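/- **Setting.** Let $M,N\ge 1$ be integers, let $\lambda_S,\lambda_R\ge 0$ and $\mu>0$. Write $\vec v=(v_1,\dots,v_M)\in\mathbb R^M$ for the velocities of a system of $M$ particles, $\vec w=(w_1,\dots,w_N)\in\mathbb R^N$ for the velocities of a reservoir of $N$ particles, and $\Gamma_n(\vec u)=\prod_{i=1}^n e^{-\pi u_i^2}$ for the Maxwellian on $\mathbb R^n$ at inverse temperature $\beta=2\pi$. For two of the $M+N$ particles $a\neq b$, with velocities $x_a,x_b$, define on $L^1(\mathbb R^{M+N})$ $$R_{a,b}[f](x)=\frac1{2\pi}\int_0^{2\pi} f(\dots,x_a\cos\theta+x_b\sin\theta,\dots,-x_a\sin\theta+x_b\cos\theta,\dots)\,d\theta$$ (only the entries $a$ and $b$ are changed); denote it by $R^S_{i,j}$ for two system particles, by $R^R_{i,j}$ for two reservoir particles, and by $R^I_{i,j}$ if $a$ is the $i$-th system particle and $b$ the $j$-th reservoir particle. Moreover, for $1\le j\le M$ let $$B_j[f](\vec v,\vec w)=\int_{\mathbb R}du\,\frac1{2\pi}\int_0^{2\pi}d\theta\; e^{-\pi(-v_j\sin\theta+u\cos\theta)^2}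 f(v_1,\dots,v_j\cos\theta+u\sin\theta,\dots,v_M,\vec w).$$ Define the bounded operators on $L^1(\mathbb R^{M+N})$ $$\mathcal L_S=\frac{\lambda_S}{M-1}\sum_{1\le i<j\le M}(R^S_{i,j}-I),\qquad \mathcal L_R=\frac{\lambda_R}{N-1}\sum_{1\le i<j\le N}(R^R_{i,j}-I),$$ (read as $0$ if $M=1$, respectively $N=1$), and $$\mathcal L=\mathcal L_S+\mathcal L_R+\frac{\mu}{N}\sum_{i=1}^M\sum_{j=1}^N(R^I_{i,j}-I),\qquad \widetilde{\mathcal L}=\mathcal L_S+\mu\sum_{j=1}^M(B_j-I);$$ $e^{t\mathcal L}$ is the evolution of the system in contact with the finite reservoir and $e^{t\widetilde{\mathcal L}}$ that of the system in contact with a Maxwellian thermostat. For $f,g\in L^1(\mathbb R^n)$ let $$d_2(f,g)=\sup_{\xi\in\mathbb R^n,\ \xi\ne0}\frac{|\widehat f(\xi)-\widehat g(\xi)|}{|\xi|^2}\in[0,\infty],\qquad \widehat f(\xi)=\int_{\mathbb R^n}e^{-2\pi i\,\xi\cdot x}f(x)\,dx,$$ be the Gabetta–Toscani–Wennberg (GTW)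 distance. **Theorem.** Let $l_0$ be a probability density on $\mathbb R^M$ that is invariant under permutations of its variables and satisfies, for all $i$, $$\int v_i\,l_0(\vec v)\,d\vec v=0,\qquad \int v_i^2\,l_0(\vec v)\,d\vec v<\infty,\qquad \int v_i^4\,l_0(\vec v)\,d\vec v=E_4<\infty ,$$ and let $f_0(\vec v,\vec w)=l_0(\vec v)\,\Gamma_N(\vec w)$. Then $d_2(l_0,\Gamma_M)<\infty$, and for every $t>0$ $$d_2\left(e^{t\widetilde{\mathcal L}}f_0,\;e^{t\mathcal L}f_0\right)\le\frac{KM}{N}\left(1-e^{-\mu t/4}\right)\sqrt{d_2(l_0,\Gamma_M)\,\bigl(F_4+d_2(l_0,\Gamma_M)\bigr)},$$ where $F_4=48\pi^4(E_4+1)$ and $K=16\sqrt2$. -/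

import Mathlib

open MeasureTheory Real Set
open scoped FourierTransform ENNReal

noncomputable section

namespace KacReservoir

/-- Velocity space of particles labelled by `ι`, with the Euclidean norm and Lebesgue measure. -/
abbrev Vel (ι : Type*) := EuclideanSpace ℝ ι

/-- The one-particle Maxwellian at inverse temperature `β = 2π`, that is
`√(β / 2π) * exp (-β w² / 2) = exp (-π w²)`. -/
def gauss (w : ℝ) : ℝ := Real.exp (-π * w ^ 2)

/-- The Maxwellian `Γ` of independent particles labelled by `ι`, at `β = 2π`. -/
def maxwellian {ι : Type*} [Fintype ι] (x : Vel ι) : ℝ := ∏ i, gauss (x i)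

/-! ### Collisions of two particles -/

/-- Velocities after particles `a` and `b` have collided with scattering angle `θ`. -/
def collide {ι : Type*} [DecidableEq ι] (a b : ι) (θ : ℝ) (x : Vel ι) : Vel ι :=
  WithLp.toLp 2 (Function.update
    (Function.update (fun i => x i) a (x a * Real.cos θ + x b * Real.sin θ))
    b (-x a * Real.sin θ + x b * Real.cos θ))

/-- `R_{a,b}[f](x)`: the mean of `f` over all outcomes of a collision between `a` and `b`. -/
def collisionMean {ι : Type*} [DecidableEq ι] (a b : ι) (f : Vel ι → ℝ) (x : Vel ι) : ℝ :=
  (2 * π)⁻¹ * ∫ θ in (0 : ℝ)..2 * π, f (collide a b θ x)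

/-! ### Collisions with the thermostat -/

/-- The velocity vector with its `j`-th entry replaced by the velocity of `j` after a collision
with a thermostat particle of velocity `w`. -/
def collideBath {ι : Type*} [DecidableEq ι] (j : ι) (θ w : ℝ) (x : Vel ι) : Vel ι :=
  WithLp.toLp 2 (Function.update (fun i => x i) j (x j * Real.cos θ + w * Real.sin θ))

/-- `B_j[f](x)`: the action of the Maxwellian thermostat on particle `j`. -/
def thermostatMean {ι : Type*} [DecidableEq ι] (j : ι) (f : Vel ι → ℝ) (x : Vel ι) : ℝ :=
  ∫ w : ℝ, (2 * π)⁻¹ * ∫ θ in (0 : ℝ)..2 * π,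
    gauss (-x j * Real.sin θ + w * Real.cos θ) * f (collideBath j θ w x)

/-! ### Both means are bounded linear operators on `L¹` -/

/-- A map `T` on functions that agrees, on integrable functions and up to null sets, with
`f ↦ ∫ K f (y, ·) dρ(y)` for a linear contractive `K`, as a bounded operator on `L¹`: the class of
`f` is sent to the class of `T f`. -/
def toL1Op {X Y : Type*} [MeasurableSpace X] [MeasurableSpace Y] {μ : Measure X} [SFinite μ]
    {ρ : Measure Y} [SFinite ρ] (T : (X → ℝ) → X → ℝ) (K : (X → ℝ) → Y × X → ℝ)
    (hT : ∀ f, Integrable f μ → T f =ᵐ[μ] fun x => ∫ y, K f (y, x) ∂ρ)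
    (hint : ∀ f, Integrable f μ → Integrable (K f) (ρ.prod μ))
    (hcongr : ∀ f g, f =ᵐ[μ] g → K f =ᵐ[ρ.prod μ] K g)
    (hadd : ∀ f g, K (f + g) = K f + K g)
    (hsmul : ∀ (c : ℝ) f, K (c • f) = c • K f)
    (hbound : ∀ f, Integrable f μ → ∫ p, ‖K f p‖ ∂(ρ.prod μ) = ∫ x, ‖f x‖ ∂μ) :
    (X →₁[μ] ℝ) →L[ℝ] (X →₁[μ] ℝ) :=
  have hTint : ∀ f, Integrable f μ → Integrable (T f) μ := fun f hf =>
    (hint f hf).integral_prod_right.congr (hT f hf).symm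
  have hTcongr : ∀ f g, Integrable f μ → f =ᵐ[μ] g → T f =ᵐ[μ] T g := fun f g hf hfg => by
    have h := Measure.ae_ae_of_ae_prod
      (Measure.measurePreserving_swap.quasiMeasurePreserving.ae (hcongr f g hfg))
    filter_upwards [hT f hf, hT g (hf.congr hfg), h] with x h1 h2 h3
    rw [h1, h2]
    exact integral_congr_ae h3
  LinearMap.mkContinuous
    { toFun := fun f => (hTint f (L1.integrable_coeFn f)).toL1 (T f)
      map_add' := fun f g => by
        have hf := L1.integrable_coeFn f
        have hg := L1.integrable_coeFn g
        rw [← Integrable.toL1_add, Integrable.toL1_eq_toL1_iff]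
        refine (hTcongr _ _ (L1.integrable_coeFn (f + g)) (Lp.coeFn_add f g)).trans ?_
        filter_upwards [hT _ hf, hT _ hg, hT _ (hf.add hg), (hint _ hf).prod_left_ae,
          (hint _ hg).prod_left_ae] with x h1 h2 h3 h4 h5
        rw [h3, Pi.add_apply, h1, h2, ← integral_add h4 h5, hadd]
        rfl
      map_smul' := fun c f => by
        have hf := L1.integrable_coeFn f
        rw [RingHom.id_apply, ← Integrable.toL1_smul, Integrable.toL1_eq_toL1_iff]
        refine (hTcongr _ _ (L1.integrable_coeFn (c • f)) (Lp.coeFn_smul c f)).trans ?_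
        filter_upwards [hT _ hf, hT _ (hf.smul c)] with x h1 h2
        rw [h2]
        change _ = c • T f x
        rw [h1, ← integral_smul, hsmul]
        rfl }
    1 (fun f => by
      have hf := L1.integrable_coeFn f
      rw [one_mul, LinearMap.coe_mk, AddHom.coe_mk, L1.norm_eq_integral_norm,
        L1.norm_eq_integral_norm, ← hbound f hf, integral_prod_symm _ (hint f hf).norm]
      refine integral_mono_ae (L1.integrable_coeFn _).norm
        (hint f hf).norm.integral_prod_right ?_
      filter_upwards [(hTint f hf).coeFn_toL1, hT f hf] with x h1 h2
      rw [h1, h2]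
      exact norm_integral_le_integral_norm _)

lemma coeFn_toL1Op {X Y : Type*} [MeasurableSpace X] [MeasurableSpace Y] {μ : Measure X} [SFinite μ]
    {ρ : Measure Y} [SFinite ρ] (T : (X → ℝ) → X → ℝ) (K : (X → ℝ) → Y × X → ℝ)
    (hT : ∀ f, Integrable f μ → T f =ᵐ[μ] fun x => ∫ y, K f (y, x) ∂ρ)
    (hint : ∀ f, Integrable f μ → Integrable (K f) (ρ.prod μ))
    (hcongr : ∀ f g, f =ᵐ[μ] g → K f =ᵐ[ρ.prod μ] K g)
    (hadd : ∀ f g, K (f + g) = K f + K g)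
    (hsmul : ∀ (c : ℝ) f, K (c • f) = c • K f)
    (hbound : ∀ f, Integrable f μ → ∫ p, ‖K f p‖ ∂(ρ.prod μ) = ∫ x, ‖f x‖ ∂μ)
    (f : X →₁[μ] ℝ) : toL1Op T K hT hint hcongr hadd hsmul hbound f =ᵐ[μ] T f :=
  Integrable.coeFn_toL1 ((hint f (L1.integrable_coeFn f)).integral_prod_right.congr
    (hT f (L1.integrable_coeFn f)).symm)

section MeasurePreserving

variable {ι : Type*} [Fintype ι] [DecidableEq ι]

lemma measurePreserving_of_norm {E : Type*} [NormedAddCommGroup E] [InnerProductSpace ℝ E]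
    [FiniteDimensional ℝ E] [MeasurableSpace E] [BorelSpace E] (A : E →ₗ[ℝ] E)
    (h : ∀ x, ‖A x‖ = ‖x‖) : MeasurePreserving A volume volume := by
  let B : E →ₗᵢ[ℝ] E := ⟨A, h⟩
  have := (B.toLinearIsometryEquiv rfl).measurePreserving
  simpa [B] using this

lemma sum_sq_update {v : ι → ℝ} {j : ι} {c : ℝ} :
    ∑ i, (Function.update v j c i) ^ 2 = ∑ i, v i ^ 2 - v j ^ 2 + c ^ 2 := by
  rw [← Finset.add_sum_erase _ _ (Finset.mem_univ j),
    ← Finset.add_sum_erase _ (fun i => v i ^ 2) (Finset.mem_univ j)]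
  have : ∑ i ∈ Finset.univ.erase j, (Function.update v j c i) ^ 2
      = ∑ i ∈ Finset.univ.erase j, v i ^ 2 :=
    Finset.sum_congr rfl fun i hi => by
      rw [Function.update_of_ne (Finset.ne_of_mem_erase hi)]
  rw [this, Function.update_self]
  ring

lemma measurePreserving_collide {a b : ι} (hab : a ≠ b) (θ : ℝ) :
    MeasurePreserving (collide a b θ : Vel ι → Vel ι) volume volume := by
  let A : Vel ι →ₗ[ℝ] Vel ι :=
    { toFun := collide a b θ
      map_add' := fun x y => by
        ext i
        by_cases hb : i = b
        · subst hb; simp [collide]; ring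
        · by_cases ha : i = a
          · subst ha; simp [collide, hb]; ring
          · simp [collide, ha, hb]
      map_smul' := fun c x => by
        ext i
        by_cases hb : i = b
        · subst hb; simp [collide]; ring
        · by_cases ha : i = a
          · subst ha; simp [collide, hb]; ring
          · simp [collide, ha, hb] }
  refine measurePreserving_of_norm A fun x => ?_
  rw [EuclideanSpace.norm_eq, EuclideanSpace.norm_eq]
  congr 1
  simp only [Real.norm_eq_abs, sq_abs]
  change ∑ i, (Function.update _ b _ i) ^ 2 = _
  rw [sum_sq_update, sum_sq_update, Function.update_of_ne hab.symm]
  linear_combination (x a ^ 2 + x b ^ 2) * Real.sin_sq_add_cos_sq θ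

/-- A collision between particle `j` and a thermostat particle, as a map of both velocities. -/
def bathRotation (j : ι) (θ : ℝ) (p : Vel ι × ℝ) : Vel ι × ℝ :=
  (collideBath j θ p.2 p.1, -p.1 j * Real.sin θ + p.2 * Real.cos θ)

lemma measurePreserving_bathRotation (j : ι) (θ : ℝ) :
    MeasurePreserving (bathRotation j θ : Vel ι × ℝ → Vel ι × ℝ) volume volume := by
  let A : WithLp 2 (Vel ι × ℝ) →ₗ[ℝ] WithLp 2 (Vel ι × ℝ) :=
    { toFun := fun p => WithLp.toLp 2 (bathRotation j θ (WithLp.ofLp p))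
      map_add' := fun x y => by
        refine congrArg (WithLp.toLp 2) (Prod.ext ?_ ?_)
        · ext i
          by_cases hj : i = j
          · subst hj; simp [bathRotation, collideBath]; ring
          · simp [bathRotation, collideBath, hj]
        · simp [bathRotation]; ring
      map_smul' := fun c x => by
        refine congrArg (WithLp.toLp 2) (Prod.ext ?_ ?_)
        · ext i
          by_cases hj : i = j
          · subst hj; simp [bathRotation, collideBath]; ring
          · simp [bathRotation, collideBath, hj]
        · simp [bathRotation]; ring }
  have hA := measurePreserving_of_norm A fun x => by
    have h2 : ‖A x‖ ^ 2 = ‖x‖ ^ 2 := by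
      rw [WithLp.prod_norm_sq_eq_of_L2, WithLp.prod_norm_sq_eq_of_L2,
        EuclideanSpace.norm_sq_eq, EuclideanSpace.norm_sq_eq]
      simp only [Real.norm_eq_abs, sq_abs]
      change ∑ i, (Function.update (fun i => x.fst i) j
          (x.fst j * Real.cos θ + x.snd * Real.sin θ) i) ^ 2
        + (-x.fst j * Real.sin θ + x.snd * Real.cos θ) ^ 2 = _
      rw [sum_sq_update]
      linear_combination (x.fst j ^ 2 + x.snd ^ 2) * Real.sin_sq_add_cos_sq θ
    exact (sq_eq_sq₀ (norm_nonneg _) (norm_nonneg _)).1 h2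
  exact (WithLp.volume_preserving_ofLp (Vel ι) ℝ).comp
    (hA.comp (WithLp.volume_preserving_toLp (Vel ι) ℝ))

lemma measurePreserving_angle_collide {a b : ι} (hab : a ≠ b) (ρ : Measure ℝ) [SFinite ρ] :
    MeasurePreserving (fun p : ℝ × Vel ι => (p.1, collide a b p.1 p.2))
      (ρ.prod volume) (ρ.prod volume) := by
  refine (MeasurePreserving.id ρ).skew_product (g := fun θ x => collide a b θ x) ?_
    (Filter.Eventually.of_forall fun θ => (measurePreserving_collide hab θ).map_eq)
  refine (WithLp.measurable_toLp 2 _).comp (measurable_pi_lambda _ fun i => ?_)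
  by_cases hb : i = b
  · subst hb
    simp only [Function.update_self]
    fun_prop
  · by_cases ha : i = a
    · subst ha
      simp only [Function.update_of_ne hb, Function.update_self]
      fun_prop
    · simp only [Function.update_of_ne hb, Function.update_of_ne ha]
      fun_prop

lemma measurePreserving_angle_bath (j : ι) (ρ : Measure ℝ) [SFinite ρ] :
    MeasurePreserving (fun p : ℝ × (Vel ι × ℝ) => (p.1, bathRotation j p.1 p.2))
      (ρ.prod volume) (ρ.prod volume) := by
  refine (MeasurePreserving.id ρ).skew_product (g := fun θ x => bathRotation j θ x) ?_
    (Filter.Eventually.of_forall fun θ => (measurePreserving_bathRotation j θ).map_eq)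
  refine Measurable.prodMk ?_ (by fun_prop)
  refine (WithLp.measurable_toLp 2 _).comp (measurable_pi_lambda _ fun i => ?_)
  by_cases hj : i = j
  · subst hj
    simp only [Function.update_self]
    fun_prop
  · simp only [Function.update_of_ne hj]
    fun_prop

end MeasurePreserving

section Operators

variable {ι : Type*} [Fintype ι] [DecidableEq ι]

lemma gauss_nonneg (w : ℝ) : 0 ≤ gauss w := (Real.exp_pos _).le

lemma integrable_gauss : Integrable gauss := integrable_exp_neg_mul_sq Real.pi_pos

lemma integral_gauss : ∫ w, gauss w = 1 := by
  have h := integral_gaussian π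
  rwa [div_self Real.pi_ne_zero, Real.sqrt_one] at h

/-- The collision operator `R_{a,b}` on `L¹`: the class of `f` is sent to the class of
`collisionMean a b f`. -/
def collisionOp (a b : ι) (hab : a ≠ b) :
    (Vel ι →₁[volume] ℝ) →L[ℝ] (Vel ι →₁[volume] ℝ) :=
  toL1Op (ρ := volume.restrict (Ioc 0 (2 * π))) (collisionMean a b)
    (fun f p => (2 * π)⁻¹ * f (collide a b p.1 p.2))
    (fun f _ => Filter.Eventually.of_forall fun x => by
      simp only [collisionMean]
      rw [intervalIntegral.integral_of_le Real.two_pi_pos.le, integral_const_mul])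
    (fun f hf => ((measurePreserving_angle_collide hab _).integrable_comp_of_integrable
      (g := fun p : ℝ × Vel ι => f p.2) (hf.comp_snd _)).const_mul _)
    (fun f g hfg => by
      have h : (fun p : ℝ × Vel ι => f p.2) =ᵐ[(volume.restrict (Ioc 0 (2 * π))).prod volume]
          fun p => g p.2 := Measure.quasiMeasurePreserving_snd.ae_eq_comp hfg
      filter_upwards [(measurePreserving_angle_collide hab _).quasiMeasurePreserving.ae_eq_comp h]
        with p hp
      simp only [Function.comp] at hp
      rw [hp])
    (fun f g => by ext p; simp [mul_add])
    (fun c f => by ext p; simp only [Pi.smul_apply, smul_eq_mul]; ring)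
    (fun f hf => by
      have hmp := measurePreserving_angle_collide hab (volume.restrict (Ioc 0 (2 * π)))
      have hi : Integrable (fun p : ℝ × Vel ι => ‖f p.2‖)
          ((volume.restrict (Ioc 0 (2 * π))).prod volume) := hf.norm.comp_snd _
      have h1 : ∫ p, ‖f (collide a b p.1 p.2)‖ ∂((volume.restrict (Ioc 0 (2 * π))).prod volume)
          = ∫ p : ℝ × Vel ι, ‖f p.2‖ ∂((volume.restrict (Ioc 0 (2 * π))).prod volume) := by
        conv_rhs => rw [← hmp.map_eq]
        rw [integral_map hmp.aemeasurable (by rw [hmp.map_eq]; exact hi.1)]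
      simp only [norm_mul]
      rw [integral_const_mul, h1, integral_prod _ hi]
      simp only [integral_const, smul_eq_mul, measureReal_restrict_apply_univ,
        Real.volume_real_Ioc_of_le Real.two_pi_pos.le, sub_zero, norm_inv, Real.norm_eq_abs,
        abs_of_pos Real.two_pi_pos]
      rw [← mul_assoc, inv_mul_cancel₀ Real.two_pi_pos.ne', one_mul])

/-- Reordering of (scattering angle, thermostat velocity, velocities), followed by a collision. -/
def bathMap (j : ι) (p : (ℝ × ℝ) × Vel ι) : ℝ × (Vel ι × ℝ) :=
  (p.1.1, bathRotation j p.1.1 (p.2, p.1.2))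

lemma measurePreserving_bathMap (j : ι) (ρ : Measure ℝ) [SFinite ρ] :
    MeasurePreserving (bathMap j : (ℝ × ℝ) × Vel ι → ℝ × (Vel ι × ℝ))
      ((ρ.prod volume).prod volume) (ρ.prod volume) := by
  have h1 : MeasurePreserving (MeasurableEquiv.prodAssoc : (ℝ × ℝ) × Vel ι ≃ᵐ ℝ × (ℝ × Vel ι))
      ((ρ.prod volume).prod volume) (ρ.prod (volume.prod volume)) :=
    measurePreserving_prodAssoc ρ volume volume
  have h2 : MeasurePreserving (Prod.map id Prod.swap : ℝ × (ℝ × Vel ι) → ℝ × (Vel ι × ℝ))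
      (ρ.prod (volume.prod volume)) (ρ.prod (volume.prod volume)) :=
    (MeasurePreserving.id ρ).prod Measure.measurePreserving_swap
  exact (measurePreserving_angle_bath j ρ).comp (h2.comp h1)

lemma integrable_bath {ι : Type*} [Fintype ι] {ρ : Measure ℝ} [IsFiniteMeasure ρ] {f : Vel ι → ℝ}
    (hf : Integrable f) :
    Integrable (fun p : ℝ × (Vel ι × ℝ) => gauss p.2.2 * f p.2.1) (ρ.prod volume) := by
  have h : Integrable (fun q : Vel ι × ℝ => gauss q.2 * f q.1) := by
    have h' := hf.mul_prod integrable_gauss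
    simp only [mul_comm] at h' ⊢
    exact h'
  exact h.comp_snd ρ

lemma integrable_bathKernel (j : ι) (f : Vel ι → ℝ) (hf : Integrable f) :
    Integrable (fun p : (ℝ × ℝ) × Vel ι =>
      (2 * π)⁻¹ * (gauss (bathMap j p).2.2 * f (bathMap j p).2.1))
      (((volume.restrict (Ioc 0 (2 * π))).prod volume).prod volume) :=
  ((measurePreserving_bathMap j _).integrable_comp_of_integrable
    (g := fun p : ℝ × (Vel ι × ℝ) => gauss p.2.2 * f p.2.1)
    (integrable_bath hf)).const_mul _

/-- The thermostat operator `B_j` on `L¹`: the class of `f` is sent to the class of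
`thermostatMean j f`. -/
def thermostatOp (j : ι) : (Vel ι →₁[volume] ℝ) →L[ℝ] (Vel ι →₁[volume] ℝ) :=
  toL1Op (ρ := (volume.restrict (Ioc 0 (2 * π))).prod volume) (thermostatMean j)
    (fun f p => (2 * π)⁻¹ * (gauss (bathMap j p).2.2 * f (bathMap j p).2.1))
    (fun f hf => by
      filter_upwards [(integrable_bathKernel j f hf).prod_left_ae] with x hx
      rw [integral_prod_symm _ hx]
      simp only [thermostatMean]
      congr 1
      ext w
      rw [intervalIntegral.integral_of_le Real.two_pi_pos.le, ← integral_const_mul]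
      rfl)
    (integrable_bathKernel j)
    (fun f g hfg => by
      have h : (fun p : ℝ × (Vel ι × ℝ) => f p.2.1)
          =ᵐ[(volume.restrict (Ioc 0 (2 * π))).prod volume] fun p => g p.2.1 :=
        (Measure.quasiMeasurePreserving_fst.comp
          Measure.quasiMeasurePreserving_snd).ae_eq_comp hfg
      filter_upwards [(measurePreserving_bathMap j _).quasiMeasurePreserving.ae_eq_comp h]
        with p hp
      simp only [Function.comp] at hp
      rw [hp])
    (fun f g => by ext p; simp [mul_add])
    (fun c f => by ext p; simp only [Pi.smul_apply, smul_eq_mul]; ring)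
    (fun f hf => by
      have hmp := measurePreserving_bathMap j (volume.restrict (Ioc 0 (2 * π))) (ι := ι)
      have hi := (integrable_bath (ρ := volume.restrict (Ioc 0 (2 * π))) hf).norm
      have h1 : ∫ p, ‖gauss (bathMap j p).2.2 * f (bathMap j p).2.1‖
            ∂(((volume.restrict (Ioc 0 (2 * π))).prod volume).prod volume)
          = ∫ p : ℝ × (Vel ι × ℝ), ‖gauss p.2.2 * f p.2.1‖
            ∂((volume.restrict (Ioc 0 (2 * π))).prod volume) := by
        conv_rhs => rw [← hmp.map_eq]
        rw [integral_map hmp.aemeasurable (by rw [hmp.map_eq]; exact hi.1)]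
      have h2 : ∫ q : Vel ι × ℝ, ‖gauss q.2 * f q.1‖ = ∫ x, ‖f x‖ := by
        have : ∀ q : Vel ι × ℝ, ‖gauss q.2 * f q.1‖ = ‖f q.1‖ * gauss q.2 := fun q => by
          rw [norm_mul, Real.norm_of_nonneg (gauss_nonneg _), mul_comm]
        simp_rw [this]
        refine (integral_prod_mul (fun x : Vel ι => ‖f x‖) gauss).trans ?_
        rw [integral_gauss, mul_one]
      have h3 : ∀ p, ‖(2 * π)⁻¹ * (gauss (bathMap j p).2.2 * f (bathMap j p).2.1)‖
          = (2 * π)⁻¹ * ‖gauss (bathMap j p).2.2 * f (bathMap j p).2.1‖ := fun p => by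
        rw [norm_mul, norm_inv, Real.norm_of_nonneg Real.two_pi_pos.le]
      simp_rw [h3]
      rw [integral_const_mul, h1, integral_prod _ hi]
      simp only [h2, integral_const, smul_eq_mul, measureReal_restrict_apply_univ,
        Real.volume_real_Ioc_of_le Real.two_pi_pos.le, sub_zero]
      rw [← mul_assoc, inv_mul_cancel₀ Real.two_pi_pos.ne', one_mul])

lemma coeFn_collisionOp (a b : ι) (hab : a ≠ b) (f : Vel ι →₁[volume] ℝ) :
    collisionOp a b hab f =ᵐ[volume] collisionMean a b f :=
  coeFn_toL1Op (ρ := volume.restrict (Ioc 0 (2 * π))) _ _ _ _ _ _ _ _ f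

lemma coeFn_thermostatOp (j : ι) (f : Vel ι →₁[volume] ℝ) :
    thermostatOp j f =ᵐ[volume] thermostatMean j f :=
  coeFn_toL1Op (ρ := (volume.restrict (Ioc 0 (2 * π))).prod (volume : Measure ℝ)) _ _ _ _ _ _ _ _ f

end Operators

/-! ### Generators and evolutions

The `M` particles of the system carry the labels `Sum.inl i`, the `N` particles of the reservoir
the labels `Sum.inr j`. -/

/-- States (`L¹` functions of all `M + N` velocities). -/
abbrev State (M N : ℕ) := Vel (Fin M ⊕ Fin N) →₁[volume] ℝ

/-- `L_S`: Kac collisions inside the system. -/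
def genS (M N : ℕ) (lamS : ℝ) : State M N →L[ℝ] State M N :=
  (lamS / ((M : ℝ) - 1)) • ∑ p : {p : Fin M × Fin M // p.1 < p.2},
    (collisionOp (Sum.inl p.1.1) (Sum.inl p.1.2) (Sum.inl_injective.ne p.2.ne) - 1)

/-- `L_R`: Kac collisions inside the reservoir. -/
def genR (M N : ℕ) (lamR : ℝ) : State M N →L[ℝ] State M N :=
  (lamR / ((N : ℝ) - 1)) • ∑ p : {p : Fin N × Fin N // p.1 < p.2},
    (collisionOp (Sum.inr p.1.1) (Sum.inr p.1.2) (Sum.inr_injective.ne p.2.ne) - 1)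

/-- `L_I`: collisions between system and reservoir. -/
def genI (M N : ℕ) (mu : ℝ) : State M N →L[ℝ] State M N :=
  (mu / (N : ℝ)) • ∑ i : Fin M, ∑ j : Fin N,
    (collisionOp (Sum.inl i) (Sum.inr j) Sum.inl_ne_inr - 1)

/-- `L_T`: collisions between the system and the Maxwellian thermostat. -/
def genT (M N : ℕ) (mu : ℝ) : State M N →L[ℝ] State M N :=
  mu • ∑ i : Fin M, (thermostatOp (Sum.inl i) - 1)

/-- Generator of the system in contact with the finite reservoir. -/
def genFinite (M N : ℕ) (lamS lamR mu : ℝ) : State M N →L[ℝ] State M N :=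
  genS M N lamS + genR M N lamR + genI M N mu

/-- Generator of the system in contact with the thermostat (the reservoir velocities are left
alone). -/
def genThermostat (M N : ℕ) (lamS mu : ℝ) : State M N →L[ℝ] State M N :=
  genS M N lamS + genT M N mu

/-- System velocities. -/
def sysPart {M N : ℕ} (x : Vel (Fin M ⊕ Fin N)) : Vel (Fin M) :=
  WithLp.toLp 2 fun i => x (Sum.inl i)

/-- Reservoir velocities. -/
def resPart {M N : ℕ} (x : Vel (Fin M ⊕ Fin N)) : Vel (Fin N) :=
  WithLp.toLp 2 fun j => x (Sum.inr j)

lemma integrable_maxwellian {ι : Type*} [Fintype ι] :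
    Integrable (maxwellian : Vel ι → ℝ) := by
  have h : Integrable (fun x : ι → ℝ => ∏ i, gauss (x i)) :=
    Integrable.fintype_prod fun _ => integrable_gauss
  exact (PiLp.volume_preserving_ofLp ι).integrable_comp_of_integrable h

lemma measurePreserving_split (M N : ℕ) :
    MeasurePreserving (fun x : Vel (Fin M ⊕ Fin N) => (sysPart x, resPart x)) volume volume := by
  have h1 := PiLp.volume_preserving_ofLp (Fin M ⊕ Fin N)
  have h2 := volume_measurePreserving_sumPiEquivProdPi (fun _ : Fin M ⊕ Fin N => ℝ)
  have h3 := (PiLp.volume_preserving_toLp (Fin M)).prod (PiLp.volume_preserving_toLp (Fin N))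
  exact h3.comp (h2.comp h1)

lemma integrable_initial {M N : ℕ} {l : Vel (Fin M) → ℝ} (hl : Integrable l) :
    Integrable (fun x : Vel (Fin M ⊕ Fin N) => l (sysPart x) * maxwellian (resPart x)) :=
  (measurePreserving_split M N).integrable_comp_of_integrable
    (g := fun p : Vel (Fin M) × Vel (Fin N) => l p.1 * maxwellian p.2)
    (hl.mul_prod integrable_maxwellian)

/-- The initial state `f₀(v, w) = l(v) Γ_N(w)`. -/
def initialState {M : ℕ} (N : ℕ) {l : Vel (Fin M) → ℝ} (hl : Integrable l) : State M N :=
  (integrable_initial hl).toL1 _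

/-- The state at time `t` of the system in contact with the finite reservoir. -/
def finiteEvolution {M N : ℕ} (lamS lamR mu t : ℝ) (f : State M N) : State M N :=
  NormedSpace.exp (t • genFinite M N lamS lamR mu) f

/-- The state at time `t` of the system in contact with the thermostat. -/
def thermostatEvolution {M N : ℕ} (lamS mu t : ℝ) (f : State M N) : State M N :=
  NormedSpace.exp (t • genThermostat M N lamS mu) f

/-! ### The Gabetta-Toscani-Wennberg distance -/

/-- `d₂(f, g) = sup_{ξ ≠ 0} |f̂(ξ) - ĝ(ξ)| / |ξ|²` in `[0, ∞]`, where
`f̂(ξ) = ∫ exp (-2πi⟨ξ, v⟩) f(v) dv`. -/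
def gtwDist {ι : Type*} [Fintype ι] (f g : Vel ι → ℝ) : ℝ≥0∞ :=
  ⨆ (ξ : Vel ι) (_ : ξ ≠ 0),
    ENNReal.ofReal (‖𝓕 (fun v => (f v : ℂ)) ξ - 𝓕 (fun v => (g v : ℂ)) ξ‖ / ‖ξ‖ ^ 2)

end KacReservoir

end

open KacReservoir

noncomputable section

namespace KacReservoir

/-! Write `f_s` for the thermostat evolution at time `s`. By Duhamel's formula the difference of the
two evolutions is the integral over `s ∈ [0, t]` of the finite-reservoir evolution for time `t - s`
applied to `(genThermostat - genFinite) f_s`. On the Fourier side every collision is an average over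
rotations of the frequency, so the finite-reservoir evolution does not increase a bound of the form
`C * ‖ζ‖ ^ 2` (`norm_fourierAt_finiteEvolution_le`). It remains to bound the transform of
`(genThermostat - genFinite) f_s` by a multiple of `‖ζ‖ ^ 2 / N` that decays in `s`.

Three facts about `f_s` are used, collected in `CloseToEquilibrium`: the reservoir stays Maxwellian
and independent of the system; the deviation of the transform from that of the Maxwellian is at most
`D_s * ‖sysPart ζ‖ ^ 2` with `D_s = exp (-μ s / 2) * D` and `D = d₂(l₀, Γ)`; the second and fourth
moments stay bounded. Each says that an extended seminorm, here a `Gauge`, does not grow, or decays,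
under the exponential of a sum of averaging operators minus a scalar (`Gauge.exp_generator_le`).

For such a state the collisions inside the reservoir do nothing, so the generator difference is `μ /
N` times the sum over `i, j` of (thermostat collision of `i`) minus (collision of `i` with `j`). Let
`x, y` be the frequencies of `i, j`, `g` the Gaussian, and `κ` the deviation as a function of the
`i`-th frequency alone. Up to a Gaussian factor in the other reservoir frequencies, the difference
compares the angular means of `κ(x cos θ) g(x sin θ) g(y)` and `κ(x cos θ + y sin θ) g(-x sin θ + y
cos θ)`. A shift of the angle turns the second into the mean of `κ(r cos θ) g(r sin θ)` with `r² =
x² + y²`, and only the even part of `κ` matters. That part has zero derivative at the origin, so the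
change from radius `|x|` to `r` is controlled by `r² - x² = y²` and a bound on `κ''`
(`norm_angleMean_difference_le`). Interpolating between the smallness `D_s` of `κ` and the fourth
moments bounds `κ''` by a multiple of `√(D_s L)` (`norm_second_deriv_le`); this is the origin of the
square root in the theorem.

In the sum over `j` the part proportional to `‖sysPart ζ‖ ^ 2` carries the weights `(1 - g(y_j))
∏_{k ≠ j} g(y_k)`, whose total is at most one (`sum_one_sub_mul_prod_erase_le`), while the `y_j ^ 2`
add up to `‖resPart ζ‖ ^ 2`. No factor `N` is produced, so the `1 / N` of the coupling survives.
Finally `√D_s` decays at rate `μ / 4`, and integrating in time gives `5 * 4 = 20 ≤ 16 √2`. -/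

/-! ### Gauges and exponentials of operators -/

/-- An extended seminorm that is lower semicontinuous, given by its sublevel sets. -/
structure Gauge (E : Type*) [NormedAddCommGroup E] [NormedSpace ℝ E] where
  /-- `Le x C`: the gauge of `x` is at most `C`. -/
  Le : E → ℝ → Prop
  mono : ∀ {x a b}, 0 ≤ a → a ≤ b → Le x a → Le x b
  add : ∀ {x y a b}, 0 ≤ a → 0 ≤ b → Le x a → Le y b → Le (x + y) (a + b)
  smul : ∀ {x a c}, 0 ≤ a → 0 ≤ c → Le x a → Le (c • x) (c * a)
  closed : ∀ {u : ℕ → E} {x a}, 0 ≤ a → Filter.Tendsto u Filter.atTop (nhds x) →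
    (∀ n, Le (u n) a) → Le x a

section Gauge

variable {E : Type*} [NormedAddCommGroup E] [NormedSpace ℝ E]

/-- `Q` enlarges the gauge by a factor of at most `q`. -/
def Gauge.OpLe (G : Gauge E) (Q : E →L[ℝ] E) (q : ℝ) : Prop :=
  ∀ x C, 0 ≤ C → G.Le x C → G.Le (Q x) (q * C)

lemma Gauge.OpLe.add {G : Gauge E} {P Q : E →L[ℝ] E} {p q : ℝ} (hp : 0 ≤ p) (hq : 0 ≤ q)
    (hP : G.OpLe P p) (hQ : G.OpLe Q q) : G.OpLe (P + Q) (p + q) := fun x C hC hx => by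
  rw [add_mul]
  exact G.add (mul_nonneg hp hC) (mul_nonneg hq hC) (hP x C hC hx) (hQ x C hC hx)

lemma Gauge.OpLe.smul {G : Gauge E} {P : E →L[ℝ] E} {p c : ℝ} (hp : 0 ≤ p) (hc : 0 ≤ c)
    (hP : G.OpLe P p) : G.OpLe (c • P) (c * p) := fun x C hC hx => by
  rw [mul_assoc]
  exact G.smul (mul_nonneg hp hC) hc (hP x C hC hx)

lemma Gauge.OpLe.sum {G : Gauge E} {α : Type*} (s : Finset α) {P : α → E →L[ℝ] E}
    (hP : ∀ i ∈ s, G.OpLe (P i) 1) : G.OpLe (∑ i ∈ s, P i) s.card := by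
  classical
  induction s using Finset.induction_on with
  | empty =>
    intro x C hC hx
    -- The gauge of zero is not an axiom; it is obtained by scaling `x` by `0`.
    have := G.smul hC le_rfl hx
    simpa using this
  | insert a s ha ih =>
    rw [Finset.sum_insert ha, Finset.card_insert_of_notMem ha, Nat.cast_succ, add_comm (s.card : ℝ)]
    exact Gauge.OpLe.add zero_le_one (Nat.cast_nonneg _) (hP a (Finset.mem_insert_self _ _))
      (ih fun i hi => hP i (Finset.mem_insert_of_mem hi))

variable [CompleteSpace E]

lemma hasSum_exp_apply (Q : E →L[ℝ] E) (x : E) :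
    HasSum (fun n : ℕ => ((n.factorial : ℝ)⁻¹) • (Q ^ n) x) (NormedSpace.exp Q x) := by
  have h := NormedSpace.exp_series_hasSum_exp' (𝕂 := ℝ) Q
  simpa using h.mapL (ContinuousLinearMap.apply ℝ E x)

/-- The terms of the exponential series have gauge at most `q ^ n * C / n!` and nonnegative
coefficients, so partial sums are controlled by the axioms and the limit by lower semicontinuity. -/
lemma Gauge.exp_le (G : Gauge E) {Q : E →L[ℝ] E} {q : ℝ} (hq : 0 ≤ q) (hQ : G.OpLe Q q)
    {x : E} {C : ℝ} (hC : 0 ≤ C) (hx : G.Le x C) :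
    G.Le (NormedSpace.exp Q x) (Real.exp q * C) := by
  have hpow : ∀ n : ℕ, G.Le ((Q ^ n) x) (q ^ n * C) := by
    intro n
    induction n with
    | zero => simpa using hx
    | succ n ih =>
      rw [pow_succ', pow_succ', mul_assoc]
      exact hQ _ _ (by positivity) ih
  have hpart : ∀ n : ℕ, G.Le (∑ k ∈ Finset.range n, ((k.factorial : ℝ)⁻¹) • (Q ^ k) x)
      (∑ k ∈ Finset.range n, ((k.factorial : ℝ)⁻¹) * (q ^ k * C)) := by
    intro n
    induction n with
    | zero => simpa using G.smul hC le_rfl hx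
    | succ n ih =>
      rw [Finset.sum_range_succ, Finset.sum_range_succ]
      exact G.add (Finset.sum_nonneg fun k _ => by positivity) (by positivity) ih
        (G.smul (by positivity) (by positivity) (hpow n))
  have hs : HasSum (fun n : ℕ => ((n.factorial : ℝ)⁻¹) * (q ^ n * C)) (Real.exp q * C) := by
    have h := NormedSpace.exp_series_hasSum_exp' (𝕂 := ℝ) q
    rw [← Real.exp_eq_exp_ℝ] at h
    simpa [mul_assoc] using h.mul_right C
  refine G.closed (by positivity) (hasSum_exp_apply Q x).tendsto_sum_nat fun n => ?_
  refine G.mono (Finset.sum_nonneg fun k _ => by positivity) ?_ (hpart n)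
  exact sum_le_hasSum _ (fun k _ => by positivity) hs

/-- The evolution generated by `Q - c` multiplies the gauge by at most `exp (t (q - c))`. -/
lemma Gauge.exp_generator_le (G : Gauge E) {Q A : E →L[ℝ] E} {q c t : ℝ} (hq : 0 ≤ q)
    (ht : 0 ≤ t) (hA : A = Q - c • 1) (hQ : G.OpLe Q q)
    {x : E} {C : ℝ} (hC : 0 ≤ C) (hx : G.Le x C) :
    G.Le (NormedSpace.exp (t • A) x) (Real.exp (t * (q - c)) * C) := by
  let _ : NormedAlgebra ℚ (E →L[ℝ] E) := NormedAlgebra.restrictScalars ℚ ℝ (E →L[ℝ] E)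
  -- The loss term `-c` is scalar and commutes with `Q`, so it leaves the exponential as the factor
  -- `exp (-t c)`. Estimating the series of `A` directly would lose this sign.
  have h1 : t • A = algebraMap ℝ (E →L[ℝ] E) (-(t * c)) + t • Q := by
    rw [hA, Algebra.algebraMap_eq_smul_one, smul_sub, smul_smul, neg_smul]
    abel
  have h2 : NormedSpace.exp (t • A) x = Real.exp (-(t * c)) • NormedSpace.exp (t • Q) x := by
    rw [h1, NormedSpace.exp_add_of_commute (Algebra.commutes _ _),
      ← NormedSpace.algebraMap_exp_comm, ← Real.exp_eq_exp_ℝ, Algebra.algebraMap_eq_smul_one]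
    simp
  have h3 : Real.exp (t * (q - c)) * C = Real.exp (-(t * c)) * (Real.exp (t * q) * C) := by
    rw [← mul_assoc, ← Real.exp_add]
    ring_nf
  rw [h2, h3]
  exact G.smul (by positivity) (Real.exp_pos _).le
    (G.exp_le (mul_nonneg ht hq) (hQ.smul hq ht) hC hx)

end Gauge

/-- The gauge `sup |ψ i x| / w i` of a family of continuous functionals. -/
def functionalGauge {E : Type*} [NormedAddCommGroup E] [NormedSpace ℝ E] {α : Type*}
    (ψ : α → E →L[ℝ] ℂ) (w : α → ℝ) (hw : ∀ i, 0 ≤ w i) : Gauge E where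
  Le x C := ∀ i, ‖ψ i x‖ ≤ C * w i
  mono := fun _ hab h i => (h i).trans (mul_le_mul_of_nonneg_right hab (hw i))
  add := fun _ _ hx hy i => by
    rw [map_add, add_mul]
    exact (norm_add_le _ _).trans (add_le_add (hx i) (hy i))
  smul := fun _ hc hx i => by
    rw [map_smul, norm_smul, Real.norm_of_nonneg hc, mul_assoc]
    exact mul_le_mul_of_nonneg_left (hx i) hc
  closed := fun _ hu h i =>
    le_of_tendsto (((ψ i).continuous.tendsto _).comp hu).norm
      (Filter.Eventually.of_forall fun n => h n i)

lemma aemeasurable_weight_mul_enorm {X : Type*} [MeasurableSpace X] {μ : Measure X} {W : X → ℝ}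
    (hW : Measurable W) (f : X →₁[μ] ℝ) :
    AEMeasurable (fun x => ENNReal.ofReal (W x) * ‖f x‖ₑ) μ :=
  hW.ennreal_ofReal.aemeasurable.mul (Lp.aestronglyMeasurable f).enorm

/-- The gauge `sup ∫ W i |f|` on `L¹` of a family of weights. -/
def weightGauge {X : Type*} [MeasurableSpace X] (μ : Measure X) {α : Type*}
    (W : α → X → ℝ) (hW : ∀ i, Measurable (W i)) : Gauge (X →₁[μ] ℝ) where
  Le f C := ∀ i, ∫⁻ x, ENNReal.ofReal (W i x) * ‖f x‖ₑ ∂μ ≤ ENNReal.ofReal C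
  mono := fun _ hab h i => (h i).trans (ENNReal.ofReal_le_ofReal hab)
  add := fun {f g a b} ha hb hf hg i => by
    rw [ENNReal.ofReal_add ha hb]
    refine le_trans ?_ (add_le_add (hf i) (hg i))
    rw [← lintegral_add_left' (aemeasurable_weight_mul_enorm (hW i) f)]
    refine lintegral_mono_ae ?_
    filter_upwards [Lp.coeFn_add f g] with x hx
    rw [hx, Pi.add_apply, ← mul_add]
    gcongr
    exact enorm_add_le _ _
  smul := fun {f a c} ha hc hf i => by
    rw [ENNReal.ofReal_mul hc]
    refine le_trans ?_ (mul_le_mul_right (hf i) _)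
    rw [← lintegral_const_mul'' _ (aemeasurable_weight_mul_enorm (hW i) f)]
    refine lintegral_mono_ae ?_
    filter_upwards [Lp.coeFn_smul c f] with x hx
    rw [hx, Pi.smul_apply, enorm_smul, Real.enorm_of_nonneg hc]
    exact (mul_left_comm _ _ _).le
  closed := fun {u f a} ha hu h i => by
    -- The weights may be unbounded, so convergence in `L¹` does not pass to the weighted integrals;
    -- Fatou's lemma along an almost everywhere convergent subsequence suffices for the inequality.
    obtain ⟨ns, -, hns⟩ := (tendstoInMeasure_of_tendsto_Lp hu).exists_seq_tendsto_ae
    have hlim : ∀ᵐ x ∂μ, ENNReal.ofReal (W i x) * ‖f x‖ₑ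
        = Filter.liminf (fun n => ENNReal.ofReal (W i x) * ‖u (ns n) x‖ₑ) Filter.atTop := by
      filter_upwards [hns] with x hx
      exact (ENNReal.Tendsto.const_mul (hx.enorm) (Or.inr ENNReal.ofReal_ne_top)).liminf_eq.symm
    rw [lintegral_congr_ae hlim]
    refine (lintegral_liminf_le' fun n => aemeasurable_weight_mul_enorm (hW i) _).trans ?_
    refine Filter.liminf_le_of_le (by isBoundedDefault) fun b hb => ?_
    obtain ⟨n, hn⟩ := hb.exists
    exact hn.trans (h (ns n) i)

/-! ### Duality for the collision operators -/

lemma integral_mul_of_ae_eq_integral {X Y : Type*} [MeasurableSpace X] [MeasurableSpace Y]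
    {μ : Measure X} [SFinite μ] {ρ : Measure Y} [SFinite ρ] {h : X → ℝ} {k : Y × X → ℝ}
    (hk : Integrable k (ρ.prod μ)) (hh : h =ᵐ[μ] fun x => ∫ y, k (y, x) ∂ρ)
    {φ : X → ℂ} (hφ : Measurable φ) (hφ1 : ∀ x, ‖φ x‖ ≤ 1) :
    ∫ x, φ x * (h x : ℂ) ∂μ = ∫ p, φ p.2 * (k p : ℂ) ∂(ρ.prod μ) := by
  have hi : Integrable (fun p : Y × X => φ p.2 * (k p : ℂ)) (ρ.prod μ) :=
    hk.ofReal.bdd_mul (c := 1) (hφ.comp measurable_snd).aestronglyMeasurable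
      (Filter.Eventually.of_forall fun p => hφ1 p.2)
  rw [integral_prod_symm _ hi]
  refine integral_congr_ae ?_
  filter_upwards [hh] with x hx
  rw [hx, integral_const_mul, integral_complex_ofReal]

lemma lintegral_mul_of_ae_eq_integral {X Y : Type*} [MeasurableSpace X] [MeasurableSpace Y]
    {μ : Measure X} [SFinite μ] {ρ : Measure Y} [SFinite ρ] {h : X → ℝ} {k : Y × X → ℝ}
    (hk : Integrable k (ρ.prod μ)) (hh : h =ᵐ[μ] fun x => ∫ y, k (y, x) ∂ρ)
    {W : X → ℝ≥0∞} (hW : Measurable W) :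
    ∫⁻ x, W x * ‖h x‖ₑ ∂μ ≤ ∫⁻ p, W p.2 * ‖k p‖ₑ ∂(ρ.prod μ) := by
  have hm : AEMeasurable (fun p : Y × X => W p.2 * ‖k p‖ₑ) (ρ.prod μ) :=
    (hW.comp measurable_snd).aemeasurable.mul hk.1.enorm
  rw [lintegral_prod_symm _ hm]
  refine lintegral_mono_ae ?_
  filter_upwards [hh, hk.prod_left_ae] with x hx hx'
  rw [hx, lintegral_const_mul'' _ hx'.1.enorm]
  gcongr
  exact enorm_integral_le_lintegral_enorm _

section Adjoint

variable {ι : Type*} [DecidableEq ι]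

lemma collide_neg_collide {a b : ι} (hab : a ≠ b) (θ : ℝ) (x : Vel ι) :
    collide a b (-θ) (collide a b θ x) = x := by
  ext i
  by_cases hb : i = b
  · subst hb
    simp [collide, hab]
    linear_combination (x i) * Real.sin_sq_add_cos_sq θ
  · by_cases ha : i = a
    · subst ha
      simp [collide, hb]
      linear_combination (x i) * Real.sin_sq_add_cos_sq θ
    · simp [collide, ha, hb]

lemma collideBath_neg_bathRotation (j : ι) (θ : ℝ) (p : Vel ι × ℝ) :
    collideBath j (-θ) (bathRotation j θ p).2 (bathRotation j θ p).1 = p.1 := by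
  ext i
  by_cases hj : i = j
  · subst hj
    simp [collideBath, bathRotation]
    linear_combination (p.1 i) * Real.sin_sq_add_cos_sq θ
  · simp [collideBath, bathRotation, hj]

lemma continuous_collide (a b : ι) :
    Continuous fun p : ℝ × Vel ι => collide a b p.1 p.2 := by
  unfold collide
  fun_prop

lemma continuous_collideBath (j : ι) :
    Continuous fun p : ℝ × (Vel ι × ℝ) => collideBath j p.1 p.2.2 p.2.1 := by
  unfold collideBath
  fun_prop

variable [Fintype ι]

lemma integrable_collisionKernel {a b : ι} (hab : a ≠ b) {f : Vel ι → ℝ} (hf : Integrable f) :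
    Integrable (fun p : ℝ × Vel ι => (2 * π)⁻¹ * f (collide a b p.1 p.2))
      ((volume.restrict (Ioc 0 (2 * π))).prod volume) :=
  ((measurePreserving_angle_collide hab _).integrable_comp_of_integrable
      (g := fun p : ℝ × Vel ι => f p.2) (hf.comp_snd _)).const_mul _

lemma collisionOp_ae_eq {a b : ι} (hab : a ≠ b) (f : Vel ι →₁[volume] ℝ) :
    collisionOp a b hab f =ᵐ[volume] fun x => ∫ θ, (2 * π)⁻¹ * f (collide a b θ x)
      ∂(volume.restrict (Ioc 0 (2 * π))) := by
  filter_upwards [coeFn_collisionOp a b hab f] with x hx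
  rw [hx, collisionMean, intervalIntegral.integral_of_le Real.two_pi_pos.le, integral_const_mul]

lemma thermostatOp_ae_eq (j : ι) (f : Vel ι →₁[volume] ℝ) :
    thermostatOp j f =ᵐ[volume] fun x => ∫ q, (2 * π)⁻¹ *
      (gauss (bathMap j (q, x)).2.2 * f (bathMap j (q, x)).2.1)
      ∂((volume.restrict (Ioc 0 (2 * π))).prod volume) := by
  filter_upwards [coeFn_thermostatOp j f,
    (integrable_bathKernel j f (L1.integrable_coeFn f)).prod_left_ae] with x h hx
  rw [h, integral_prod_symm _ hx]
  simp only [thermostatMean]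
  congr 1
  ext w
  rw [intervalIntegral.integral_of_le Real.two_pi_pos.le, ← integral_const_mul]
  rfl

/-- Joint rotation of angle and velocities preserves the product measure; substituting it moves the
collision from `f` to the test function, where the inverse rotation appears. -/
lemma integral_mul_collisionOp {a b : ι} (hab : a ≠ b) (f : Vel ι →₁[volume] ℝ)
    {φ : Vel ι → ℂ} (hφ : Continuous φ) (hφ1 : ∀ x, ‖φ x‖ ≤ 1) :
    ∫ x, φ x * (collisionOp a b hab f x : ℂ)
      = (2 * π : ℂ)⁻¹ * ∫ θ in (0 : ℝ)..2 * π, ∫ y, φ (collide a b (-θ) y) * (f y : ℂ) := by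
  have hmp := measurePreserving_angle_collide hab (volume.restrict (Ioc 0 (2 * π))) (ι := ι)
  have hf := L1.integrable_coeFn f
  have hc : Continuous fun p : ℝ × Vel ι => φ (collide a b (-p.1) p.2) :=
    hφ.comp ((continuous_collide a b).comp (by fun_prop : Continuous fun p : ℝ × Vel ι =>
      (-p.1, p.2)))
  have hi : Integrable (fun p : ℝ × Vel ι => φ (collide a b (-p.1) p.2) * (f p.2 : ℂ))
      ((volume.restrict (Ioc 0 (2 * π))).prod volume) :=
    (hf.comp_snd _).ofReal.bdd_mul (c := 1) hc.aestronglyMeasurable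
      (Filter.Eventually.of_forall fun p => hφ1 _)
  rw [integral_mul_of_ae_eq_integral (integrable_collisionKernel hab hf)
    (collisionOp_ae_eq hab f) hφ.measurable hφ1,
    intervalIntegral.integral_of_le Real.two_pi_pos.le, ← integral_prod _ hi,
    ← integral_const_mul]
  conv_rhs => rw [← hmp.map_eq]
  rw [integral_map hmp.aemeasurable (by rw [hmp.map_eq]; exact (hi.const_mul _).1)]
  refine integral_congr_ae (Filter.Eventually.of_forall fun p => ?_)
  simp only [collide_neg_collide hab]
  push_cast
  ring

/-- The same substitution with the thermostat velocity as an additional variable: before the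
collision the partner is Maxwellian and independent, and the test function ignores it afterwards. -/
lemma integral_mul_thermostatOp (j : ι) (f : Vel ι →₁[volume] ℝ)
    {φ : Vel ι → ℂ} (hφ : Continuous φ) (hφ1 : ∀ x, ‖φ x‖ ≤ 1) :
    ∫ x, φ x * (thermostatOp j f x : ℂ)
      = (2 * π : ℂ)⁻¹ * ∫ θ in (0 : ℝ)..2 * π, ∫ q : Vel ι × ℝ,
        φ (collideBath j (-θ) q.2 q.1) * (gauss q.2 * f q.1 : ℝ) := by
  have hmp := measurePreserving_bathMap j (volume.restrict (Ioc 0 (2 * π))) (ι := ι)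
  have hf := L1.integrable_coeFn f
  have hc : Continuous fun p : ℝ × (Vel ι × ℝ) => φ (collideBath j (-p.1) p.2.2 p.2.1) :=
    hφ.comp ((continuous_collideBath j).comp (by fun_prop : Continuous fun p : ℝ × (Vel ι × ℝ) =>
      (-p.1, p.2)))
  have hi : Integrable (fun p : ℝ × (Vel ι × ℝ) =>
      φ (collideBath j (-p.1) p.2.2 p.2.1) * (gauss p.2.2 * f p.2.1 : ℝ))
      ((volume.restrict (Ioc 0 (2 * π))).prod volume) :=
    (integrable_bath hf).ofReal.bdd_mul (c := 1) hc.aestronglyMeasurable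
      (Filter.Eventually.of_forall fun p => hφ1 _)
  rw [integral_mul_of_ae_eq_integral (integrable_bathKernel j f hf)
    (thermostatOp_ae_eq j f) hφ.measurable hφ1,
    intervalIntegral.integral_of_le Real.two_pi_pos.le, ← integral_prod _ hi,
    ← integral_const_mul]
  conv_rhs => rw [← hmp.map_eq]
  rw [integral_map hmp.aemeasurable (by rw [hmp.map_eq]; exact (hi.const_mul _).1)]
  refine integral_congr_ae (Filter.Eventually.of_forall fun p => ?_)
  have h := collideBath_neg_bathRotation j p.1.1 (p.2, p.1.2)
  simp only [bathMap, h]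
  push_cast
  ring

/-- Duality for absolute values and possibly unbounded weights. It is an inequality because the
absolute value is moved inside the angular mean. -/
lemma lintegral_mul_collisionOp_le {a b : ι} (hab : a ≠ b) (f : Vel ι →₁[volume] ℝ)
    {W V : Vel ι → ℝ} (hW : Continuous W) (hW0 : ∀ x, 0 ≤ W x)
    (hV : ∀ x, (2 * π)⁻¹ * ∫ θ in (0 : ℝ)..2 * π, W (collide a b (-θ) x) ≤ V x) :
    ∫⁻ x, ENNReal.ofReal (W x) * ‖collisionOp a b hab f x‖ₑ
      ≤ ∫⁻ x, ENNReal.ofReal (V x) * ‖f x‖ₑ := by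
  have hmp := measurePreserving_angle_collide hab (volume.restrict (Ioc 0 (2 * π))) (ι := ι)
  have hf := L1.integrable_coeFn f
  have hc : Continuous fun p : ℝ × Vel ι => W (collide a b (-p.1) p.2) :=
    hW.comp ((continuous_collide a b).comp (by fun_prop : Continuous fun p : ℝ × Vel ι =>
      (-p.1, p.2)))
  have hpi : (0 : ℝ) ≤ (2 * π)⁻¹ := by positivity
  refine (lintegral_mul_of_ae_eq_integral (integrable_collisionKernel hab hf)
    (collisionOp_ae_eq hab f) hW.measurable.ennreal_ofReal).trans ?_
  have hm : AEMeasurable (fun p : ℝ × Vel ι =>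
      ENNReal.ofReal ((2 * π)⁻¹ * W (collide a b (-p.1) p.2)) * ‖f p.2‖ₑ)
      ((volume.restrict (Ioc 0 (2 * π))).prod volume) :=
    (continuous_const.mul hc).measurable.ennreal_ofReal.aemeasurable.mul
      (hf.comp_snd (volume.restrict (Ioc 0 (2 * π)))).1.enorm
  have h1 : ∫⁻ p : ℝ × Vel ι, ENNReal.ofReal (W p.2) * ‖(2 * π)⁻¹ * f (collide a b p.1 p.2)‖ₑ
        ∂((volume.restrict (Ioc 0 (2 * π))).prod volume)
      = ∫⁻ p : ℝ × Vel ι, ENNReal.ofReal ((2 * π)⁻¹ * W (collide a b (-p.1) p.2)) * ‖f p.2‖ₑ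
        ∂((volume.restrict (Ioc 0 (2 * π))).prod volume) := by
    conv_rhs => rw [← hmp.map_eq]
    rw [lintegral_map' (by rw [hmp.map_eq]; exact hm) hmp.aemeasurable]
    refine lintegral_congr fun p => ?_
    rw [collide_neg_collide hab, enorm_mul, Real.enorm_of_nonneg hpi, ENNReal.ofReal_mul hpi]
    ring
  rw [h1, lintegral_prod_symm _ hm]
  refine lintegral_mono fun x => ?_
  have hcx : Continuous fun θ : ℝ => (2 * π)⁻¹ * W (collide a b (-θ) x) :=
    continuous_const.mul (hc.comp (by fun_prop : Continuous fun θ : ℝ => (θ, x)))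
  simp only
  rw [lintegral_mul_const _ hcx.measurable.ennreal_ofReal]
  gcongr
  rw [← ofReal_integral_eq_lintegral_ofReal
    ((hcx.intervalIntegrable 0 (2 * π)).1)
    (Filter.Eventually.of_forall fun θ => mul_nonneg hpi (hW0 _))]
  refine ENNReal.ofReal_le_ofReal (le_trans (le_of_eq ?_) (hV x))
  rw [integral_const_mul, intervalIntegral.integral_of_le Real.two_pi_pos.le]

/-- Tonelli for a kernel depending on an angle, a state and a thermostat velocity. -/
lemma lintegral_angle_bath_le {ρ τ : Measure ℝ} [SFinite ρ] [SFinite τ] {X : Type*}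
    [MeasurableSpace X] {ν : Measure X} [SFinite ν] {k : ℝ × (X × ℝ) → ℝ≥0∞} (hk : Measurable k)
    {F : X → ℝ≥0∞} (hF : AEMeasurable F ν) {V : X → ℝ≥0∞}
    (hV : ∀ x, ∫⁻ θ, ∫⁻ w, k (θ, (x, w)) ∂τ ∂ρ ≤ V x) :
    ∫⁻ p, k p * F p.2.1 ∂(ρ.prod (ν.prod τ)) ≤ ∫⁻ x, V x * F x ∂ν := by
  have hF' : AEMeasurable (fun p : ℝ × (X × ℝ) => F p.2.1) (ρ.prod (ν.prod τ)) :=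
    hF.comp_quasiMeasurePreserving (Measure.quasiMeasurePreserving_fst.comp
      Measure.quasiMeasurePreserving_snd)
  rw [lintegral_prod_symm (fun p : ℝ × (X × ℝ) => k p * F p.2.1) (hk.aemeasurable.mul hF')]
  have h1 : ∀ q : X × ℝ, ∫⁻ θ, k (θ, q) * F q.1 ∂ρ = (∫⁻ θ, k (θ, q) ∂ρ) * F q.1 := fun q =>
    lintegral_mul_const _ (hk.comp measurable_prodMk_right)
  have hk1 : Measurable fun q : X × ℝ => ∫⁻ θ, k (θ, q) ∂ρ := hk.lintegral_prod_left'
  have hF1 : AEMeasurable (fun q : X × ℝ => F q.1) (ν.prod τ) :=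
    hF.comp_quasiMeasurePreserving Measure.quasiMeasurePreserving_fst
  simp only [h1]
  rw [lintegral_prod (fun q : X × ℝ => (∫⁻ θ, k (θ, q) ∂ρ) * F q.1)
    (hk1.aemeasurable.mul hF1)]
  refine lintegral_mono fun x => ?_
  have h2 : ∫⁻ w, (∫⁻ θ, k (θ, (x, w)) ∂ρ) * F x ∂τ
      = (∫⁻ w, ∫⁻ θ, k (θ, (x, w)) ∂ρ ∂τ) * F x :=
    lintegral_mul_const _ (hk1.comp measurable_prodMk_left)
  simp only [h2]
  gcongr
  refine le_trans (le_of_eq ?_) (hV x)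
  refine lintegral_lintegral_swap (f := fun w θ => k (θ, (x, w))) ?_
  exact (hk.comp (by fun_prop : Measurable fun p : ℝ × ℝ => (p.2, (x, p.1)))).aemeasurable

lemma lintegral_mul_thermostatOp_le_prod (j : ι) (f : Vel ι →₁[volume] ℝ)
    {W : Vel ι → ℝ} (hW : Continuous W) (hW0 : ∀ x, 0 ≤ W x) :
    ∫⁻ x, ENNReal.ofReal (W x) * ‖thermostatOp j f x‖ₑ
      ≤ ∫⁻ p : ℝ × (Vel ι × ℝ),
        ENNReal.ofReal ((2 * π)⁻¹ * (W (collideBath j (-p.1) p.2.2 p.2.1) * gauss p.2.2)) *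
        ‖f p.2.1‖ₑ ∂((volume.restrict (Ioc 0 (2 * π))).prod (volume.prod volume)) := by
  have hmp := measurePreserving_bathMap j (volume.restrict (Ioc 0 (2 * π))) (ι := ι)
  have hf := L1.integrable_coeFn f
  have hg : Continuous gauss := by unfold gauss; fun_prop
  have hc : Continuous fun p : ℝ × (Vel ι × ℝ) =>
      W (collideBath j (-p.1) p.2.2 p.2.1) * gauss p.2.2 :=
    (hW.comp ((continuous_collideBath j).comp (by fun_prop : Continuous fun p : ℝ × (Vel ι × ℝ) =>
      (-p.1, p.2)))).mul (hg.comp (by fun_prop))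
  have hpi : (0 : ℝ) ≤ (2 * π)⁻¹ := by positivity
  refine (lintegral_mul_of_ae_eq_integral (integrable_bathKernel j f hf)
    (thermostatOp_ae_eq j f) hW.measurable.ennreal_ofReal).trans (le_of_eq ?_)
  have hsnd : AEMeasurable (fun p : ℝ × (Vel ι × ℝ) => ‖f p.2.1‖ₑ)
      ((volume.restrict (Ioc 0 (2 * π))).prod volume) :=
    (hf.1.comp_quasiMeasurePreserving (Measure.quasiMeasurePreserving_fst.comp
          Measure.quasiMeasurePreserving_snd)).enorm
  have hm : AEMeasurable (fun p : ℝ × (Vel ι × ℝ) =>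
      ENNReal.ofReal ((2 * π)⁻¹ * (W (collideBath j (-p.1) p.2.2 p.2.1) * gauss p.2.2)) *
        ‖f p.2.1‖ₑ) ((volume.restrict (Ioc 0 (2 * π))).prod volume) :=
    (continuous_const.mul hc).measurable.ennreal_ofReal.aemeasurable.mul hsnd
  rw [← Measure.volume_eq_prod]
  conv_rhs => rw [← hmp.map_eq]
  rw [lintegral_map' (by rw [hmp.map_eq]; exact hm) hmp.aemeasurable]
  refine lintegral_congr fun p => ?_
  have h := collideBath_neg_bathRotation j p.1.1 (p.2, p.1.2)
  simp only [bathMap, h]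
  rw [enorm_mul, enorm_mul, Real.enorm_of_nonneg hpi, Real.enorm_of_nonneg (gauss_nonneg _),
    ENNReal.ofReal_mul hpi, ENNReal.ofReal_mul (hW0 _)]
  ring

/-- The mean of the weight is taken in two stages, `U` over the thermostat velocity and `V` over the
angle, so that each can be computed explicitly for polynomial weights. -/
lemma lintegral_mul_thermostatOp_le (j : ι) (f : Vel ι →₁[volume] ℝ)
    {W V : Vel ι → ℝ} {U : ℝ → Vel ι → ℝ} (hW : Continuous W) (hW0 : ∀ x, 0 ≤ W x)
    (hUi : ∀ θ x, Integrable fun w => W (collideBath j (-θ) w x) * gauss w)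
    (hU : ∀ θ x, ∫ w, W (collideBath j (-θ) w x) * gauss w = U θ x)
    (hUc : ∀ x, Continuous fun θ => U θ x)
    (hV : ∀ x, (2 * π)⁻¹ * ∫ θ in (0 : ℝ)..2 * π, U θ x ≤ V x) :
    ∫⁻ x, ENNReal.ofReal (W x) * ‖thermostatOp j f x‖ₑ
      ≤ ∫⁻ x, ENNReal.ofReal (V x) * ‖f x‖ₑ := by
  have hg : Continuous gauss := by unfold gauss; fun_prop
  have hc : Continuous fun p : ℝ × (Vel ι × ℝ) =>
      W (collideBath j (-p.1) p.2.2 p.2.1) * gauss p.2.2 :=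
    (hW.comp ((continuous_collideBath j).comp (by fun_prop : Continuous fun p : ℝ × (Vel ι × ℝ) =>
      (-p.1, p.2)))).mul (hg.comp (by fun_prop))
  have hpi : (0 : ℝ) ≤ (2 * π)⁻¹ := by positivity
  have hU0 : ∀ θ x, 0 ≤ U θ x := fun θ x => by
    rw [← hU]
    exact integral_nonneg fun w => mul_nonneg (hW0 _) (gauss_nonneg _)
  refine (lintegral_mul_thermostatOp_le_prod j f hW hW0).trans ?_
  refine lintegral_angle_bath_le (continuous_const.mul hc).measurable.ennreal_ofReal
    (Lp.aestronglyMeasurable f).enorm fun x => ?_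
  have h3 : ∀ θ : ℝ, ∫⁻ w,
      ENNReal.ofReal ((2 * π)⁻¹ * (W (collideBath j (-θ) w x) * gauss w))
      = ENNReal.ofReal ((2 * π)⁻¹ * U θ x) := fun θ => by
    rw [← ofReal_integral_eq_lintegral_ofReal ((hUi θ x).const_mul _)
      (Filter.Eventually.of_forall fun w =>
        mul_nonneg hpi (mul_nonneg (hW0 _) (gauss_nonneg _))), integral_const_mul, hU]
  have hcU : Continuous fun θ => (2 * π)⁻¹ * U θ x := continuous_const.mul (hUc x)
  refine (lintegral_congr h3).trans_le ?_
  rw [← ofReal_integral_eq_lintegral_ofReal (hcU.intervalIntegrable 0 (2 * π)).1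
    (Filter.Eventually.of_forall fun θ => mul_nonneg hpi (hU0 _ _))]
  refine ENNReal.ofReal_le_ofReal (le_trans (le_of_eq ?_) (hV x))
  rw [integral_const_mul, intervalIntegral.integral_of_le Real.two_pi_pos.le]

end Adjoint

/-! ### The Fourier transform as a family of functionals on `L¹` -/

section Fourier

variable {ι : Type*} [Fintype ι]

/-- The character `x ↦ exp (-2πi⟨x, ζ⟩)`. -/
def planeWave (ζ x : Vel ι) : ℂ := Complex.exp (((-2 * π * inner ℝ x ζ : ℝ) : ℂ) * Complex.I)

lemma norm_planeWave (ζ x : Vel ι) : ‖planeWave ζ x‖ = 1 :=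
  Complex.norm_exp_ofReal_mul_I _

lemma continuous_planeWave (ζ : Vel ι) : Continuous (planeWave ζ) := by
  unfold planeWave
  fun_prop

lemma integrable_planeWave_mul (ζ : Vel ι) {f : Vel ι → ℝ} (hf : Integrable f) :
    Integrable fun x => planeWave ζ x * (f x : ℂ) :=
  hf.ofReal.bdd_mul (c := 1) (continuous_planeWave ζ).aestronglyMeasurable
    (Filter.Eventually.of_forall fun x => (norm_planeWave ζ x).le)

lemma fourier_eq_integral_planeWave (f : Vel ι → ℝ) (ζ : Vel ι) :
    𝓕 (fun v => (f v : ℂ)) ζ = ∫ x, planeWave ζ x * (f x : ℂ) := by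
  rw [Real.fourier_eq']
  rfl

/-- The value at `ζ` of the Fourier transform, as a functional on `L¹`. -/
def fourierAt (ζ : Vel ι) : (Vel ι →₁[volume] ℝ) →L[ℝ] ℂ :=
  LinearMap.mkContinuous
    { toFun := fun f => ∫ x, planeWave ζ x * (f x : ℂ)
      map_add' := fun f g => by
        rw [← integral_add (integrable_planeWave_mul ζ (L1.integrable_coeFn f))
          (integrable_planeWave_mul ζ (L1.integrable_coeFn g))]
        refine integral_congr_ae ?_
        filter_upwards [Lp.coeFn_add f g] with x hx
        rw [hx]
        simp [mul_add]
      map_smul' := fun c f => by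
        rw [RingHom.id_apply, ← integral_smul]
        refine integral_congr_ae ?_
        filter_upwards [Lp.coeFn_smul c f] with x hx
        rw [hx]
        simp [mul_left_comm] }
    1 (fun f => by
      rw [one_mul, LinearMap.coe_mk, AddHom.coe_mk, L1.norm_eq_integral_norm]
      refine (norm_integral_le_integral_norm _).trans (le_of_eq ?_)
      refine integral_congr_ae (Filter.Eventually.of_forall fun x => ?_)
      simp [norm_planeWave])

lemma fourierAt_apply (ζ : Vel ι) (f : Vel ι →₁[volume] ℝ) :
    fourierAt ζ f = ∫ x, planeWave ζ x * (f x : ℂ) := rfl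

lemma fourier_coe (ζ : Vel ι) (f : Vel ι →₁[volume] ℝ) :
    𝓕 (fun v => (f v : ℂ)) ζ = fourierAt ζ f := by
  rw [fourier_eq_integral_planeWave, fourierAt_apply]

lemma continuous_fourierAt (f : Vel ι →₁[volume] ℝ) : Continuous fun ζ => fourierAt ζ f := by
  simp only [fourierAt_apply]
  refine continuous_of_dominated (bound := fun x => ‖f x‖)
    (fun ζ => (integrable_planeWave_mul ζ (L1.integrable_coeFn f)).1)
    (fun ζ => Filter.Eventually.of_forall fun x => by simp [norm_planeWave])
    (L1.integrable_coeFn f).norm (Filter.Eventually.of_forall fun x => ?_)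
  unfold planeWave
  fun_prop

lemma maxwellian_eq (x : Vel ι) : maxwellian x = Real.exp (-π * ‖x‖ ^ 2) := by
  simp only [maxwellian, gauss, ← Real.exp_sum, ← Finset.mul_sum, EuclideanSpace.norm_sq_eq,
    Real.norm_eq_abs, sq_abs]

/-- At `β = 2π` the Maxwellian is a fixed point of this Fourier transform, so one function serves on
both sides. -/
lemma fourier_maxwellian (ζ : Vel ι) :
    𝓕 (fun v : Vel ι => (maxwellian v : ℂ)) ζ = maxwellian ζ := by
  have h := fourier_gaussian_innerProductSpace (V := Vel ι) (b := (π : ℂ))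
    (by simpa using Real.pi_pos) ζ
  have hpi : (π : ℂ) ≠ 0 := by exact_mod_cast Real.pi_ne_zero
  rw [div_self hpi, Complex.one_cpow, one_mul] at h
  have h2 : (fun v : Vel ι => (maxwellian v : ℂ)) = fun v => Complex.exp (-π * ‖v‖ ^ 2) := by
    ext v
    rw [maxwellian_eq]
    push_cast
    rfl
  rw [h2, h, maxwellian_eq]
  push_cast
  congr 1
  field_simp

lemma continuous_gauss : Continuous gauss := by
  unfold gauss
  fun_prop

lemma continuous_maxwellian : Continuous (maxwellian : Vel ι → ℝ) := by
  have : (maxwellian : Vel ι → ℝ) = fun x => Real.exp (-π * ‖x‖ ^ 2) := funext maxwellian_eq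
  rw [this]
  fun_prop

lemma gauss_neg (x : ℝ) : gauss (-x) = gauss x := by
  simp [gauss]

lemma gauss_le_one (x : ℝ) : gauss x ≤ 1 := by
  rw [gauss, Real.exp_le_one_iff]
  have : 0 ≤ π * x ^ 2 := by positivity
  linarith

lemma maxwellian_nonneg (x : Vel ι) : 0 ≤ maxwellian x :=
  Finset.prod_nonneg fun _ _ => gauss_nonneg _

lemma maxwellian_le_one (x : Vel ι) : maxwellian x ≤ 1 :=
  Finset.prod_le_one (fun _ _ => gauss_nonneg _) fun _ _ => gauss_le_one _

lemma fourier_gauss (s : ℝ) :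
    ∫ w : ℝ, Complex.exp (((2 * π * w * s : ℝ) : ℂ) * Complex.I) * (gauss w : ℂ) = gauss s := by
  have h := fourierIntegral_gaussian (b := (π : ℂ)) (by simpa using Real.pi_pos) (2 * π * s : ℂ)
  have hpi : (π : ℂ) ≠ 0 := by exact_mod_cast Real.pi_ne_zero
  rw [div_self hpi, Complex.one_cpow, one_mul] at h
  have h2 : ∀ w : ℝ, Complex.exp (((2 * π * w * s : ℝ) : ℂ) * Complex.I) * (gauss w : ℂ)
      = Complex.exp (Complex.I * (2 * π * s) * w) * Complex.exp (-π * w ^ 2) := fun w => by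
    unfold gauss
    push_cast
    ring_nf
  simp only [h2]
  rw [h]
  unfold gauss
  push_cast
  congr 1
  field_simp
  ring

variable [DecidableEq ι]

/-- A collision is a rotation, so its transpose is its inverse. -/
lemma inner_collide_neg {a b : ι} (hab : a ≠ b) (θ : ℝ) (x ζ : Vel ι) :
    inner ℝ (collide a b (-θ) x) ζ = inner ℝ x (collide a b θ ζ) := by
  have hs : ∀ u v : Vel ι, inner ℝ u v = u a * v a + (u b * v b +
      ∑ i ∈ (Finset.univ.erase a).erase b, u i * v i) := fun u v => by
    rw [PiLp.inner_apply, ← Finset.add_sum_erase _ _ (Finset.mem_univ a),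
      ← Finset.add_sum_erase _ _ (Finset.mem_erase.2 ⟨hab.symm, Finset.mem_univ b⟩)]
    simp [mul_comm]
  rw [hs, hs]
  have h : ∑ i ∈ (Finset.univ.erase a).erase b, collide a b (-θ) x i * ζ i
      = ∑ i ∈ (Finset.univ.erase a).erase b, x i * collide a b θ ζ i :=
    Finset.sum_congr rfl fun i hi => by
      have h1 : i ≠ b := Finset.ne_of_mem_erase hi
      have h2 : i ≠ a := Finset.ne_of_mem_erase (Finset.mem_of_mem_erase hi)
      simp [collide, h1, h2]
  rw [h]
  simp [collide, hab]
  ring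

lemma inner_collideBath_neg (j : ι) (θ w : ℝ) (x ζ : Vel ι) :
    inner ℝ (collideBath j (-θ) w x) ζ
      = inner ℝ x (collideBath j θ 0 ζ) - w * (ζ j * Real.sin θ) := by
  have hs : ∀ u v : Vel ι, inner ℝ u v = u j * v j +
      ∑ i ∈ Finset.univ.erase j, u i * v i := fun u v => by
    rw [PiLp.inner_apply, ← Finset.add_sum_erase _ _ (Finset.mem_univ j)]
    simp [mul_comm]
  rw [hs, hs]
  have h : ∑ i ∈ Finset.univ.erase j, collideBath j (-θ) w x i * ζ i
      = ∑ i ∈ Finset.univ.erase j, x i * collideBath j θ 0 ζ i :=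
    Finset.sum_congr rfl fun i hi => by
      have h1 : i ≠ j := Finset.ne_of_mem_erase hi
      simp [collideBath, h1]
  rw [h]
  simp [collideBath]
  ring

lemma fourierAt_collisionOp {a b : ι} (hab : a ≠ b) (f : Vel ι →₁[volume] ℝ) (ζ : Vel ι) :
    fourierAt ζ (collisionOp a b hab f)
      = (2 * π : ℂ)⁻¹ * ∫ θ in (0 : ℝ)..2 * π, fourierAt (collide a b θ ζ) f := by
  rw [fourierAt_apply, integral_mul_collisionOp hab f (continuous_planeWave ζ)
    fun x => (norm_planeWave ζ x).le]
  simp only [fourierAt_apply, planeWave, inner_collide_neg hab]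

/-- The character factors into a function of the velocities and one of the thermostat velocity; the
latter integrates against the Gaussian to the multiplier `gauss (ζ j * sin θ)`. -/
lemma fourierAt_thermostatOp (j : ι) (f : Vel ι →₁[volume] ℝ) (ζ : Vel ι) :
    fourierAt ζ (thermostatOp j f) = (2 * π : ℂ)⁻¹ * ∫ θ in (0 : ℝ)..2 * π,
      (gauss (ζ j * Real.sin θ) : ℂ) * fourierAt (collideBath j θ 0 ζ) f := by
  rw [fourierAt_apply, integral_mul_thermostatOp j f (continuous_planeWave ζ)
    fun x => (norm_planeWave ζ x).le]
  congr 2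
  ext θ
  rw [fourierAt_apply, ← fourier_gauss, mul_comm]
  refine Eq.trans ?_ (integral_prod_mul
    (fun x => planeWave (collideBath j θ 0 ζ) x * (f x : ℂ))
    (fun w : ℝ => Complex.exp (((2 * π * w * (ζ j * Real.sin θ) : ℝ) : ℂ) * Complex.I)
      * (gauss w : ℂ)))
  refine integral_congr_ae (Filter.Eventually.of_forall fun q => ?_)
  simp only [planeWave, inner_collideBath_neg]
  have h : (((-2 * π * (inner ℝ q.1 (collideBath j θ 0 ζ) - q.2 * (ζ j * Real.sin θ)) : ℝ) : ℂ)
      * Complex.I) = ((-2 * π * inner ℝ q.1 (collideBath j θ 0 ζ) : ℝ) : ℂ) * Complex.I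
        + ((2 * π * q.2 * (ζ j * Real.sin θ) : ℝ) : ℂ) * Complex.I := by
    push_cast
    ring
  rw [h, Complex.exp_add]
  push_cast
  ring

end Fourier

/-! ### Averages over the scattering angle -/

/-- The mean over the scattering angle. -/
def angleMean (F : ℝ → ℂ) : ℂ := (2 * π : ℂ)⁻¹ * ∫ θ in (0 : ℝ)..2 * π, F θ

lemma norm_two_pi_inv : ‖(2 * π : ℂ)⁻¹‖ = (2 * π)⁻¹ := by
  rw [norm_inv, norm_mul, Complex.norm_real, Real.norm_of_nonneg Real.pi_pos.le]
  simp

lemma two_pi_inv_mul : (2 * π : ℂ)⁻¹ * (2 * π) = 1 := by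
  refine inv_mul_cancel₀ ?_
  exact_mod_cast Real.two_pi_pos.ne'

/-- No measurability of `F` is needed: the integral of a non-integrable function is `0` by
convention. -/
lemma norm_angleMean_le_mean {F : ℝ → ℂ} {B : ℝ → ℝ} (hB : Continuous B)
    (h : ∀ θ, ‖F θ‖ ≤ B θ) :
    ‖angleMean F‖ ≤ (2 * π)⁻¹ * ∫ θ in (0 : ℝ)..2 * π, B θ := by
  rw [angleMean, norm_mul, norm_two_pi_inv]
  refine mul_le_mul_of_nonneg_left ?_ (by positivity)
  exact intervalIntegral.norm_integral_le_of_norm_le Real.two_pi_pos.le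
    (Filter.Eventually.of_forall fun θ _ => h θ) (hB.intervalIntegrable _ _)

lemma norm_angleMean_le {F : ℝ → ℂ} {C : ℝ} (h : ∀ θ, ‖F θ‖ ≤ C) : ‖angleMean F‖ ≤ C := by
  refine (norm_angleMean_le_mean continuous_const h).trans (le_of_eq ?_)
  rw [intervalIntegral.integral_const, sub_zero, smul_eq_mul, ← mul_assoc,
    inv_mul_cancel₀ Real.two_pi_pos.ne', one_mul]

lemma angleMean_const (c : ℂ) : angleMean (fun _ => c) = c := by
  rw [angleMean, intervalIntegral.integral_const, sub_zero, Complex.real_smul, ← mul_assoc]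
  push_cast
  rw [two_pi_inv_mul, one_mul]

lemma angleMean_sub {F G : ℝ → ℂ} (hF : Continuous F) (hG : Continuous G) :
    angleMean (fun θ => F θ - G θ) = angleMean F - angleMean G := by
  rw [angleMean, intervalIntegral.integral_sub (hF.intervalIntegrable _ _)
    (hG.intervalIntegrable _ _), mul_sub]
  rfl

lemma angleMean_const_mul (c : ℂ) (F : ℝ → ℂ) :
    angleMean (fun θ => c * F θ) = c * angleMean F := by
  rw [angleMean, intervalIntegral.integral_const_mul, angleMean]
  ring

/-! ### Deviation from the Maxwellian -/

section Deviation

variable {ι : Type*} [Fintype ι]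

/-- The Fourier transform of the deviation from the Maxwellian of the same mass. -/
def deviationAt (ζ : Vel ι) : (Vel ι →₁[volume] ℝ) →L[ℝ] ℂ :=
  fourierAt ζ - maxwellian ζ • fourierAt 0

lemma deviationAt_apply (ζ : Vel ι) (f : Vel ι →₁[volume] ℝ) :
    deviationAt ζ f = fourierAt ζ f - maxwellian ζ * fourierAt 0 f := by
  simp [deviationAt]

end Deviation

/-! ### Families of functionals that intertwine with collisions -/

section Families

variable {ι : Type*} [Fintype ι] [DecidableEq ι]

/-- The family `ψ` intertwines the collision of `a` and `b` with its action on frequencies. -/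
def CollisionCovariant (ψ : Vel ι → (Vel ι →₁[volume] ℝ) →L[ℝ] ℂ) (a b : ι) (hab : a ≠ b) : Prop :=
  ∀ ζ f, ψ ζ (collisionOp a b hab f) = angleMean fun θ => ψ (collide a b θ ζ) f

/-- The family `ψ` intertwines the thermostat acting on `j` with its action on frequencies. -/
def ThermostatCovariant (ψ : Vel ι → (Vel ι →₁[volume] ℝ) →L[ℝ] ℂ) (j : ι) : Prop :=
  ∀ ζ f, ψ ζ (thermostatOp j f)
    = angleMean fun θ => (gauss (ζ j * Real.sin θ) : ℂ) * ψ (collideBath j θ 0 ζ) f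

lemma collisionCovariant_fourierAt {a b : ι} (hab : a ≠ b) :
    CollisionCovariant (fourierAt : Vel ι → _) a b hab :=
  fun ζ f => fourierAt_collisionOp hab f ζ

lemma thermostatCovariant_fourierAt (j : ι) :
    ThermostatCovariant (fourierAt : Vel ι → _) j :=
  fun ζ f => fourierAt_thermostatOp j f ζ

lemma norm_collide {a b : ι} (hab : a ≠ b) (θ : ℝ) (x : Vel ι) : ‖collide a b θ x‖ = ‖x‖ := by
  have h : ‖collide a b θ x‖ ^ 2 = ‖x‖ ^ 2 := by
    rw [← real_inner_self_eq_norm_sq, ← inner_collide_neg hab, collide_neg_collide hab,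
      real_inner_self_eq_norm_sq]
  exact (sq_eq_sq₀ (norm_nonneg _) (norm_nonneg _)).1 h

lemma norm_sq_collideBath_zero (j : ι) (θ : ℝ) (x : Vel ι) :
    ‖collideBath j θ 0 x‖ ^ 2 = ‖x‖ ^ 2 - (x j * Real.sin θ) ^ 2 := by
  simp only [EuclideanSpace.norm_sq_eq, Real.norm_eq_abs, sq_abs]
  change ∑ i, (Function.update _ j _ i) ^ 2 = _
  rw [sum_sq_update]
  linear_combination (x j ^ 2) * Real.sin_sq_add_cos_sq θ

lemma maxwellian_collide {a b : ι} (hab : a ≠ b) (θ : ℝ) (x : Vel ι) :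
    maxwellian (collide a b θ x) = maxwellian x := by
  rw [maxwellian_eq, maxwellian_eq, norm_collide hab]

/-- The multiplier restores exactly the squared length that the frequency loses. This is the
stationarity of the Maxwellian under the thermostat, angle by angle. -/
lemma gauss_mul_maxwellian_collideBath (j : ι) (θ : ℝ) (x : Vel ι) :
    gauss (x j * Real.sin θ) * maxwellian (collideBath j θ 0 x) = maxwellian x := by
  rw [maxwellian_eq, maxwellian_eq, norm_sq_collideBath_zero, gauss, ← Real.exp_add]
  ring_nf

end Families

section Zero

variable {ι : Type*} [DecidableEq ι]

lemma collide_zero (a b : ι) (θ : ℝ) : collide a b θ (0 : Vel ι) = 0 := by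
  ext i
  simp only [collide]
  by_cases hb : i = b
  · subst hb; simp
  · by_cases ha : i = a
    · subst ha; simp [hb]
    · simp [hb]

lemma collideBath_zero_zero (j : ι) (θ : ℝ) : collideBath j θ 0 (0 : Vel ι) = 0 := by
  ext i
  by_cases hj : i = j
  · subst hj; simp [collideBath]
  · simp [collideBath]

lemma continuous_collide_left (a b : ι) (ζ : Vel ι) : Continuous fun θ => collide a b θ ζ :=
  (continuous_collide a b).comp (by fun_prop : Continuous fun θ : ℝ => (θ, ζ))

lemma continuous_collideBath_left (j : ι) (ζ : Vel ι) :
    Continuous fun θ => collideBath j θ 0 ζ :=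
  (continuous_collideBath j).comp (by fun_prop : Continuous fun θ : ℝ => (θ, (ζ, (0 : ℝ))))

end Zero

section Families

variable {ι : Type*} [Fintype ι] [DecidableEq ι]

lemma fourierAt_zero_collisionOp {a b : ι} (hab : a ≠ b) (f : Vel ι →₁[volume] ℝ) :
    fourierAt 0 (collisionOp a b hab f) = fourierAt 0 f := by
  rw [collisionCovariant_fourierAt hab]
  simp only [collide_zero, angleMean_const]

lemma fourierAt_zero_thermostatOp (j : ι) (f : Vel ι →₁[volume] ℝ) :
    fourierAt 0 (thermostatOp j f) = fourierAt 0 f := by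
  rw [thermostatCovariant_fourierAt j]
  have : gauss 0 = 1 := by simp [gauss]
  simp [collideBath_zero_zero, this, angleMean_const]

/-- Collisions conserve mass and leave the Maxwellian invariant, so the subtracted term passes
through the angular mean unchanged. -/
lemma collisionCovariant_deviationAt {a b : ι} (hab : a ≠ b) :
    CollisionCovariant (deviationAt : Vel ι → _) a b hab := fun ζ f => by
  simp only [deviationAt_apply, maxwellian_collide hab]
  have hc : Continuous fun θ => fourierAt (collide a b θ ζ) f :=
    (continuous_fourierAt f).comp (continuous_collide_left a b ζ)
  rw [angleMean_sub hc continuous_const, angleMean_const, fourierAt_zero_collisionOp,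
    collisionCovariant_fourierAt hab]

lemma thermostatCovariant_deviationAt (j : ι) :
    ThermostatCovariant (deviationAt : Vel ι → _) j := fun ζ f => by
  have h : ∀ θ, (gauss (ζ j * Real.sin θ) : ℂ) * deviationAt (collideBath j θ 0 ζ) f
      = (gauss (ζ j * Real.sin θ) : ℂ) * fourierAt (collideBath j θ 0 ζ) f
        - maxwellian ζ * fourierAt 0 f := fun θ => by
    rw [deviationAt_apply, mul_sub, ← mul_assoc, ← Complex.ofReal_mul,
      gauss_mul_maxwellian_collideBath]
  have hc : Continuous fun θ =>
      (gauss (ζ j * Real.sin θ) : ℂ) * fourierAt (collideBath j θ 0 ζ) f :=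
    (Complex.continuous_ofReal.comp (continuous_gauss.comp (by fun_prop))).mul
      ((continuous_fourierAt f).comp (continuous_collideBath_left j ζ))
  simp only [h]
  rw [angleMean_sub hc continuous_const, angleMean_const, deviationAt_apply,
    fourierAt_zero_thermostatOp, thermostatCovariant_fourierAt j]

/-- A mean over rotated frequencies cannot exceed a bound that is the same at all of them. -/
lemma CollisionCovariant.opLe {ψ : Vel ι → (Vel ι →₁[volume] ℝ) →L[ℝ] ℂ} {a b : ι} {hab : a ≠ b}
    (h : CollisionCovariant ψ a b hab) {w : Vel ι → ℝ} (hw : ∀ ζ, 0 ≤ w ζ)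
    (hwc : ∀ ζ θ, w (collide a b θ ζ) = w ζ) :
    (functionalGauge ψ w hw).OpLe (collisionOp a b hab) 1 := fun f C _ hf ζ => by
  rw [h, one_mul]
  refine norm_angleMean_le fun θ => ?_
  rw [← hwc ζ θ]
  exact hf _

/-- Here it is enough that the weight does not grow along the contraction of the frequency, since
the Gaussian multiplier is at most one. -/
lemma ThermostatCovariant.opLe {ψ : Vel ι → (Vel ι →₁[volume] ℝ) →L[ℝ] ℂ} {j : ι}
    (h : ThermostatCovariant ψ j) {w : Vel ι → ℝ} (hw : ∀ ζ, 0 ≤ w ζ)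
    (hwc : ∀ ζ θ, w (collideBath j θ 0 ζ) ≤ w ζ) :
    (functionalGauge ψ w hw).OpLe (thermostatOp j) 1 := fun f C hC hf ζ => by
  rw [h, one_mul]
  refine norm_angleMean_le fun θ => ?_
  rw [norm_mul, Complex.norm_real, Real.norm_of_nonneg (gauss_nonneg _)]
  calc _ ≤ 1 * (C * w (collideBath j θ 0 ζ)) :=
        mul_le_mul (gauss_le_one _) (hf _) (norm_nonneg _) zero_le_one
    _ ≤ C * w ζ := by
        rw [one_mul]
        exact mul_le_mul_of_nonneg_left (hwc ζ θ) hC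

end Families

/-! ### Gauges along the evolutions -/

section GaugeSum

variable {E : Type*} [NormedAddCommGroup E] [NormedSpace ℝ E]

lemma smul_sum_sub_one {α : Type*} [Fintype α] (c : ℝ) (P : α → E →L[ℝ] E) :
    c • ∑ i, (P i - 1) = c • ∑ i, P i - (c * Fintype.card α) • 1 := by
  rw [Finset.sum_sub_distrib, smul_sub, Finset.sum_const, Finset.card_univ, mul_smul,
    Nat.cast_smul_eq_nsmul]

variable [CompleteSpace E]

/-- For the `P i` gain and loss cancel exactly. The `T i` are bounded only through their sum,
because the contraction is visible in the sum and not in each term. -/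
lemma Gauge.exp_sum_le (G : Gauge E) {α β : Type*} [Fintype α] [Fintype β]
    {P : α → E →L[ℝ] E} {T : β → E →L[ℝ] E} {r m t b C : ℝ} (hr : 0 ≤ r) (hm : 0 ≤ m)
    (ht : 0 ≤ t) (hb : 0 ≤ b) (hC : 0 ≤ C) (hP : ∀ i, G.OpLe (P i) 1)
    (hT : G.OpLe (∑ i, T i) b) {x : E} (hx : G.Le x C) :
    G.Le (NormedSpace.exp (t • (r • ∑ i, (P i - 1) + m • ∑ i, (T i - 1))) x)
      (Real.exp (t * (m * (b - Fintype.card β))) * C) := by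
  have hS := (Gauge.OpLe.sum Finset.univ fun i _ => hP i).smul (Nat.cast_nonneg _) hr
  have hQ := hS.add (by positivity) (by positivity) (hT.smul hb hm)
  have h := G.exp_generator_le (c := r * Fintype.card α + m * Fintype.card β)
    (by positivity) ht rfl hQ hC hx
  have he : r * (Finset.univ : Finset α).card + m * b - (r * Fintype.card α + m * Fintype.card β)
      = m * (b - Fintype.card β) := by
    rw [Finset.card_univ]
    ring
  rw [he] at h
  have hA : r • ∑ i, (P i - 1) + m • ∑ i, (T i - 1)
      = (r • ∑ i, P i + m • ∑ i, T i) - (r * Fintype.card α + m * Fintype.card β) • 1 := by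
    rw [smul_sum_sub_one, smul_sum_sub_one, add_smul]
    abel
  rw [hA]
  exact h

lemma Gauge.exp_sum_three_le (G : Gauge E) {α β γ δ : Type*} [Fintype α] [Fintype β] [Fintype γ]
    [Fintype δ] {P : α → E →L[ℝ] E} {R : β → E →L[ℝ] E} {T : γ → δ → E →L[ℝ] E} {r s m t C : ℝ}
    (hr : 0 ≤ r) (hs : 0 ≤ s) (hm : 0 ≤ m) (ht : 0 ≤ t) (hC : 0 ≤ C)
    (hP : ∀ i, G.OpLe (P i) 1) (hR : ∀ i, G.OpLe (R i) 1) (hT : ∀ i j, G.OpLe (T i j) 1)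
    {x : E} (hx : G.Le x C) :
    G.Le (NormedSpace.exp (t • (r • ∑ i, (P i - 1) + s • ∑ i, (R i - 1)
      + m • ∑ i, ∑ j, (T i j - 1))) x) C := by
  have hP' := (Gauge.OpLe.sum Finset.univ fun i _ => hP i).smul (Nat.cast_nonneg _) hr
  have hR' := (Gauge.OpLe.sum Finset.univ fun i _ => hR i).smul (Nat.cast_nonneg _) hs
  have hT' := (Gauge.OpLe.sum Finset.univ fun (p : γ × δ) _ => hT p.1 p.2).smul
    (Nat.cast_nonneg _) hm
  have hQ := (hP'.add (by positivity) (by positivity) hR').add (by positivity) (by positivity) hT'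
  have h := G.exp_generator_le
    (c := r * Fintype.card α + s * Fintype.card β + m * Fintype.card (γ × δ))
    (by positivity) ht rfl hQ hC hx
  simp only [Finset.card_univ, sub_self, mul_zero, Real.exp_zero, one_mul] at h
  have hA : r • ∑ i, (P i - 1) + s • ∑ i, (R i - 1) + m • ∑ i, ∑ j, (T i j - 1)
      = (r • ∑ i, P i + s • ∑ i, R i + m • ∑ p : γ × δ, T p.1 p.2)
        - (r * Fintype.card α + s * Fintype.card β + m * Fintype.card (γ × δ)) • 1 := by
    rw [← Fintype.sum_prod_type' (f := fun i j => T i j - 1), smul_sum_sub_one, smul_sum_sub_one,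
      smul_sum_sub_one, add_smul, add_smul]
    abel
  rw [hA]
  exact h

end GaugeSum

section Evolution

variable {M N : ℕ}

/-- For `n = 1` this is a division by zero, with value `0`, in agreement with the convention for a
single particle. -/
lemma rate_nonneg {n : ℕ} (hn : 0 < n) {lam : ℝ} (h : 0 ≤ lam) : 0 ≤ lam / ((n : ℝ) - 1) := by
  refine div_nonneg h ?_
  have : (1 : ℝ) ≤ n := by exact_mod_cast hn
  linarith

lemma Gauge.thermostatEvolution_le (G : Gauge (State M N)) (hM : 0 < M) {lamS mu t b C : ℝ}
    (hlamS : 0 ≤ lamS) (hmu : 0 ≤ mu) (ht : 0 ≤ t) (hb : 0 ≤ b) (hC : 0 ≤ C)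
    (hS : ∀ (i j : Fin M) (hij : i ≠ j),
      G.OpLe (collisionOp (Sum.inl i) (Sum.inl j) (Sum.inl_injective.ne hij)) 1)
    (hT : G.OpLe (∑ i : Fin M, thermostatOp (Sum.inl i)) b) {f : State M N} (hf : G.Le f C) :
    G.Le (thermostatEvolution lamS mu t f) (Real.exp (t * (mu * (b - M))) * C) := by
  have h := G.exp_sum_le (P := fun p : {p : Fin M × Fin M // p.1 < p.2} =>
      collisionOp (Sum.inl p.1.1) (Sum.inl p.1.2) (Sum.inl_injective.ne p.2.ne))
    (rate_nonneg hM hlamS) hmu ht hb hC (fun p => hS p.1.1 p.1.2 p.2.ne) hT hf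
  rw [Fintype.card_fin] at h
  exact h

lemma Gauge.finiteEvolution_le (G : Gauge (State M N)) (hM : 0 < M) (hN : 0 < N)
    {lamS lamR mu t C : ℝ} (hlamS : 0 ≤ lamS) (hlamR : 0 ≤ lamR) (hmu : 0 ≤ mu) (ht : 0 ≤ t)
    (hC : 0 ≤ C) (h : ∀ a b hab, G.OpLe (collisionOp a b hab) 1) {f : State M N}
    (hf : G.Le f C) : G.Le (finiteEvolution lamS lamR mu t f) C := by
  exact G.exp_sum_three_le (P := fun p : {p : Fin M × Fin M // p.1 < p.2} =>
      collisionOp (Sum.inl p.1.1) (Sum.inl p.1.2) (Sum.inl_injective.ne p.2.ne))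
    (R := fun p : {p : Fin N × Fin N // p.1 < p.2} =>
      collisionOp (Sum.inr p.1.1) (Sum.inr p.1.2) (Sum.inr_injective.ne p.2.ne))
    (T := fun (i : Fin M) (j : Fin N) => collisionOp (Sum.inl i) (Sum.inr j) Sum.inl_ne_inr)
    (rate_nonneg hM hlamS) (rate_nonneg hN hlamR) (by positivity) ht hC
    (fun _ => h _ _ _) (fun _ => h _ _ _) (fun _ _ => h _ _ _) hf

end Evolution

/-! ### System and reservoir frequencies -/

section Split

variable {M N : ℕ}

/-- The frequency vector with its reservoir entries set to zero. -/
def sysOnly (ζ : Vel (Fin M ⊕ Fin N)) : Vel (Fin M ⊕ Fin N) :=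
  WithLp.toLp 2 (Sum.elim (fun i => ζ (Sum.inl i)) fun _ => 0)

@[simp] lemma sysOnly_inl (ζ : Vel (Fin M ⊕ Fin N)) (i : Fin M) :
    sysOnly ζ (Sum.inl i) = ζ (Sum.inl i) := rfl

@[simp] lemma sysOnly_inr (ζ : Vel (Fin M ⊕ Fin N)) (j : Fin N) :
    sysOnly ζ (Sum.inr j) = 0 := rfl

@[simp] lemma sysPart_apply (ζ : Vel (Fin M ⊕ Fin N)) (i : Fin M) :
    sysPart ζ i = ζ (Sum.inl i) := rfl

@[simp] lemma resPart_apply (ζ : Vel (Fin M ⊕ Fin N)) (j : Fin N) :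
    resPart ζ j = ζ (Sum.inr j) := rfl

lemma sysPart_collide (i j : Fin M) (θ : ℝ) (ζ : Vel (Fin M ⊕ Fin N)) :
    sysPart (collide (Sum.inl i) (Sum.inl j) θ ζ) = collide i j θ (sysPart ζ) := by
  ext k
  simp only [sysPart_apply, collide, Function.update_apply, Sum.inl.injEq]

lemma resPart_collide (i j : Fin M) (θ : ℝ) (ζ : Vel (Fin M ⊕ Fin N)) :
    resPart (collide (Sum.inl i) (Sum.inl j) θ ζ) = resPart ζ := by
  ext k
  simp [collide]

lemma sysOnly_collide (i j : Fin M) (θ : ℝ) (ζ : Vel (Fin M ⊕ Fin N)) :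
    sysOnly (collide (Sum.inl i) (Sum.inl j) θ ζ)
      = collide (Sum.inl i) (Sum.inl j) θ (sysOnly ζ) := by
  ext k
  rcases k with k | k
  · simp only [sysOnly_inl, collide, Function.update_apply]
  · simp [collide]

lemma sysPart_collideBath (i : Fin M) (θ : ℝ) (ζ : Vel (Fin M ⊕ Fin N)) :
    sysPart (collideBath (Sum.inl i) θ 0 ζ) = collideBath i θ 0 (sysPart ζ) := by
  ext k
  simp only [sysPart_apply, collideBath, Function.update_apply, Sum.inl.injEq]

lemma resPart_collideBath (i : Fin M) (θ : ℝ) (ζ : Vel (Fin M ⊕ Fin N)) :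
    resPart (collideBath (Sum.inl i) θ 0 ζ) = resPart ζ := by
  ext k
  simp [collideBath]

lemma sysOnly_collideBath (i : Fin M) (θ : ℝ) (ζ : Vel (Fin M ⊕ Fin N)) :
    sysOnly (collideBath (Sum.inl i) θ 0 ζ) = collideBath (Sum.inl i) θ 0 (sysOnly ζ) := by
  ext k
  rcases k with k | k
  · simp only [sysOnly_inl, collideBath, Function.update_apply]
  · simp [collideBath]

lemma sysPart_sysOnly (ζ : Vel (Fin M ⊕ Fin N)) : sysPart (sysOnly ζ) = sysPart ζ := rfl

lemma maxwellian_split (ζ : Vel (Fin M ⊕ Fin N)) :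
    maxwellian ζ = maxwellian (sysPart ζ) * maxwellian (resPart ζ) :=
  Fintype.prod_sum_type _

lemma norm_sq_split (ζ : Vel (Fin M ⊕ Fin N)) :
    ‖ζ‖ ^ 2 = ‖sysPart ζ‖ ^ 2 + ‖resPart ζ‖ ^ 2 := by
  simp only [EuclideanSpace.norm_sq_eq, Fintype.sum_sum_type]
  rfl

lemma inner_split (x ζ : Vel (Fin M ⊕ Fin N)) :
    inner ℝ x ζ = inner ℝ (sysPart x) (sysPart ζ) + inner ℝ (resPart x) (resPart ζ) := by
  simp only [PiLp.inner_apply, Fintype.sum_sum_type]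
  rfl

lemma planeWave_split (ζ x : Vel (Fin M ⊕ Fin N)) :
    planeWave ζ x = planeWave (sysPart ζ) (sysPart x) * planeWave (resPart ζ) (resPart x) := by
  rw [planeWave, planeWave, planeWave, ← Complex.exp_add, inner_split]
  congr 1
  push_cast
  ring

/-- Vanishes when the reservoir is independent of the system and Maxwellian. -/
def correlationAt (ζ : Vel (Fin M ⊕ Fin N)) : State M N →L[ℝ] ℂ :=
  fourierAt ζ - maxwellian (resPart ζ) • fourierAt (sysOnly ζ)

lemma correlationAt_apply (ζ : Vel (Fin M ⊕ Fin N)) (f : State M N) :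
    correlationAt ζ f = fourierAt ζ f - maxwellian (resPart ζ) * fourierAt (sysOnly ζ) f := by
  simp [correlationAt]

lemma collisionCovariant_correlationAt {i j : Fin M} (hij : i ≠ j) :
    CollisionCovariant (correlationAt : Vel (Fin M ⊕ Fin N) → _) (Sum.inl i) (Sum.inl j)
      (Sum.inl_injective.ne hij) := fun ζ f => by
  have hc : ∀ ζ : Vel (Fin M ⊕ Fin N), Continuous fun θ =>
      fourierAt (collide (Sum.inl i) (Sum.inl j) θ ζ) f := fun ζ =>
    (continuous_fourierAt f).comp (continuous_collide_left _ _ ζ)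
  have hc' : Continuous fun θ => (maxwellian (resPart ζ) : ℂ) *
      fourierAt (collide (Sum.inl i) (Sum.inl j) θ (sysOnly ζ)) f := continuous_const.mul (hc _)
  simp only [correlationAt_apply, resPart_collide, sysOnly_collide]
  rw [angleMean_sub (hc ζ) hc', angleMean_const_mul,
    collisionCovariant_fourierAt, collisionCovariant_fourierAt]

/-- The multiplier depends only on the `i`-th system frequency, which `sysOnly` keeps, so both terms
of the correlation carry the same factor. -/
lemma thermostatCovariant_correlationAt (i : Fin M) :
    ThermostatCovariant (correlationAt : Vel (Fin M ⊕ Fin N) → _) (Sum.inl i) := fun ζ f => by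
  have hc : ∀ ζ : Vel (Fin M ⊕ Fin N), Continuous fun θ =>
      (gauss (ζ (Sum.inl i) * Real.sin θ) : ℂ) * fourierAt (collideBath (Sum.inl i) θ 0 ζ) f :=
    fun ζ => (Complex.continuous_ofReal.comp (continuous_gauss.comp (by fun_prop))).mul
      ((continuous_fourierAt f).comp (continuous_collideBath_left _ ζ))
  have hc' : Continuous fun θ => (maxwellian (resPart ζ) : ℂ) *
      ((gauss (ζ (Sum.inl i) * Real.sin θ) : ℂ) *
        fourierAt (collideBath (Sum.inl i) θ 0 (sysOnly ζ)) f) :=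
    continuous_const.mul (hc (sysOnly ζ))
  simp only [correlationAt_apply, resPart_collideBath, sysOnly_collideBath, mul_sub,
    mul_left_comm _ ((maxwellian (resPart ζ) : ℝ) : ℂ)]
  rw [angleMean_sub (hc ζ) hc', angleMean_const_mul,
    thermostatCovariant_fourierAt, thermostatCovariant_fourierAt]
  rfl

lemma fourierAt_initialState {l : Vel (Fin M) → ℝ} (hl : Integrable l)
    (ζ : Vel (Fin M ⊕ Fin N)) :
    fourierAt ζ (initialState N hl)
      = 𝓕 (fun v => (l v : ℂ)) (sysPart ζ) * maxwellian (resPart ζ) := by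
  have hmp := measurePreserving_split M N
  have hi : Integrable fun p : Vel (Fin M) × Vel (Fin N) =>
      (planeWave (sysPart ζ) p.1 * (l p.1 : ℂ)) * (planeWave (resPart ζ) p.2 * (maxwellian p.2 : ℂ)) :=
    (integrable_planeWave_mul _ hl).mul_prod (integrable_planeWave_mul _ integrable_maxwellian)
  have h1 : fourierAt ζ (initialState N hl)
      = ∫ p : Vel (Fin M) × Vel (Fin N), (planeWave (sysPart ζ) p.1 * (l p.1 : ℂ)) *
        (planeWave (resPart ζ) p.2 * (maxwellian p.2 : ℂ)) := by
    rw [← hmp.map_eq, integral_map hmp.aemeasurable (by rw [hmp.map_eq]; exact hi.1),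
      fourierAt_apply]
    refine integral_congr_ae ?_
    filter_upwards [(integrable_initial (N := N) hl).coeFn_toL1] with x hx
    rw [initialState, hx, planeWave_split]
    push_cast
    ring
  rw [h1, ← fourier_maxwellian, fourier_eq_integral_planeWave, fourier_eq_integral_planeWave]
  exact integral_prod_mul (fun v => planeWave (sysPart ζ) v * (l v : ℂ))
    (fun w => planeWave (resPart ζ) w * (maxwellian w : ℂ))

lemma maxwellian_zero {ι : Type*} [Fintype ι] : maxwellian (0 : Vel ι) = 1 := by
  simp [maxwellian_eq]

lemma integral_maxwellian {ι : Type*} [Fintype ι] : ∫ v : Vel ι, maxwellian v = 1 := by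
  have h := fourier_maxwellian (0 : Vel ι)
  rw [fourier_eq_integral_planeWave, maxwellian_zero] at h
  simp only [planeWave, inner_zero_right, mul_zero, Complex.ofReal_zero, zero_mul,
    Complex.exp_zero, one_mul] at h
  rw [integral_complex_ofReal] at h
  exact Complex.ofReal_injective h

lemma correlationAt_initialState {l : Vel (Fin M) → ℝ} (hl : Integrable l)
    (ζ : Vel (Fin M ⊕ Fin N)) : correlationAt ζ (initialState N hl) = 0 := by
  have h : resPart (sysOnly ζ) = 0 := rfl
  rw [correlationAt_apply, fourierAt_initialState, fourierAt_initialState, sysPart_sysOnly, h,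
    maxwellian_zero]
  push_cast
  ring

lemma fourierAt_zero_initialState {l : Vel (Fin M) → ℝ} (hl : Integrable l)
    (h1 : ∫ v, l v = 1) : fourierAt 0 (initialState N hl) = 1 := by
  have hs : sysPart (0 : Vel (Fin M ⊕ Fin N)) = 0 := rfl
  have hr : resPart (0 : Vel (Fin M ⊕ Fin N)) = 0 := rfl
  rw [fourierAt_initialState, hs, hr, maxwellian_zero, fourier_eq_integral_planeWave]
  simp only [planeWave, inner_zero_right, mul_zero, Complex.ofReal_zero, zero_mul,
    Complex.exp_zero, one_mul]
  rw [integral_complex_ofReal, h1]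
  simp

lemma norm_deviationAt_initialState_le {l : Vel (Fin M) → ℝ} (hl : Integrable l)
    (h1 : ∫ v, l v = 1) {D : ℝ}
    (hD : ∀ ξ, ‖𝓕 (fun v => (l v : ℂ)) ξ
      - 𝓕 (fun v : Vel (Fin M) => (maxwellian v : ℂ)) ξ‖ ≤ D * ‖ξ‖ ^ 2)
    (ζ : Vel (Fin M ⊕ Fin N)) :
    ‖deviationAt ζ (initialState N hl)‖ ≤ D * ‖sysPart ζ‖ ^ 2 := by
  have h : deviationAt ζ (initialState N hl)
      = (𝓕 (fun v => (l v : ℂ)) (sysPart ζ)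
        - 𝓕 (fun v : Vel (Fin M) => (maxwellian v : ℂ)) (sysPart ζ))
        * maxwellian (resPart ζ) := by
    rw [deviationAt_apply, fourierAt_zero_initialState hl h1, fourierAt_initialState,
      maxwellian_split, fourier_maxwellian]
    push_cast
    ring
  rw [h, norm_mul, Complex.norm_real, Real.norm_of_nonneg (maxwellian_nonneg _)]
  exact (mul_le_of_le_one_right (norm_nonneg _) (maxwellian_le_one _)).trans (hD _)

/-- The gauge of the distance to the Maxwellian in the system frequencies. -/
def deviationGauge (M N : ℕ) : Gauge (State M N) :=
  functionalGauge deviationAt (fun ζ => ‖sysPart ζ‖ ^ 2) fun _ => sq_nonneg _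

lemma norm_deviationAt_thermostatOp_le {f : State M N} {C : ℝ}
    (hf : ∀ ζ, ‖deviationAt ζ f‖ ≤ C * ‖sysPart ζ‖ ^ 2) (i : Fin M)
    (ζ : Vel (Fin M ⊕ Fin N)) :
    ‖deviationAt ζ (thermostatOp (Sum.inl i) f)‖
      ≤ C * ‖sysPart ζ‖ ^ 2 - C / 2 * ζ (Sum.inl i) ^ 2 := by
  rw [thermostatCovariant_deviationAt]
  -- The `i`-th frequency shrinks by `cos θ`, so the quadratic bound drops by `C ζ_i² sin² θ`, whose
  -- mean is `C ζ_i² / 2`.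
  refine (norm_angleMean_le_mean
    (B := fun θ => C * ‖sysPart ζ‖ ^ 2 - C * ζ (Sum.inl i) ^ 2 * Real.sin θ ^ 2)
    (by fun_prop) fun θ => ?_).trans (le_of_eq ?_)
  · rw [norm_mul, Complex.norm_real, Real.norm_of_nonneg (gauss_nonneg _)]
    refine (mul_le_of_le_one_left (norm_nonneg _) (gauss_le_one _)).trans ((hf _).trans ?_)
    rw [sysPart_collideBath, norm_sq_collideBath_zero, sysPart_apply]
    exact le_of_eq (by ring)
  · rw [intervalIntegral.integral_sub (by simp) (Continuous.intervalIntegrable (by fun_prop) _ _),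
      intervalIntegral.integral_const_mul (C * ζ (Sum.inl i) ^ 2), integral_sin_sq]
    simp
    field_simp

/-- Each thermostat damps its own frequency only, by half of its square; over all system particles
these halves add up to half of `‖sysPart ζ‖ ^ 2`. Hence `M - 1 / 2`, and after subtracting `M` the
decay rate `μ / 2`. -/
lemma opLe_deviationGauge_sum_thermostatOp :
    (deviationGauge M N).OpLe (∑ i : Fin M, thermostatOp (Sum.inl i)) (M - 1 / 2) :=
  fun f C _ hf ζ => by
    have h1 : (∑ i : Fin M, thermostatOp (Sum.inl i) : State M N →L[ℝ] State M N) f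
        = ∑ i : Fin M, thermostatOp (Sum.inl i) f :=
      sum_apply _ _ _
    rw [h1, map_sum]
    refine (norm_sum_le _ _).trans ((Finset.sum_le_sum fun i _ =>
      norm_deviationAt_thermostatOp_le hf i ζ).trans (le_of_eq ?_))
    have h2 : ‖sysPart ζ‖ ^ 2 = ∑ i, ζ (Sum.inl i) ^ 2 := by
      simp [EuclideanSpace.norm_sq_eq]
    rw [Finset.sum_sub_distrib, ← Finset.mul_sum (a := C / 2), ← h2]
    simp
    ring

lemma norm_deviationAt_thermostatEvolution_le (hM : 0 < M) {lamS mu t D : ℝ} (hlamS : 0 ≤ lamS)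
    (hmu : 0 ≤ mu) (ht : 0 ≤ t) (hD : 0 ≤ D) {f : State M N}
    (hf : ∀ ζ, ‖deviationAt ζ f‖ ≤ D * ‖sysPart ζ‖ ^ 2) (ζ : Vel (Fin M ⊕ Fin N)) :
    ‖deviationAt ζ (thermostatEvolution lamS mu t f)‖
      ≤ Real.exp (-(mu / 2) * t) * D * ‖sysPart ζ‖ ^ 2 := by
  have hM1 : (1 : ℝ) ≤ M := by exact_mod_cast hM
  have h := (deviationGauge M N).thermostatEvolution_le hM hlamS hmu ht
    (by linarith) hD (fun i j hij => (collisionCovariant_deviationAt _).opLe _ fun ζ θ => by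
      rw [sysPart_collide, norm_collide hij]) opLe_deviationGauge_sum_thermostatOp hf ζ
  have he : t * (mu * ((M : ℝ) - 1 / 2 - M)) = -(mu / 2) * t := by ring
  rw [he] at h
  exact h

/-- The correlation functionals vanish at time zero, and the bound `0` is propagated like any other
gauge bound. -/
lemma fourierAt_thermostatEvolution_initialState (hM : 0 < M) {lamS mu t : ℝ} (hlamS : 0 ≤ lamS)
    (hmu : 0 ≤ mu) (ht : 0 ≤ t) {l : Vel (Fin M) → ℝ} (hl : Integrable l)
    (ζ : Vel (Fin M ⊕ Fin N)) :
    fourierAt ζ (thermostatEvolution lamS mu t (initialState N hl))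
      = maxwellian (resPart ζ) *
        fourierAt (sysOnly ζ) (thermostatEvolution lamS mu t (initialState N hl)) := by
  let G : Gauge (State M N) := functionalGauge correlationAt (fun _ => 1) fun _ => zero_le_one
  have hB : G.OpLe (∑ i : Fin M, thermostatOp (Sum.inl i)) (Finset.univ : Finset (Fin M)).card :=
    Gauge.OpLe.sum _ fun i _ => (thermostatCovariant_correlationAt i).opLe _ fun _ _ => le_rfl
  have h := G.thermostatEvolution_le hM hlamS hmu ht (Nat.cast_nonneg _) le_rfl
    (fun i j hij => (collisionCovariant_correlationAt hij).opLe _ fun _ _ => rfl) hB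
    (f := initialState N hl) (fun ζ => by simp [correlationAt_initialState]) ζ
  rw [mul_zero, zero_mul, norm_le_zero_iff, correlationAt_apply, sub_eq_zero] at h
  exact h

end Split

/-! ### One-dimensional estimates -/

lemma abs_two_cos_sub_le (u : ℝ) : |2 * Real.cos u - 2 + u ^ 2| ≤ u ^ 4 := by
  have h0 := Real.one_sub_sq_div_two_le_cos (x := u)
  rw [abs_of_nonneg (by linarith)]
  rcases le_total |u| 1 with hu | hu
  · have h := (abs_le.1 (Real.cos_bound hu)).2
    have h4 : |u| ^ 4 = u ^ 4 := by rw [← abs_pow, abs_of_nonneg (by positivity)]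
    rw [h4] at h
    have : 0 ≤ u ^ 4 := by positivity
    linarith
  · have h1 : 1 ≤ u ^ 2 := by rw [← sq_abs]; nlinarith
    have := Real.cos_le_one u
    nlinarith

/-! ### Oscillatory integrals in one frequency -/

section Oscillatory

/-- The `k`-th derivative in `z` of `∫ exp (-2πi z a) F`. -/
def oscIntegral {X : Type*} [MeasurableSpace X] (μ : Measure X) (a : X → ℝ) (F : X → ℂ) (k : ℕ) (z : ℝ) : ℂ :=
  ∫ x, ((-2 * π * a x : ℝ) * Complex.I) ^ k *
    Complex.exp ((z : ℂ) * ((-2 * π * a x : ℝ) * Complex.I)) * F x ∂μ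

lemma norm_exp_osc (z b : ℝ) : ‖Complex.exp ((z : ℂ) * ((b : ℂ) * Complex.I))‖ = 1 := by
  rw [← mul_assoc, ← Complex.ofReal_mul, Complex.norm_exp_ofReal_mul_I]

lemma norm_oscIntegrand {X : Type*} (a : X → ℝ) (F : X → ℂ) (k : ℕ) (z : ℝ) (x : X) :
    ‖((-2 * π * a x : ℝ) * Complex.I) ^ k *
      Complex.exp ((z : ℂ) * ((-2 * π * a x : ℝ) * Complex.I)) * F x‖
      = (2 * π) ^ k * (|a x| ^ k * ‖F x‖) := by
  rw [norm_mul, norm_mul, norm_pow, norm_exp_osc, norm_mul, Complex.norm_I, Complex.norm_real,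
    Real.norm_eq_abs, abs_mul, abs_mul, abs_neg, abs_two, abs_of_pos Real.pi_pos]
  ring

variable {X : Type*} [MeasurableSpace X] {μ : Measure X} {a : X → ℝ} {F : X → ℂ}

lemma aestronglyMeasurable_oscIntegrand (ha : Measurable a) (hF : AEStronglyMeasurable F μ)
    (k : ℕ) (z : ℝ) : AEStronglyMeasurable (fun x => ((-2 * π * a x : ℝ) * Complex.I) ^ k *
      Complex.exp ((z : ℂ) * ((-2 * π * a x : ℝ) * Complex.I)) * F x) μ := by
  refine AEStronglyMeasurable.mul (Measurable.aestronglyMeasurable ?_) hF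
  fun_prop

lemma integrable_oscIntegrand (ha : Measurable a) (hF : AEStronglyMeasurable F μ) {k : ℕ}
    (hk : Integrable (fun x => |a x| ^ k * ‖F x‖) μ) (z : ℝ) :
    Integrable (fun x => ((-2 * π * a x : ℝ) * Complex.I) ^ k *
      Complex.exp ((z : ℂ) * ((-2 * π * a x : ℝ) * Complex.I)) * F x) μ := by
  refine (hk.const_mul ((2 * π) ^ k)).mono' (aestronglyMeasurable_oscIntegrand ha hF k z) ?_
  exact Filter.Eventually.of_forall fun x => (norm_oscIntegrand a F k z x).le

lemma hasDerivAt_oscIntegral (ha : Measurable a) (hF : AEStronglyMeasurable F μ) {k : ℕ}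
    (hk : Integrable (fun x => |a x| ^ k * ‖F x‖) μ)
    (hk1 : Integrable (fun x => |a x| ^ (k + 1) * ‖F x‖) μ) (z : ℝ) :
    HasDerivAt (oscIntegral μ a F k) (oscIntegral μ a F (k + 1) z) z := by
  refine (hasDerivAt_integral_of_dominated_loc_of_deriv_le (s := Set.univ)
    (bound := fun x => (2 * π) ^ (k + 1) * (|a x| ^ (k + 1) * ‖F x‖)) Filter.univ_mem
    (Filter.Eventually.of_forall fun z => aestronglyMeasurable_oscIntegrand ha hF k z)
    (integrable_oscIntegrand ha hF hk z) (aestronglyMeasurable_oscIntegrand ha hF (k + 1) z)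
    (Filter.Eventually.of_forall fun x z _ => (norm_oscIntegrand a F (k + 1) z x).le)
    (hk1.const_mul _) (Filter.Eventually.of_forall fun x z _ => ?_)).2
  have h1 : HasDerivAt (fun z : ℝ => (z : ℂ) * ((-2 * π * a x : ℝ) * Complex.I))
      (1 * ((-2 * π * a x : ℝ) * Complex.I)) z :=
    (Complex.ofRealCLM.hasDerivAt (x := z)).mul_const _
  refine ((h1.cexp.const_mul (((-2 * π * a x : ℝ) * Complex.I) ^ k)).mul_const (F x)).congr_deriv ?_
  ring

lemma integral_second_difference {f₁ f₂ f₃ f₄ : X → ℂ} (h₁ : Integrable f₁ μ)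
    (h₂ : Integrable f₂ μ) (h₃ : Integrable f₃ μ) (h₄ : Integrable f₄ μ) {c : ℂ} :
    ∫ x, (f₁ x + f₂ x - 2 * f₃ x - c * f₄ x) ∂μ
      = ∫ x, f₁ x ∂μ + ∫ x, f₂ x ∂μ - 2 * ∫ x, f₃ x ∂μ - c * ∫ x, f₄ x ∂μ := by
  have j₁ : Integrable (fun x => f₁ x + f₂ x) μ := h₁.add h₂
  have j₂ : Integrable (fun x => f₁ x + f₂ x - 2 * f₃ x) μ := j₁.sub (h₃.const_mul 2)
  rw [integral_sub j₂ (h₄.const_mul c), integral_sub j₁ (h₃.const_mul 2), integral_add h₁ h₂,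
    integral_const_mul, integral_const_mul]

/-- Under the integral, the second difference minus `h²` times the second derivative is `2 cos u - 2
+ u²` with `u = -2π h a(x)`, times a unimodular phase and `F`. The fourth moment therefore enters
without differentiating four times. -/
lemma norm_second_difference_oscIntegral_le (ha : Measurable a) (hF : AEStronglyMeasurable F μ)
    (h0 : Integrable F μ) (h2 : Integrable (fun x => |a x| ^ 2 * ‖F x‖) μ)
    (h4 : Integrable (fun x => |a x| ^ 4 * ‖F x‖) μ) (z h : ℝ) :
    ‖oscIntegral μ a F 0 (z + h) + oscIntegral μ a F 0 (z - h) - 2 * oscIntegral μ a F 0 z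
      - h ^ 2 * oscIntegral μ a F 2 z‖ ≤ (2 * π) ^ 4 * (∫ x, |a x| ^ 4 * ‖F x‖ ∂μ) * h ^ 4 := by
  have i0 := fun z => integrable_oscIntegrand (k := 0) ha hF (by simpa using h0.norm) z
  have i2 := integrable_oscIntegrand ha hF h2 z
  simp only [oscIntegral]
  rw [← integral_second_difference (i0 (z + h)) (i0 (z - h)) (i0 z) i2, ← integral_const_mul,
    ← integral_mul_const]
  refine norm_integral_le_of_norm_le ((h4.const_mul _).mul_const _)
    (Filter.Eventually.of_forall fun x => ?_)
  set b : ℝ := -2 * π * a x with hb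
  have he : ((b : ℂ) * Complex.I) ^ 0 * Complex.exp (((z + h : ℝ) : ℂ) * (b * Complex.I)) * F x
      + ((b : ℂ) * Complex.I) ^ 0 * Complex.exp (((z - h : ℝ) : ℂ) * (b * Complex.I)) * F x
      - 2 * (((b : ℂ) * Complex.I) ^ 0 * Complex.exp ((z : ℂ) * (b * Complex.I)) * F x)
      - h ^ 2 * (((b : ℂ) * Complex.I) ^ 2 * Complex.exp ((z : ℂ) * (b * Complex.I)) * F x)
      = ((2 * Real.cos (h * b) - 2 + (h * b) ^ 2 : ℝ) : ℂ) *
        (Complex.exp ((z : ℂ) * (b * Complex.I)) * F x) := by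
    have e1 : Complex.exp (((z + h : ℝ) : ℂ) * (b * Complex.I))
        = Complex.exp ((z : ℂ) * (b * Complex.I)) * Complex.exp ((h * b : ℂ) * Complex.I) := by
      rw [← Complex.exp_add]; push_cast; ring_nf
    have e2 : Complex.exp (((z - h : ℝ) : ℂ) * (b * Complex.I))
        = Complex.exp ((z : ℂ) * (b * Complex.I)) * Complex.exp (-(h * b : ℂ) * Complex.I) := by
      rw [← Complex.exp_add]; push_cast; ring_nf
    have e3 : (2 * Complex.cos (h * b : ℂ)) = Complex.exp ((h * b : ℂ) * Complex.I)
        + Complex.exp (-(h * b : ℂ) * Complex.I) := Complex.two_cos _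
    rw [e1, e2]
    push_cast
    rw [e3]
    linear_combination (-(h : ℂ) ^ 2 * b ^ 2 * Complex.exp ((z : ℂ) * (b * Complex.I)) * F x)
      * Complex.I_sq
  refine (le_of_eq (congrArg norm he)).trans ?_
  rw [norm_mul, norm_mul, norm_exp_osc, one_mul, Complex.norm_real, Real.norm_eq_abs]
  calc _ ≤ (h * b) ^ 4 * ‖F x‖ :=
        mul_le_mul_of_nonneg_right (abs_two_cos_sub_le _) (norm_nonneg _)
    _ = _ := by
        have : |a x| ^ 4 = a x ^ 4 := by rw [← abs_pow, abs_of_nonneg (by positivity)]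
        rw [this, hb]
        ring

end Oscillatory

/-- Interpolation between the growth of a function and its fourth derivative. -/
lemma norm_second_deriv_le {κ κ₂ : ℝ → ℂ} {D F L ρ : ℝ} (hD : 0 ≤ D) (hF : 0 ≤ F)
    (hL : F + D ≤ L) (hκ : ∀ z, ‖κ z‖ ≤ D * (ρ + z ^ 2))
    (hT : ∀ z h : ℝ, ‖κ (z + h) + κ (z - h) - 2 * κ z - h ^ 2 * κ₂ z‖ ≤ F * h ^ 4) (z : ℝ) :
    ‖κ₂ z‖ ≤ √(D * L) * (4 * (ρ + z ^ 2) + 3) := by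
  -- Solve the second-difference estimate for `κ₂ z` and bound `κ` at `z + h`, `z - h` and twice at
  -- `z`; the step `h` remains free.
  have key : ∀ h : ℝ, h ^ 2 * ‖κ₂ z‖ ≤ D * (4 * (ρ + z ^ 2) + 2 * h ^ 2) + F * h ^ 4 := fun h => by
    have e : ((h ^ 2 : ℝ) : ℂ) * κ₂ z = κ (z + h) + κ (z - h) - 2 * κ z
        - (κ (z + h) + κ (z - h) - 2 * κ z - h ^ 2 * κ₂ z) := by push_cast; ring
    have e' : h ^ 2 * ‖κ₂ z‖ = ‖((h ^ 2 : ℝ) : ℂ) * κ₂ z‖ := by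
      rw [norm_mul, Complex.norm_real, Real.norm_of_nonneg (sq_nonneg h)]
    rw [e', e]
    have n1 := norm_sub_le (κ (z + h) + κ (z - h) - 2 * κ z)
      (κ (z + h) + κ (z - h) - 2 * κ z - h ^ 2 * κ₂ z)
    have n2 := norm_sub_le (κ (z + h) + κ (z - h)) (2 * κ z)
    have n3 := norm_add_le (κ (z + h)) (κ (z - h))
    have n4 : ‖2 * κ z‖ = 2 * ‖κ z‖ := by simp
    have := hT z h
    have := hκ z
    have := hκ (z + h)
    have := hκ (z - h)
    nlinarith
  -- For `D = 0` the step tends to zero: `h² = ε / (F + 1)` leaves `F h² ≤ ε`.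
  rcases hD.eq_or_lt with rfl | hD
  · have h0 : ‖κ₂ z‖ ≤ 0 := by
      refine le_of_forall_pos_le_add fun ε hε => ?_
      have hpos : 0 < ε / (F + 1) := by positivity
      have h := key (√(ε / (F + 1)))
      have h4 : √(ε / (F + 1)) ^ 4 = (ε / (F + 1)) * (ε / (F + 1)) := by
        rw [show (4 : ℕ) = 2 * 2 from rfl, pow_mul, Real.sq_sqrt hpos.le, sq]
      rw [Real.sq_sqrt hpos.le, h4, zero_mul, zero_add, mul_left_comm] at h
      have h' := le_of_mul_le_mul_left h hpos
      have : F * (ε / (F + 1)) ≤ ε := by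
        rw [mul_div_assoc', div_le_iff₀ (by positivity)]
        nlinarith
      linarith
    simpa using h0
  · have hLpos : 0 < L := by linarith
    have hs : 0 < √(D / L) := Real.sqrt_pos.2 (by positivity)
    -- The choice `h² = √(D / L)` balances `D / h²` against `L h²`; both equal `√(D L)`.
    have h := key (√(√(D / L)))
    have h4 : √(√(D / L)) ^ 4 = √(D / L) * √(D / L) := by
      rw [show (4 : ℕ) = 2 * 2 from rfl, pow_mul, Real.sq_sqrt hs.le, sq]
    rw [Real.sq_sqrt hs.le, h4] at h
    have hG : √(D * L) = √(D / L) * L := by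
      rw [show D * L = D / L * L ^ 2 by field_simp, Real.sqrt_mul (by positivity),
        Real.sqrt_sq hLpos.le]
    have hD' : D = √(D / L) * √(D * L) := by
      rw [hG, ← mul_assoc, Real.mul_self_sqrt (by positivity)]
      field_simp
    have hDG : D ≤ √(D * L) := Real.le_sqrt_of_sq_le (by nlinarith)
    refine le_of_mul_le_mul_left (h.trans ?_) hs
    have hF' : F * √(D / L) ≤ √(D * L) := by
      rw [hG, mul_comm]
      exact mul_le_mul_of_nonneg_left (by linarith) hs.le
    have t1 : D * (4 * (ρ + z ^ 2)) = √(D / L) * (√(D * L) * (4 * (ρ + z ^ 2))) := by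
      rw [← mul_assoc (√(D / L)), ← hD']
    have t2 : D * (2 * √(D / L)) ≤ √(D / L) * (2 * √(D * L)) := by nlinarith
    have t3 : F * (√(D / L) * √(D / L)) ≤ √(D / L) * √(D * L) := by nlinarith
    nlinarith

lemma hasDerivAt_gauss (x : ℝ) : HasDerivAt gauss (-2 * π * x * gauss x) x := by
  have h := (((hasDerivAt_id x).pow 2).const_mul (-π)).exp
  refine h.congr_deriv ?_
  simp [gauss]
  ring

/-- Increments of `r ↦ κ (r cos θ) g (r sin θ)` for `κ` flat at the origin. -/
lemma norm_radial_increment_le {κ κ₁ κ₂ : ℝ → ℂ} {D G ρ : ℝ} (hD : 0 ≤ D) (hDG : D ≤ G)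
    (hρ : 0 ≤ ρ) (h1 : ∀ z, HasDerivAt κ (κ₁ z) z) (h2 : ∀ z, HasDerivAt κ₁ (κ₂ z) z)
    (h10 : κ₁ 0 = 0) (hκ : ∀ z, ‖κ z‖ ≤ D * (ρ + z ^ 2))
    (hκ₂ : ∀ z, ‖κ₂ z‖ ≤ G * (4 * (ρ + z ^ 2) + 3)) {c s : ℝ} (hcs : c ^ 2 + s ^ 2 = 1)
    {r₀ r₁ : ℝ} (hr₀ : 0 ≤ r₀) (hr : r₀ ≤ r₁) :
    ‖κ (r₁ * c) * gauss (r₁ * s) - κ (r₀ * c) * gauss (r₀ * s)‖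
      ≤ G * ((2 + π) * (ρ + r₁ ^ 2) + 3 / 2) * (r₁ ^ 2 - r₀ ^ 2) := by
  have hG : 0 ≤ G := hD.trans hDG
  have hπ := Real.pi_pos
  have hc1 : c ^ 2 ≤ 1 := by nlinarith [sq_nonneg s]
  have hs1 : s ^ 2 ≤ 1 := by nlinarith [sq_nonneg c]
  set S : ℝ := G * (4 * (ρ + r₁ ^ 2) + 3) with hS
  -- Since `κ₁ 0 = 0`, the mean value inequality gives linear growth, with `S` the bound on `κ₂` for
  -- arguments up to `r₁`.
  have hκ₁ : ∀ z, z ^ 2 ≤ r₁ ^ 2 → ‖κ₁ z‖ ≤ S * |z| := fun z hz => by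
    have h := (convex_segment (0 : ℝ) z).norm_image_sub_le_of_norm_hasDerivWithin_le
      (f := κ₁) (f' := κ₂) (C := S) (fun y _ => (h2 y).hasDerivWithinAt) (fun y hy => ?_)
      (left_mem_segment ℝ 0 z) (right_mem_segment ℝ 0 z)
    · simpa [h10] using h
    · obtain ⟨t, u, ht, hu, htu, rfl⟩ := hy
      refine (hκ₂ _).trans (mul_le_mul_of_nonneg_left ?_ hG)
      simp only [smul_eq_mul, mul_zero, zero_add]
      have hle : u ^ 2 ≤ 1 := by nlinarith
      have : (u * z) ^ 2 ≤ z ^ 2 := by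
        rw [mul_pow]
        exact mul_le_of_le_one_left (sq_nonneg z) hle
      nlinarith
  have hm : ∀ r : ℝ, HasDerivAt (fun r : ℝ => κ (r * c) * (gauss (r * s) : ℂ))
      (c * κ₁ (r * c) * gauss (r * s)
        + κ (r * c) * ((-2 * π * (r * s) * gauss (r * s) * s : ℝ) : ℂ)) r := fun r => by
    have e1 : HasDerivAt (fun r : ℝ => κ (r * c)) (c • κ₁ (r * c)) r := by
      have := HasDerivAt.scomp r (h1 (r * c)) ((hasDerivAt_id r).mul_const c)
      rw [one_mul] at this
      exact this
    have e2 : HasDerivAt (fun r : ℝ => (gauss (r * s) : ℂ))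
        ((-2 * π * (r * s) * gauss (r * s) * s : ℝ) : ℂ) r := by
      have := (hasDerivAt_gauss (r * s)).comp r ((hasDerivAt_id r).mul_const s)
      simpa using this.ofReal_comp
    refine (e1.mul e2).congr_deriv ?_
    rw [Complex.real_smul]
  have hB : ∀ r : ℝ, HasDerivAt (fun r : ℝ => (G * ((2 + π) * (ρ + r₁ ^ 2) + 3 / 2)) * (r ^ 2 - r₀ ^ 2))
      ((G * ((2 + π) * (ρ + r₁ ^ 2) + 3 / 2)) * (2 * r)) r := fun r => by
    have := (((hasDerivAt_id r).pow 2).sub_const (r₀ ^ 2)).const_mul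
      (G * ((2 + π) * (ρ + r₁ ^ 2) + 3 / 2))
    refine this.congr_deriv ?_
    simp
  -- The radial derivative is bounded by a multiple of `r`, so comparison with a multiple of `r² -
  -- r₀²` yields an increment in the squared radius.
  refine image_norm_le_of_norm_deriv_right_le_deriv_boundary (a := r₀) (b := r₁)
    (f := fun r => κ (r * c) * (gauss (r * s) : ℂ) - κ (r₀ * c) * (gauss (r₀ * s) : ℂ))
    (fun r _ => ((hm r).sub_const _).continuousAt.continuousWithinAt)
    (fun r _ => ((hm r).sub_const _).hasDerivWithinAt) (by simp) hB (fun r hrr => ?_)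
    (right_mem_Icc.2 hr)
  have hr0 : 0 ≤ r := hr₀.trans hrr.1
  have hr1 : r ^ 2 ≤ r₁ ^ 2 := by nlinarith [hrr.2]
  have hrc : (r * c) ^ 2 ≤ r ^ 2 := by rw [mul_pow]; exact mul_le_of_le_one_right (sq_nonneg r) hc1
  have hca : |c| * |c| ≤ 1 := by rw [← sq, sq_abs]; exact hc1
  have n1 : ‖(c : ℂ) * κ₁ (r * c) * gauss (r * s)‖ ≤ S * r := by
    rw [norm_mul, norm_mul, Complex.norm_real, Complex.norm_real,
      Real.norm_of_nonneg (gauss_nonneg _), Real.norm_eq_abs]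
    refine (mul_le_of_le_one_right (by positivity) (gauss_le_one _)).trans ?_
    calc |c| * ‖κ₁ (r * c)‖ ≤ |c| * (S * |r * c|) :=
          mul_le_mul_of_nonneg_left (hκ₁ _ (hrc.trans hr1)) (abs_nonneg _)
      _ = S * r * (|c| * |c|) := by rw [abs_mul, abs_of_nonneg hr0]; ring
      _ ≤ S * r := mul_le_of_le_one_right (by positivity) hca
  have n2 : ‖κ (r * c) * ((-2 * π * (r * s) * gauss (r * s) * s : ℝ) : ℂ)‖
      ≤ G * (ρ + r₁ ^ 2) * (2 * π * r) := by
    rw [norm_mul, Complex.norm_real, Real.norm_eq_abs]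
    refine mul_le_mul ((hκ _).trans ?_) ?_ (abs_nonneg _) (by positivity)
    · exact mul_le_mul hDG (by linarith) (by positivity) hG
    · have : -2 * π * (r * s) * gauss (r * s) * s = -(2 * π * r * (s ^ 2 * gauss (r * s))) := by
        ring
      have hsg := mul_nonneg (sq_nonneg s) (gauss_nonneg (r * s))
      rw [this, abs_neg, abs_of_nonneg (by positivity)]
      refine mul_le_of_le_one_right (by positivity) ?_
      exact mul_le_one₀ hs1 (gauss_nonneg _) (gauss_le_one _)
  refine (norm_add_le _ _).trans ((add_le_add n1 n2).trans (le_of_eq ?_))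
  rw [hS]
  ring

/-- With `u = π y² ≤ 1`, `exp (-u) ≤ 1 / (1 + u) ≤ 1 - u / 2`. This trades a factor `y²` for `1 -
gauss y`, the form needed for the sum over the reservoir. -/
lemma mul_sq_le_one_sub_gauss {y : ℝ} (h : π * y ^ 2 ≤ 1) : π * y ^ 2 ≤ 2 * (1 - gauss y) := by
  have h0 : 0 ≤ π * y ^ 2 := by have := Real.pi_pos; positivity
  have h1 : gauss y ≤ 1 - π * y ^ 2 / 2 := by
    have h3 : gauss y = (Real.exp (π * y ^ 2))⁻¹ := by rw [gauss, neg_mul, Real.exp_neg]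
    rw [h3]
    refine inv_le_of_inv_le₀ (by linarith) ((inv_le_of_inv_le₀ (by linarith) ?_).trans
      (Real.add_one_le_exp _))
    rw [inv_le_comm₀ (by linarith) (by linarith), inv_le_iff_one_le_mul₀ (by linarith)]
    nlinarith
  linarith

/-! ### Radial averages -/

/-- For small `y`, split off the loss `1 - gauss y` and use the radial increment from `|x|` to `√(x²
+ y²)`. For large `y` no cancellation is needed. It is essential that `ρ + x²` is multiplied by `1 -
gauss y` and not only by a constant. -/
lemma norm_radial_difference_le {κ κ₁ κ₂ : ℝ → ℂ} {D G ρ : ℝ} (hD : 0 ≤ D) (hDG : D ≤ G)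
    (hρ : 0 ≤ ρ) (h1 : ∀ z, HasDerivAt κ (κ₁ z) z) (h2 : ∀ z, HasDerivAt κ₁ (κ₂ z) z)
    (h10 : κ₁ 0 = 0) (heven : ∀ z, κ (-z) = κ z) (hκ : ∀ z, ‖κ z‖ ≤ D * (ρ + z ^ 2))
    (hκ₂ : ∀ z, ‖κ₂ z‖ ≤ G * (4 * (ρ + z ^ 2) + 3)) {c s : ℝ} (hcs : c ^ 2 + s ^ 2 = 1)
    (x y : ℝ) :
    ‖κ (x * c) * gauss (x * s) * gauss y
      - κ (√(x ^ 2 + y ^ 2) * c) * gauss (√(x ^ 2 + y ^ 2) * s)‖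
      ≤ 5 * G * ((1 - gauss y) * (ρ + x ^ 2) + y ^ 2) := by
  have hG : 0 ≤ G := hD.trans hDG
  have hπ := Real.pi_pos
  have hc1 : c ^ 2 ≤ 1 := by nlinarith [sq_nonneg s]
  have hg0 := gauss_nonneg y
  have hg1 := gauss_le_one y
  have hr2 : √(x ^ 2 + y ^ 2) ^ 2 = x ^ 2 + y ^ 2 := Real.sq_sqrt (by positivity)
  have hm : ∀ r : ℝ, ‖κ (r * c) * gauss (r * s)‖ ≤ G * (ρ + r ^ 2) := fun r => by
    rw [norm_mul, Complex.norm_real, Real.norm_of_nonneg (gauss_nonneg _)]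
    refine (mul_le_of_le_one_right (norm_nonneg _) (gauss_le_one _)).trans ((hκ _).trans ?_)
    refine mul_le_mul hDG ?_ (by positivity) hG
    rw [mul_pow]
    have := mul_le_of_le_one_right (sq_nonneg r) hc1
    linarith
  have hx := hm x
  have hX : 0 ≤ ρ + x ^ 2 := by positivity
  rcases le_total (π * y ^ 2) 1 with hy | hy
  · have habs : κ (x * c) * gauss (x * s) = κ (|x| * c) * gauss (|x| * s) := by
      rcases abs_choice x with h | h
      · rw [h]
      · rw [h, neg_mul, neg_mul, heven, gauss_neg]
    have hinc := norm_radial_increment_le hD hDG hρ h1 h2 h10 hκ hκ₂ hcs (abs_nonneg x)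
      (Real.abs_le_sqrt (by nlinarith [sq_nonneg y]) : |x| ≤ √(x ^ 2 + y ^ 2))
    rw [hr2, sq_abs, ← habs, add_sub_cancel_left] at hinc
    have hsplit : κ (x * c) * gauss (x * s) * gauss y
        - κ (√(x ^ 2 + y ^ 2) * c) * gauss (√(x ^ 2 + y ^ 2) * s)
        = -((1 - gauss y : ℝ) * (κ (x * c) * gauss (x * s)))
          - (κ (√(x ^ 2 + y ^ 2) * c) * gauss (√(x ^ 2 + y ^ 2) * s)
            - κ (x * c) * gauss (x * s)) := by
      push_cast
      ring
    rw [hsplit]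
    have n1 : ‖-(((1 - gauss y : ℝ) : ℂ) * (κ (x * c) * gauss (x * s)))‖
        ≤ (1 - gauss y) * (G * (ρ + x ^ 2)) := by
      rw [norm_neg, norm_mul, Complex.norm_real, Real.norm_of_nonneg (by linarith)]
      exact mul_le_mul_of_nonneg_left hx (by linarith)
    refine (norm_sub_le _ _).trans ((add_le_add n1 hinc).trans ?_)
    -- The constant `5` is `1` from the loss term plus `4` from the increment, where `(2 + π) y² ≤
    -- 2π y² ≤ 4 (1 - gauss y)`.
    have hy2 := mul_sq_le_one_sub_gauss hy
    have hπ3 := Real.pi_gt_three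
    have e1 : (2 + π) * y ^ 2 ≤ 4 * (1 - gauss y) := by nlinarith [sq_nonneg y]
    have e2 : (2 + π) * y ^ 2 ≤ 2 := by nlinarith [sq_nonneg y]
    have e3 := mul_le_mul_of_nonneg_right e1 hX
    have e4 := mul_le_mul_of_nonneg_right e2 (sq_nonneg y)
    have e5 : ((2 + π) * (ρ + (x ^ 2 + y ^ 2)) + 3 / 2) * y ^ 2
        ≤ 4 * (1 - gauss y) * (ρ + x ^ 2) + 7 / 2 * y ^ 2 := by nlinarith
    have e6 := mul_le_mul_of_nonneg_left e5 hG
    nlinarith [mul_nonneg hG (sq_nonneg y)]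
  -- Now `1 - gauss y ≥ 1 / 2`, so bounding the two terms separately is affordable.
  · have hgy : gauss y ≤ 1 / 2 := by
      have h3 : gauss y = (Real.exp (π * y ^ 2))⁻¹ := by rw [gauss, neg_mul, Real.exp_neg]
      rw [h3, inv_le_comm₀ (Real.exp_pos _) (by norm_num)]
      have := Real.add_one_le_exp (π * y ^ 2)
      linarith
    have hr := hm (√(x ^ 2 + y ^ 2))
    rw [hr2] at hr
    refine (norm_sub_le _ _).trans ?_
    rw [norm_mul (κ (x * c) * gauss (x * s)), Complex.norm_real, Real.norm_of_nonneg hg0]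
    have e1 := mul_le_mul hx hgy hg0 (by positivity)
    have e2 := mul_nonneg (mul_nonneg hG hX) (by linarith : 0 ≤ 1 / 2 - gauss y)
    nlinarith [mul_nonneg hG (sq_nonneg y), mul_nonneg hG hX]

lemma angleMean_add_right {F : ℝ → ℂ} (hF : Function.Periodic F (2 * π)) (φ : ℝ) :
    angleMean (fun θ => F (θ + φ)) = angleMean F := by
  rw [angleMean, angleMean, intervalIntegral.integral_comp_add_right, zero_add,
    add_comm (2 * π), hF.intervalIntegral_add_eq φ 0, zero_add]

lemma exists_polar (x y : ℝ) :
    ∃ φ : ℝ, x = √(x ^ 2 + y ^ 2) * Real.cos φ ∧ y = √(x ^ 2 + y ^ 2) * Real.sin φ := by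
  refine ⟨Complex.arg ⟨x, y⟩, ?_, ?_⟩
  · have h := Complex.norm_mul_cos_arg ⟨x, y⟩
    rw [Complex.norm_eq_sqrt_sq_add_sq] at h
    exact h.symm
  · have h := Complex.norm_mul_sin_arg ⟨x, y⟩
    rw [Complex.norm_eq_sqrt_sq_add_sq] at h
    exact h.symm

/-- In polar coordinates for `(x, y)` the two arguments become `r cos (θ - φ)` and, up to sign, `r
sin (θ - φ)`; the mean over a period ignores the shift. -/
lemma angleMean_rotate (κ : ℝ → ℂ) (x y : ℝ) :
    angleMean (fun θ => κ (x * Real.cos θ + y * Real.sin θ)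
      * gauss (-x * Real.sin θ + y * Real.cos θ))
      = angleMean fun θ => κ (√(x ^ 2 + y ^ 2) * Real.cos θ)
        * gauss (√(x ^ 2 + y ^ 2) * Real.sin θ) := by
  obtain ⟨φ, hx, hy⟩ := exists_polar x y
  set r := √(x ^ 2 + y ^ 2)
  have hp : Function.Periodic (fun θ => κ (r * Real.cos θ) * (gauss (r * Real.sin θ) : ℂ))
      (2 * π) := fun θ => by simp
  rw [← angleMean_add_right hp (-φ)]
  congr 1
  ext θ
  rw [Real.cos_add, Real.sin_add, Real.cos_neg, Real.sin_neg, hx, hy, ← gauss_neg]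
  ring_nf

/-- A half turn changes the sign of the cosine and leaves the Gaussian factor alone, so the odd part
of `κ` averages to zero. -/
lemma angleMean_evenPart {κ : ℝ → ℂ} (hκ : Continuous κ) (r : ℝ) :
    angleMean (fun θ => κ (r * Real.cos θ) * gauss (r * Real.sin θ))
      = angleMean fun θ => (κ (r * Real.cos θ) + κ (-(r * Real.cos θ))) / 2
        * gauss (r * Real.sin θ) := by
  have hp : Function.Periodic (fun θ => κ (r * Real.cos θ) * (gauss (r * Real.sin θ) : ℂ))
      (2 * π) := fun θ => by simp
  have h := angleMean_add_right hp π
  simp only [Real.cos_add_pi, Real.sin_add_pi, mul_neg, gauss_neg] at h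
  have hg : Continuous fun θ => (gauss (r * Real.sin θ) : ℂ) :=
    Complex.continuous_ofReal.comp (continuous_gauss.comp (by fun_prop))
  have hc1 : Continuous fun θ => κ (r * Real.cos θ) * (gauss (r * Real.sin θ) : ℂ) :=
    (hκ.comp (by fun_prop)).mul hg
  have hc2 : Continuous fun θ => (-1 / 2 : ℂ) *
      (κ (-(r * Real.cos θ)) * (gauss (r * Real.sin θ) : ℂ)) :=
    continuous_const.mul ((hκ.comp (by fun_prop)).mul hg)
  have hc3 : Continuous fun θ => (1 / 2 : ℂ) *
      (κ (r * Real.cos θ) * (gauss (r * Real.sin θ) : ℂ)) := continuous_const.mul hc1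
  have e : ∀ θ, (κ (r * Real.cos θ) + κ (-(r * Real.cos θ))) / 2 * (gauss (r * Real.sin θ) : ℂ)
      = (1 / 2 : ℂ) * (κ (r * Real.cos θ) * (gauss (r * Real.sin θ) : ℂ))
        - (-1 / 2 : ℂ) * (κ (-(r * Real.cos θ)) * (gauss (r * Real.sin θ) : ℂ)) := fun θ => by ring
  simp only [e]
  rw [angleMean_sub hc3 hc2, angleMean_const_mul, angleMean_const_mul, h]
  ring

/-- Colliding with a particle of the reservoir instead of a thermostat particle changes the
Fourier transform by little. -/
lemma norm_angleMean_difference_le {κ κ₁ κ₂ : ℝ → ℂ} {D G ρ : ℝ} (hD : 0 ≤ D) (hDG : D ≤ G)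
    (hρ : 0 ≤ ρ) (h1 : ∀ z, HasDerivAt κ (κ₁ z) z) (h2 : ∀ z, HasDerivAt κ₁ (κ₂ z) z)
    (hκ : ∀ z, ‖κ z‖ ≤ D * (ρ + z ^ 2))
    (hκ₂ : ∀ z, ‖κ₂ z‖ ≤ G * (4 * (ρ + z ^ 2) + 3)) (x y : ℝ) :
    ‖angleMean (fun θ => κ (x * Real.cos θ) * gauss (x * Real.sin θ)) * gauss y
      - angleMean (fun θ => κ (x * Real.cos θ + y * Real.sin θ)
        * gauss (-x * Real.sin θ + y * Real.cos θ))‖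
      ≤ 5 * G * ((1 - gauss y) * (ρ + x ^ 2) + y ^ 2) := by
  have hcκ : Continuous κ := continuous_iff_continuousAt.2 fun z => (h1 z).continuousAt
  rw [angleMean_rotate, angleMean_evenPart hcκ, angleMean_evenPart hcκ, mul_comm,
    ← angleMean_const_mul]
  -- The even part satisfies the same bounds and has zero derivative at the origin, as the radial
  -- estimate requires.
  set κe : ℝ → ℂ := fun z => (κ z + κ (-z)) / 2 with hκe
  have hce : Continuous κe := by rw [hκe]; fun_prop
  have hg : ∀ r : ℝ, Continuous fun θ => (gauss (r * Real.sin θ) : ℂ) := fun r =>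
    Complex.continuous_ofReal.comp (continuous_gauss.comp (by fun_prop))
  have hc1 : ∀ r : ℝ, Continuous fun θ => κe (r * Real.cos θ) * (gauss (r * Real.sin θ) : ℂ) :=
    fun r => (hce.comp (by fun_prop)).mul (hg r)
  have hc2 : Continuous fun θ => (gauss y : ℂ) *
      (κe (x * Real.cos θ) * (gauss (x * Real.sin θ) : ℂ)) := continuous_const.mul (hc1 x)
  change ‖angleMean (fun θ => (gauss y : ℂ) *
      (κe (x * Real.cos θ) * (gauss (x * Real.sin θ) : ℂ))) - angleMean (fun θ =>
      κe (√(x ^ 2 + y ^ 2) * Real.cos θ) * (gauss (√(x ^ 2 + y ^ 2) * Real.sin θ) : ℂ))‖ ≤ _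
  rw [← angleMean_sub hc2 (hc1 _)]
  have hneg : ∀ (f f' : ℝ → ℂ), (∀ z, HasDerivAt f (f' z) z) → ∀ z,
      HasDerivAt (fun z => f (-z)) (-f' (-z)) z := fun f f' hf z => by
    have := HasDerivAt.scomp z (hf (-z)) (hasDerivAt_neg z)
    rw [neg_smul, one_smul] at this
    exact this
  have halve : ∀ {a b : ℂ} {C : ℝ}, ‖a‖ ≤ C → ‖b‖ ≤ C → ‖(a + b) / 2‖ ≤ C := fun ha hb => by
    rw [norm_div, Complex.norm_two, div_le_iff₀ two_pos]
    linarith [norm_add_le_of_le ha hb]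
  refine norm_angleMean_le fun θ => ?_
  rw [mul_comm (gauss y : ℂ)]
  refine norm_radial_difference_le (κ := κe) (κ₁ := fun z => (κ₁ z + -κ₁ (-z)) / 2)
    (κ₂ := fun z => (κ₂ z + κ₂ (-z)) / 2) hD hDG hρ
    (fun z => ((h1 z).add (hneg _ _ h1 z)).div_const 2)
    (fun z => ?_) (by simp) (fun z => ?_) (fun z => halve (hκ z) ?_) (fun z => halve (hκ₂ z) ?_)
    (Real.cos_sq_add_sin_sq θ) x y
  · refine (((h2 z).add (hneg _ _ h2 z).neg).div_const 2).congr_deriv ?_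
    rw [neg_neg]
  · simp only [hκe, neg_neg, add_comm]
  · simpa using hκ (-z)
  · simpa using hκ₂ (-z)

/-- The probability that exactly one of several independent events fails is at most one. -/
lemma sum_one_sub_mul_prod_erase_le {α : Type*} [DecidableEq α] (s : Finset α) {p : α → ℝ}
    (h0 : ∀ i, 0 ≤ p i) (h1 : ∀ i, p i ≤ 1) :
    ∑ i ∈ s, (1 - p i) * ∏ j ∈ s.erase i, p j ≤ 1 := by
  suffices h : ∑ i ∈ s, (1 - p i) * ∏ j ∈ s.erase i, p j + ∏ j ∈ s, p j ≤ 1 by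
    have := Finset.prod_nonneg (s := s) fun i _ => h0 i
    linarith
  induction s using Finset.induction_on with
  | empty => simp
  | insert a s ha ih =>
    have e : ∀ i ∈ s, (1 - p i) * ∏ j ∈ (insert a s).erase i, p j
        = p a * ((1 - p i) * ∏ j ∈ s.erase i, p j) := fun i hi => by
      have hia : a ≠ i := fun h => ha (h ▸ hi)
      rw [Finset.erase_insert_of_ne hia, Finset.prod_insert fun h => ha (Finset.mem_of_mem_erase h)]
      ring
    rw [Finset.sum_insert ha, Finset.erase_insert ha, Finset.prod_insert ha,
      Finset.sum_congr rfl e, ← Finset.mul_sum]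
    have hs : 0 ≤ ∑ i ∈ s, (1 - p i) * ∏ j ∈ s.erase i, p j := Finset.sum_nonneg fun i _ =>
      mul_nonneg (by linarith [h1 i]) (Finset.prod_nonneg fun j _ => h0 j)
    nlinarith [h0 a, h1 a, mul_nonneg hs (by linarith [h1 a] : 0 ≤ 1 - p a)]

section

/-! ### Moments of the Maxwellian and trigonometric means -/

lemma integrable_pow_mul_gauss (k : ℕ) : Integrable fun w : ℝ => w ^ k * gauss w := by
  have h := integrable_rpow_mul_exp_neg_mul_sq (b := π) Real.pi_pos
    (s := (k : ℝ)) (by have : (0 : ℝ) ≤ k := Nat.cast_nonneg k; linarith)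
  simp only [Real.rpow_natCast] at h
  exact h

/-- Integrate the derivative of `w ^ k * gauss w` over the line. For `k = 0` the truncated exponent
`k - 1` is harmless because of the factor `k`. -/
lemma integral_pow_mul_gauss (k : ℕ) :
    2 * π * ∫ w : ℝ, w ^ (k + 1) * gauss w = k * ∫ w : ℝ, w ^ (k - 1) * gauss w := by
  have hd : ∀ w : ℝ, HasDerivAt (fun w => w ^ k * gauss w)
      (k * (w ^ (k - 1) * gauss w) - 2 * π * (w ^ (k + 1) * gauss w)) w := fun w => by
    refine ((hasDerivAt_pow k w).mul (hasDerivAt_gauss w)).congr_deriv ?_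
    ring
  have hi := ((integrable_pow_mul_gauss (k - 1)).const_mul (k : ℝ)).sub
    ((integrable_pow_mul_gauss (k + 1)).const_mul (2 * π))
  have h := integral_eq_zero_of_hasDerivAt_of_integrable hd hi (integrable_pow_mul_gauss k)
  rw [integral_sub ((integrable_pow_mul_gauss (k - 1)).const_mul (k : ℝ))
    ((integrable_pow_mul_gauss (k + 1)).const_mul (2 * π)), integral_const_mul,
    integral_const_mul] at h
  linarith

lemma integral_one_mul_gauss : ∫ w : ℝ, w ^ 1 * gauss w = 0 := by
  have h := integral_pow_mul_gauss 0
  have := Real.pi_pos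
  simp only [Nat.cast_zero, zero_mul, zero_add] at h
  exact (mul_eq_zero.1 h).resolve_left (by positivity)

lemma integral_sq_mul_gauss : ∫ w : ℝ, w ^ 2 * gauss w = (2 * π)⁻¹ := by
  have h := integral_pow_mul_gauss 1
  simp only [Nat.cast_one, one_mul, le_refl, tsub_eq_zero_of_le, pow_zero, integral_gauss] at h
  exact eq_inv_of_mul_eq_one_right h

lemma integral_cube_mul_gauss : ∫ w : ℝ, w ^ 3 * gauss w = 0 := by
  have h := integral_pow_mul_gauss 2
  have := Real.pi_pos
  simp only [Nat.add_one_sub_one, Nat.reduceAdd] at h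
  rw [integral_one_mul_gauss, mul_zero] at h
  exact (mul_eq_zero.1 h).resolve_left (by positivity)

lemma integral_fourth_mul_gauss : ∫ w : ℝ, w ^ 4 * gauss w = 3 * (2 * π)⁻¹ ^ 2 := by
  have h := integral_pow_mul_gauss 3
  have := Real.pi_pos
  simp only [Nat.add_one_sub_one, Nat.reduceAdd] at h
  rw [integral_sq_mul_gauss] at h
  push_cast at h
  field_simp at h ⊢
  linarith

lemma mean_quadratic (α β γ : ℝ) :
    (2 * π)⁻¹ * ∫ θ in (0 : ℝ)..2 * π, (α * Real.cos θ ^ 2 + β * (Real.cos θ * Real.sin θ)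
      + γ * Real.sin θ ^ 2) = (α + γ) / 2 := by
  have hd : ∀ θ : ℝ, HasDerivAt (fun θ => α * (θ / 2 + Real.sin θ * Real.cos θ / 2)
      + β * (Real.sin θ ^ 2 / 2) + γ * (θ / 2 - Real.sin θ * Real.cos θ / 2))
      (α * Real.cos θ ^ 2 + β * (Real.cos θ * Real.sin θ) + γ * Real.sin θ ^ 2) θ := fun θ => by
    have hs := Real.hasDerivAt_sin θ
    have hc := Real.hasDerivAt_cos θ
    have hi := hasDerivAt_id θ
    refine ((((hi.div_const 2).add ((hs.mul hc).div_const 2)).const_mul α).add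
      (((hs.pow 2).div_const 2).const_mul β) |>.add
      (((hi.div_const 2).sub ((hs.mul hc).div_const 2)).const_mul γ)).congr_deriv ?_
    simp only [Nat.cast_ofNat, Nat.add_one_sub_one, pow_one]
    linear_combination (-γ / 2 - α / 2) * Real.sin_sq_add_cos_sq θ
  rw [intervalIntegral.integral_eq_sub_of_hasDerivAt (fun θ _ => hd θ)
    (Continuous.intervalIntegrable (by fun_prop) _ _)]
  have := Real.pi_pos
  simp
  field_simp

lemma mean_quartic (α β γ δ ε : ℝ) :
    (2 * π)⁻¹ * ∫ θ in (0 : ℝ)..2 * π, (α * Real.cos θ ^ 4 + β * (Real.cos θ ^ 3 * Real.sin θ)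
      + γ * (Real.cos θ ^ 2 * Real.sin θ ^ 2) + δ * (Real.cos θ * Real.sin θ ^ 3)
      + ε * Real.sin θ ^ 4) = (3 * α + γ + 3 * ε) / 8 := by
  -- An explicit antiderivative: its linear parts carry the means `3/8`, `1/8`, `3/8`, and all other
  -- terms are periodic.
  have hd : ∀ θ : ℝ, HasDerivAt (fun θ =>
      α * (3 / 8 * θ + 3 / 8 * (Real.sin θ * Real.cos θ) + 1 / 4 * (Real.sin θ * Real.cos θ ^ 3))
      + β * (-1 / 4 * Real.cos θ ^ 4)
      + γ * (1 / 8 * θ - 1 / 8 * (Real.sin θ * Real.cos θ ^ 3 - Real.sin θ ^ 3 * Real.cos θ))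
      + δ * (1 / 4 * Real.sin θ ^ 4)
      + ε * (3 / 8 * θ - 3 / 8 * (Real.sin θ * Real.cos θ)
        - 1 / 4 * (Real.sin θ ^ 3 * Real.cos θ)))
      (α * Real.cos θ ^ 4 + β * (Real.cos θ ^ 3 * Real.sin θ)
      + γ * (Real.cos θ ^ 2 * Real.sin θ ^ 2) + δ * (Real.cos θ * Real.sin θ ^ 3)
      + ε * Real.sin θ ^ 4) θ := fun θ => by
    have hs := Real.hasDerivAt_sin θ
    have hc := Real.hasDerivAt_cos θ
    have hi := hasDerivAt_id θ
    refine (((((((hi.const_mul (3 / 8)).add ((hs.mul hc).const_mul (3 / 8))).add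
      ((hs.mul (hc.pow 3)).const_mul (1 / 4))).const_mul α).add
      (((hc.pow 4).const_mul (-1 / 4)).const_mul β)).add
      (((hi.const_mul (1 / 8)).sub (((hs.mul (hc.pow 3)).sub
        ((hs.pow 3).mul hc)).const_mul (1 / 8))).const_mul γ)).add
      (((hs.pow 4).const_mul (1 / 4)).const_mul δ) |>.add
      ((((hi.const_mul (3 / 8)).sub ((hs.mul hc).const_mul (3 / 8))).sub
      (((hs.pow 3).mul hc).const_mul (1 / 4))).const_mul ε)).congr_deriv ?_
    have h1 := Real.sin_sq_add_cos_sq θ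
    have h2 : Real.sin θ ^ 2 = 1 - Real.cos θ ^ 2 := by linarith
    have h4 : Real.sin θ ^ 4 = (1 - Real.cos θ ^ 2) ^ 2 := by rw [← h2]; ring
    simp only [Nat.cast_ofNat, Nat.add_one_sub_one, Pi.pow_apply]
    ring_nf
    simp only [h2, h4]
    ring
  rw [intervalIntegral.integral_eq_sub_of_hasDerivAt (fun θ _ => hd θ)
    (Continuous.intervalIntegrable (by fun_prop) _ _)]
  have := Real.pi_pos
  simp
  field_simp
  ring

lemma mean_const (c : ℝ) : (2 * π)⁻¹ * ∫ _ in (0 : ℝ)..2 * π, c = c := by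
  have := Real.pi_pos
  simp
  field_simp

/-! ### Propagation of moments -/

/-- Labels of the moments that are propagated together. -/
inductive MomentIndex (M : ℕ)
  | mass : MomentIndex M
  | sq (i : Fin M) : MomentIndex M
  | quart (i : Fin M) : MomentIndex M
  | mixed (i j : Fin M) (hij : i ≠ j) : MomentIndex M

variable {M N : ℕ}

/-- The weights of the moments; their normalization makes the Maxwellian an extremal case. -/
def momentWeight (A : ℝ) : MomentIndex M → Vel (Fin M ⊕ Fin N) → ℝ
  | .mass, _ => A
  | .sq i, x => (2 * π)⁻¹ * x (Sum.inl i) ^ 2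
  | .quart i, x => x (Sum.inl i) ^ 4 / 3
  | .mixed i j _, x => x (Sum.inl i) ^ 2 * x (Sum.inl j) ^ 2

lemma continuous_momentWeight (A : ℝ) (k : MomentIndex M) :
    Continuous (momentWeight A k : Vel (Fin M ⊕ Fin N) → ℝ) := by
  cases k <;> unfold momentWeight <;> fun_prop

lemma momentWeight_nonneg {A : ℝ} (hA : 0 ≤ A) (k : MomentIndex M) (x : Vel (Fin M ⊕ Fin N)) :
    0 ≤ momentWeight A k x := by
  have := Real.pi_pos
  cases k <;> unfold momentWeight <;> positivity

/-- The gauge of the second and fourth moments of the system. -/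
def momentGauge (M N : ℕ) (A : ℝ) : Gauge (State M N) :=
  weightGauge volume (momentWeight A) fun k => (continuous_momentWeight A k).measurable

lemma momentGauge_le_iff {A C : ℝ} {f : State M N} :
    (momentGauge M N A).Le f C ↔
      ∀ k, ∫⁻ x, ENNReal.ofReal (momentWeight A k x) * ‖f x‖ₑ ≤ ENNReal.ofReal C := Iff.rfl

/-- `V` is dominated by a convex combination of the weights. -/
def DominatedByMoments (A : ℝ) (V : Vel (Fin M ⊕ Fin N) → ℝ) : Prop :=
  ∃ (k₁ k₂ k₃ : MomentIndex M) (c₁ c₂ c₃ : ℝ), 0 ≤ c₁ ∧ 0 ≤ c₂ ∧ 0 ≤ c₃ ∧ c₁ + c₂ + c₃ = 1 ∧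
    ∀ x, V x ≤ c₁ * momentWeight A k₁ x + c₂ * momentWeight A k₂ x + c₃ * momentWeight A k₃ x

lemma DominatedByMoments.lintegral_le {A C : ℝ} (hA : 0 ≤ A)
    {V : Vel (Fin M ⊕ Fin N) → ℝ} (hV : DominatedByMoments A V) {f : State M N}
    (hf : (momentGauge M N A).Le f C) :
    ∫⁻ x, ENNReal.ofReal (V x) * ‖f x‖ₑ ≤ ENNReal.ofReal C := by
  obtain ⟨k₁, k₂, k₃, c₁, c₂, c₃, h₁, h₂, h₃, hc, hV⟩ := hV
  have hm := fun k => aemeasurable_weight_mul_enorm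
    (continuous_momentWeight (N := N) A k).measurable f
  rw [momentGauge_le_iff] at hf
  calc ∫⁻ x, ENNReal.ofReal (V x) * ‖f x‖ₑ
      ≤ ∫⁻ x, (ENNReal.ofReal c₁ * (ENNReal.ofReal (momentWeight A k₁ x) * ‖f x‖ₑ)
          + ENNReal.ofReal c₂ * (ENNReal.ofReal (momentWeight A k₂ x) * ‖f x‖ₑ))
          + ENNReal.ofReal c₃ * (ENNReal.ofReal (momentWeight A k₃ x) * ‖f x‖ₑ) := by
        refine lintegral_mono fun x => ?_
        simp only [← mul_assoc, ← add_mul, ← ENNReal.ofReal_mul, h₁, h₂, h₃]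
        have n := fun k => momentWeight_nonneg hA k x
        rw [← ENNReal.ofReal_add (mul_nonneg h₁ (n _)) (mul_nonneg h₂ (n _)),
          ← ENNReal.ofReal_add (add_nonneg (mul_nonneg h₁ (n _)) (mul_nonneg h₂ (n _)))
            (mul_nonneg h₃ (n _))]
        gcongr
        exact hV x
    _ = ENNReal.ofReal c₁ * (∫⁻ x, ENNReal.ofReal (momentWeight A k₁ x) * ‖f x‖ₑ)
          + ENNReal.ofReal c₂ * (∫⁻ x, ENNReal.ofReal (momentWeight A k₂ x) * ‖f x‖ₑ)
          + ENNReal.ofReal c₃ * (∫⁻ x, ENNReal.ofReal (momentWeight A k₃ x) * ‖f x‖ₑ) := by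
        rw [lintegral_add_right' _ ((hm k₃).const_mul _),
          lintegral_add_left' ((hm k₁).const_mul _), lintegral_const_mul'' _ (hm k₁),
          lintegral_const_mul'' _ (hm k₂), lintegral_const_mul'' _ (hm k₃)]
    _ ≤ ENNReal.ofReal c₁ * ENNReal.ofReal C + ENNReal.ofReal c₂ * ENNReal.ofReal C
          + ENNReal.ofReal c₃ * ENNReal.ofReal C := by
        gcongr
        exacts [hf _, hf _, hf _]
    _ = ENNReal.ofReal C := by
        rw [← add_mul, ← add_mul, ← ENNReal.ofReal_add h₁ h₂,
          ← ENNReal.ofReal_add (add_nonneg h₁ h₂) h₃, hc, ENNReal.ofReal_one, one_mul]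

lemma dominatedByMoments_of_eq {A : ℝ} (k : MomentIndex M) {V : Vel (Fin M ⊕ Fin N) → ℝ}
    (h : ∀ x, V x = momentWeight A k x) : DominatedByMoments A V :=
  ⟨k, k, k, 1, 0, 0, by norm_num, le_rfl, le_rfl, by norm_num, fun x => by rw [h]; simp⟩

lemma dominatedByMoments_mean {A : ℝ} (k l : MomentIndex M) {V : Vel (Fin M ⊕ Fin N) → ℝ}
    (h : ∀ x, V x ≤ (momentWeight A k x + momentWeight A l x) / 2) : DominatedByMoments A V :=
  ⟨k, l, l, 1 / 2, 1 / 2, 0, by norm_num, by norm_num, le_rfl, by norm_num,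
    fun x => (h x).trans (le_of_eq (by ring))⟩

lemma momentWeight_mixed_comm (A : ℝ) {i j : Fin M} (hij : i ≠ j) (x : Vel (Fin M ⊕ Fin N)) :
    momentWeight A (.mixed i j hij) x = momentWeight A (.mixed j i hij.symm) x :=
  mul_comm _ _

/-! ### Moments under collisions inside the system -/

section SystemCollision

variable {a b : Fin M}

lemma collide_neg_left (hab : a ≠ b) (θ : ℝ) (x : Vel (Fin M ⊕ Fin N)) :
    collide (Sum.inl a) (Sum.inl b) (-θ) x (Sum.inl a)
      = x (Sum.inl a) * Real.cos θ - x (Sum.inl b) * Real.sin θ := by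
  simp [collide, hab, sub_eq_add_neg]

lemma collide_neg_right (θ : ℝ) (x : Vel (Fin M ⊕ Fin N)) :
    collide (Sum.inl a) (Sum.inl b) (-θ) x (Sum.inl b)
      = x (Sum.inl a) * Real.sin θ + x (Sum.inl b) * Real.cos θ := by
  simp [collide]

lemma collide_neg_other {k : Fin M} (ha : k ≠ a) (hb : k ≠ b) (θ : ℝ)
    (x : Vel (Fin M ⊕ Fin N)) :
    collide (Sum.inl a) (Sum.inl b) (-θ) x (Sum.inl k) = x (Sum.inl k) := by
  simp [collide, ha, hb]


end SystemCollision

end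

section

variable {M N : ℕ}

/-- Averaging a weight over the rotations in the plane of `a` and `b` gives a convex combination of
weights. The factor `1 / 3` in the quartic weights is what makes both `quart` and `mixed a b`
average to `3/8`, `3/8`, `1/4`; a mixed weight with one partner outside averages to the mean of two
mixed weights. -/
lemma dominatedByMoments_collide {a b : Fin M} (hab : a ≠ b) (A : ℝ) (k : MomentIndex M) :
    DominatedByMoments A fun x : Vel (Fin M ⊕ Fin N) => (2 * π)⁻¹ * ∫ θ in (0 : ℝ)..2 * π,
      momentWeight A k (collide (Sum.inl a) (Sum.inl b) (-θ) x) := by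
  have hmixed : ∀ x : Vel (Fin M ⊕ Fin N), (2 * π)⁻¹ * ∫ θ in (0 : ℝ)..2 * π,
      (collide (Sum.inl a) (Sum.inl b) (-θ) x (Sum.inl a)) ^ 2 *
      (collide (Sum.inl a) (Sum.inl b) (-θ) x (Sum.inl b)) ^ 2
      = 3 / 8 * momentWeight A (.quart a) x + 3 / 8 * momentWeight A (.quart b) x
        + 1 / 4 * momentWeight A (.mixed a b hab) x := fun x => by
    simp only [collide_neg_left hab, collide_neg_right, momentWeight]
    set p := x (Sum.inl a)
    set q := x (Sum.inl b)
    refine Eq.trans ?_ ((mean_quartic (p ^ 2 * q ^ 2) (2 * p ^ 3 * q - 2 * p * q ^ 3)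
      (p ^ 4 + q ^ 4 - 4 * p ^ 2 * q ^ 2) (2 * p * q ^ 3 - 2 * p ^ 3 * q) (p ^ 2 * q ^ 2)).trans
      (by ring))
    congr 2
    ext θ
    ring
  -- The factor `r` is `(2 * π)⁻¹` for the quadratic weights and the square of a spectator's
  -- velocity for the mixed ones.
  have hsq : ∀ (r : ℝ) (k : Fin M), k = a ∨ k = b → ∀ x : Vel (Fin M ⊕ Fin N),
      (2 * π)⁻¹ * ∫ θ in (0 : ℝ)..2 * π,
        r * (collide (Sum.inl a) (Sum.inl b) (-θ) x (Sum.inl k)) ^ 2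
      = (r * x (Sum.inl a) ^ 2 + r * x (Sum.inl b) ^ 2) / 2 := fun r k hk x => by
    rcases hk with rfl | rfl
    · simp only [collide_neg_left hab]
      set p := x (Sum.inl k)
      set q := x (Sum.inl b)
      refine Eq.trans ?_ (mean_quadratic (r * p ^ 2) (-2 * r * p * q) (r * q ^ 2))
      congr 2
      ext θ
      ring
    · simp only [collide_neg_right]
      set p := x (Sum.inl a)
      set q := x (Sum.inl k)
      refine Eq.trans ?_ ((mean_quadratic (r * q ^ 2) (2 * r * p * q) (r * p ^ 2)).trans
        (by ring))
      congr 2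
      ext θ
      ring
  have hquart : ∀ k : Fin M, k = a ∨ k = b → ∀ x : Vel (Fin M ⊕ Fin N),
      (2 * π)⁻¹ * ∫ θ in (0 : ℝ)..2 * π,
        (collide (Sum.inl a) (Sum.inl b) (-θ) x (Sum.inl k)) ^ 4 / 3
      = 3 / 8 * momentWeight A (.quart a) x + 3 / 8 * momentWeight A (.quart b) x
        + 1 / 4 * momentWeight A (.mixed a b hab) x := fun k hk x => by
    rcases hk with rfl | rfl
    · simp only [collide_neg_left hab, momentWeight]
      set p := x (Sum.inl k)
      set q := x (Sum.inl b)
      refine Eq.trans ?_ ((mean_quartic (p ^ 4 / 3) (-4 / 3 * p ^ 3 * q) (2 * p ^ 2 * q ^ 2)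
        (-4 / 3 * p * q ^ 3) (q ^ 4 / 3)).trans (by ring))
      congr 2
      ext θ
      ring
    · simp only [collide_neg_right, momentWeight]
      set p := x (Sum.inl a)
      set q := x (Sum.inl k)
      refine Eq.trans ?_ ((mean_quartic (q ^ 4 / 3) (4 / 3 * p * q ^ 3) (2 * p ^ 2 * q ^ 2)
        (4 / 3 * p ^ 3 * q) (p ^ 4 / 3)).trans (by ring))
      congr 2
      ext θ
      ring
  -- a mixed moment of two particles, the first of which takes part in the collision
  have hhalf : ∀ (k l : Fin M) (hkl : k ≠ l), k = a ∨ k = b → l ≠ a → l ≠ b →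
      DominatedByMoments A fun x : Vel (Fin M ⊕ Fin N) => (2 * π)⁻¹ * ∫ θ in (0 : ℝ)..2 * π,
        momentWeight A (.mixed k l hkl) (collide (Sum.inl a) (Sum.inl b) (-θ) x) := by
    intro k l hkl hk hla hlb
    refine dominatedByMoments_mean (.mixed a l hla.symm) (.mixed b l hlb.symm) fun x => ?_
    simp only [momentWeight, collide_neg_other hla hlb]
    simp only [mul_comm _ (x (Sum.inl l) ^ 2)]
    exact (hsq _ k hk x).le
  cases k with
  | mass => exact dominatedByMoments_of_eq .mass fun x => mean_const A
  | sq k =>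
    by_cases hk : k = a ∨ k = b
    · exact dominatedByMoments_mean (.sq a) (.sq b) fun x => (hsq _ k hk x).le
    · push Not at hk
      refine dominatedByMoments_of_eq (.sq k) fun x => ?_
      simp only [momentWeight, collide_neg_other hk.1 hk.2, mean_const]
  | quart k =>
    by_cases hk : k = a ∨ k = b
    · exact ⟨.quart a, .quart b, .mixed a b hab, 3 / 8, 3 / 8, 1 / 4, by norm_num, by norm_num,
        by norm_num, by norm_num, fun x => (hquart k hk x).le⟩
    · push Not at hk
      refine dominatedByMoments_of_eq (.quart k) fun x => ?_
      simp only [momentWeight, collide_neg_other hk.1 hk.2, mean_const]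
  | mixed k l hkl =>
    have hboth : DominatedByMoments A fun x : Vel (Fin M ⊕ Fin N) =>
        (2 * π)⁻¹ * ∫ θ in (0 : ℝ)..2 * π,
        momentWeight A (.mixed a b hab) (collide (Sum.inl a) (Sum.inl b) (-θ) x) :=
      ⟨.quart a, .quart b, .mixed a b hab, 3 / 8, 3 / 8, 1 / 4, by norm_num, by norm_num,
        by norm_num, by norm_num, fun x => (hmixed x).le⟩
    by_cases hk : k = a ∨ k = b
    · by_cases hl : l = a ∨ l = b
      · rcases hk with rfl | rfl <;> rcases hl with rfl | rfl
        · exact absurd rfl hkl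
        · exact hboth
        · simp only [momentWeight_mixed_comm A hkl]
          exact hboth
        · exact absurd rfl hkl
      · push Not at hl
        exact hhalf k l hkl hk hl.1 hl.2
    · push Not at hk
      by_cases hl : l = a ∨ l = b
      · simp only [momentWeight_mixed_comm A hkl]
        exact hhalf l k hkl.symm hl hk.1 hk.2
      · push Not at hl
        refine dominatedByMoments_of_eq (.mixed k l hkl) fun x => ?_
        simp only [momentWeight, collide_neg_other hk.1 hk.2, collide_neg_other hl.1 hl.2,
          mean_const]

lemma opLe_momentGauge_collisionOp {a b : Fin M} (hab : a ≠ b) {A : ℝ} (hA : 0 ≤ A) :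
    (momentGauge M N A).OpLe
      (collisionOp (Sum.inl a) (Sum.inl b) (Sum.inl_injective.ne hab)) 1 := fun f C _ hf => by
  rw [one_mul, momentGauge_le_iff]
  intro k
  exact (lintegral_mul_collisionOp_le _ f (continuous_momentWeight A k)
    (momentWeight_nonneg hA k) fun x => le_rfl).trans
    ((dominatedByMoments_collide hab A k).lintegral_le hA hf)

/-! ### Moments under thermostat collisions -/

section Bath

variable {a : Fin M}

lemma collideBath_neg_self (θ w : ℝ) (x : Vel (Fin M ⊕ Fin N)) :
    collideBath (Sum.inl a) (-θ) w x (Sum.inl a) = x (Sum.inl a) * Real.cos θ - w * Real.sin θ := by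
  simp [collideBath, sub_eq_add_neg]

lemma collideBath_neg_other {k : Fin M} (ha : k ≠ a) (θ w : ℝ) (x : Vel (Fin M ⊕ Fin N)) :
    collideBath (Sum.inl a) (-θ) w x (Sum.inl k) = x (Sum.inl k) := by
  simp [collideBath, ha]

/-- The mean over the thermostat velocity of a polynomial of degree at most four. -/
lemma integral_polynomial_mul_gauss (c₀ c₁ c₂ c₃ c₄ : ℝ) :
    Integrable (fun w => (c₀ + c₁ * w + c₂ * w ^ 2 + c₃ * w ^ 3 + c₄ * w ^ 4) * gauss w) ∧
    ∫ w, (c₀ + c₁ * w + c₂ * w ^ 2 + c₃ * w ^ 3 + c₄ * w ^ 4) * gauss w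
      = c₀ + c₂ * (2 * π)⁻¹ + c₄ * (3 * (2 * π)⁻¹ ^ 2) := by
  have i := fun (k : ℕ) (c : ℝ) => (integrable_pow_mul_gauss k).const_mul c
  have j1 : Integrable fun w => c₀ * (w ^ 0 * gauss w) + c₁ * (w ^ 1 * gauss w) :=
    (i 0 c₀).add (i 1 c₁)
  have j2 : Integrable fun w => c₀ * (w ^ 0 * gauss w) + c₁ * (w ^ 1 * gauss w)
      + c₂ * (w ^ 2 * gauss w) := j1.add (i 2 c₂)
  have j3 : Integrable fun w => c₀ * (w ^ 0 * gauss w) + c₁ * (w ^ 1 * gauss w)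
      + c₂ * (w ^ 2 * gauss w) + c₃ * (w ^ 3 * gauss w) := j2.add (i 3 c₃)
  have j4 : Integrable fun w => c₀ * (w ^ 0 * gauss w) + c₁ * (w ^ 1 * gauss w)
      + c₂ * (w ^ 2 * gauss w) + c₃ * (w ^ 3 * gauss w) + c₄ * (w ^ 4 * gauss w) := j3.add (i 4 c₄)
  have e : (fun w => (c₀ + c₁ * w + c₂ * w ^ 2 + c₃ * w ^ 3 + c₄ * w ^ 4) * gauss w)
      = fun w => c₀ * (w ^ 0 * gauss w) + c₁ * (w ^ 1 * gauss w)
      + c₂ * (w ^ 2 * gauss w) + c₃ * (w ^ 3 * gauss w) + c₄ * (w ^ 4 * gauss w) := by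
    ext w
    ring
  rw [e]
  refine ⟨j4, ?_⟩
  rw [integral_add j3 (i 4 c₄), integral_add j2 (i 3 c₃), integral_add j1 (i 2 c₂),
    integral_add (i 0 c₀) (i 1 c₁)]
  simp only [integral_const_mul, integral_one_mul_gauss, integral_sq_mul_gauss,
    integral_cube_mul_gauss, integral_fourth_mul_gauss, pow_zero, one_mul, integral_gauss]
  ring

/-- Moments after a thermostat collision, for weights polynomial in the thermostat velocity. -/
lemma lintegral_mul_thermostatOp_le_of_polynomial {A C : ℝ} (hA : 0 ≤ A)
    {f : State M N} (hf : (momentGauge M N A).Le f C) (k : MomentIndex M)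
    (c : Fin 5 → ℝ → Vel (Fin M ⊕ Fin N) → ℝ) (hc : ∀ n x, Continuous fun θ => c n θ x)
    (hW : ∀ θ w x, momentWeight A k (collideBath (Sum.inl a) (-θ) w x)
      = c 0 θ x + c 1 θ x * w + c 2 θ x * w ^ 2 + c 3 θ x * w ^ 3 + c 4 θ x * w ^ 4)
    (hV : DominatedByMoments A fun x => (2 * π)⁻¹ * ∫ θ in (0 : ℝ)..2 * π,
      (c 0 θ x + c 2 θ x * (2 * π)⁻¹ + c 4 θ x * (3 * (2 * π)⁻¹ ^ 2))) :
    ∫⁻ x, ENNReal.ofReal (momentWeight A k x) * ‖thermostatOp (Sum.inl a) f x‖ₑ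
      ≤ ENNReal.ofReal C := by
  refine (lintegral_mul_thermostatOp_le (Sum.inl a) f (continuous_momentWeight A k)
    (momentWeight_nonneg hA k)
    (U := fun θ x => c 0 θ x + c 2 θ x * (2 * π)⁻¹ + c 4 θ x * (3 * (2 * π)⁻¹ ^ 2))
    (fun θ x => ?_) (fun θ x => ?_) (fun x => ?_) fun x => le_rfl).trans
    (hV.lintegral_le hA hf)
  · simp only [hW]
    exact (integral_polynomial_mul_gauss _ _ _ _ _).1
  · simp only [hW]
    exact (integral_polynomial_mul_gauss _ _ _ _ _).2
  · exact ((hc 0 x).add ((hc 2 x).mul continuous_const)).add ((hc 4 x).mul continuous_const)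

lemma lintegral_mul_thermostatOp_le_of_invariant {A C : ℝ} (hA : 0 ≤ A)
    {f : State M N} (hf : (momentGauge M N A).Le f C) (k : MomentIndex M)
    (hW : ∀ θ w (x : Vel (Fin M ⊕ Fin N)), momentWeight A k (collideBath (Sum.inl a) (-θ) w x)
      = momentWeight A k x) :
    ∫⁻ x, ENNReal.ofReal (momentWeight A k x) * ‖thermostatOp (Sum.inl a) f x‖ₑ
      ≤ ENNReal.ofReal C := by
  refine lintegral_mul_thermostatOp_le_of_polynomial hA hf k
    (fun n _ x => ![momentWeight A k x, 0, 0, 0, 0] n) (fun n x => continuous_const)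
    (fun θ w x => by simp [hW]) (dominatedByMoments_of_eq k fun x => ?_)
  simp only [Matrix.cons_val_zero, Matrix.cons_val, zero_mul, add_zero]
  exact mean_const _

/-- On average half of `x_a²` is replaced by half of the thermostat's second moment `(2 * π)⁻¹`. The
result is half the mixed weight plus half the quadratic weight of `l`, which explains the
normalization of the latter. -/
lemma lintegral_mixed_mul_thermostatOp_le {A C : ℝ} (hA : 0 ≤ A)
    {f : State M N} (hf : (momentGauge M N A).Le f C) {l : Fin M} (hal : a ≠ l) :
    ∫⁻ x, ENNReal.ofReal (momentWeight A (.mixed a l hal) x) * ‖thermostatOp (Sum.inl a) f x‖ₑ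
      ≤ ENNReal.ofReal C := by
  refine lintegral_mul_thermostatOp_le_of_polynomial hA hf _
    (fun n θ x => ![x (Sum.inl l) ^ 2 * (x (Sum.inl a) * Real.cos θ) ^ 2,
      x (Sum.inl l) ^ 2 * (-2 * (x (Sum.inl a) * Real.cos θ) * Real.sin θ),
      x (Sum.inl l) ^ 2 * Real.sin θ ^ 2, 0, 0] n)
    (fun n x => by fin_cases n <;> simp <;> fun_prop)
    (fun θ w x => ?_) (dominatedByMoments_mean (.mixed a l hal) (.sq l) fun x => ?_)
  · simp only [momentWeight, collideBath_neg_self, collideBath_neg_other hal.symm,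
      Matrix.cons_val_zero, Matrix.cons_val_one, Matrix.cons_val]
    ring
  · simp only [momentWeight, Matrix.cons_val_zero, Matrix.cons_val]
    set p := x (Sum.inl a)
    set q := x (Sum.inl l)
    refine le_of_eq (Eq.trans ?_ ((mean_quadratic (q ^ 2 * p ^ 2) 0 (q ^ 2 * (2 * π)⁻¹)).trans
      (by ring)))
    congr 2
    ext θ
    ring

/-- The quadratic weight becomes half itself plus half of `(2 * π)⁻¹ ^ 2`; the quartic one becomes
`3/8` itself, `1/4` quadratic and `3/8` of `(2 * π)⁻¹ ^ 2`. The constant is absorbed by the mass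
weight `A`. -/
lemma opLe_momentGauge_thermostatOp {A : ℝ} (hA : 0 ≤ A) (hA' : (2 * π)⁻¹ ^ 2 ≤ A) :
    (momentGauge M N A).OpLe (thermostatOp (Sum.inl a)) 1 := fun f C _ hf => by
  rw [one_mul, momentGauge_le_iff]
  intro k
  cases k with
  | mass => exact lintegral_mul_thermostatOp_le_of_invariant hA hf _ fun _ _ _ => rfl
  | sq k =>
    by_cases hk : k = a
    · subst hk
      refine lintegral_mul_thermostatOp_le_of_polynomial hA hf _
        (fun n θ x => ![(2 * π)⁻¹ * (x (Sum.inl k) * Real.cos θ) ^ 2,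
          (2 * π)⁻¹ * (-2 * (x (Sum.inl k) * Real.cos θ) * Real.sin θ),
          (2 * π)⁻¹ * Real.sin θ ^ 2, 0, 0] n)
        (fun n x => by fin_cases n <;> simp <;> fun_prop)
        (fun θ w x => ?_) (dominatedByMoments_mean (.sq k) .mass fun x => ?_)
      · simp only [momentWeight, collideBath_neg_self, Matrix.cons_val_zero, Matrix.cons_val_one,
          Matrix.cons_val]
        ring
      · simp only [momentWeight, Matrix.cons_val_zero, Matrix.cons_val]
        set p := x (Sum.inl k)
        have h : (2 * π)⁻¹ * ∫ θ in (0 : ℝ)..2 * π, ((2 * π)⁻¹ * (p * Real.cos θ) ^ 2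
            + (2 * π)⁻¹ * Real.sin θ ^ 2 * (2 * π)⁻¹ + 0 * (3 * (2 * π)⁻¹ ^ 2))
            = ((2 * π)⁻¹ * p ^ 2 + (2 * π)⁻¹ ^ 2) / 2 := by
          refine Eq.trans ?_ (mean_quadratic ((2 * π)⁻¹ * p ^ 2) 0 ((2 * π)⁻¹ ^ 2))
          congr 2
          ext θ
          ring
        rw [h]
        linarith
    · exact lintegral_mul_thermostatOp_le_of_invariant hA hf _ fun θ w x => by
        simp only [momentWeight, collideBath_neg_other hk]
  | quart k =>
    by_cases hk : k = a
    · subst hk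
      refine lintegral_mul_thermostatOp_le_of_polynomial hA hf _
        (fun n θ x => ![(x (Sum.inl k) * Real.cos θ) ^ 4 / 3,
          -4 / 3 * (x (Sum.inl k) * Real.cos θ) ^ 3 * Real.sin θ,
          2 * (x (Sum.inl k) * Real.cos θ) ^ 2 * Real.sin θ ^ 2,
          -4 / 3 * (x (Sum.inl k) * Real.cos θ) * Real.sin θ ^ 3,
          Real.sin θ ^ 4 / 3] n)
        (fun n x => by fin_cases n <;> simp <;> fun_prop)
        (fun θ w x => ?_) ⟨.quart k, .sq k, .mass, 3 / 8, 1 / 4, 3 / 8, by norm_num, by norm_num,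
          by norm_num, by norm_num, fun x => ?_⟩
      · simp only [momentWeight, collideBath_neg_self, Matrix.cons_val_zero, Matrix.cons_val_one,
          Matrix.cons_val]
        ring
      · simp only [momentWeight, Matrix.cons_val_zero, Matrix.cons_val]
        set p := x (Sum.inl k)
        have h : (2 * π)⁻¹ * ∫ θ in (0 : ℝ)..2 * π, ((p * Real.cos θ) ^ 4 / 3
            + 2 * (p * Real.cos θ) ^ 2 * Real.sin θ ^ 2 * (2 * π)⁻¹
            + Real.sin θ ^ 4 / 3 * (3 * (2 * π)⁻¹ ^ 2))
            = 3 / 8 * (p ^ 4 / 3) + 1 / 4 * ((2 * π)⁻¹ * p ^ 2) + 3 / 8 * (2 * π)⁻¹ ^ 2 := by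
          refine Eq.trans ?_ ((mean_quartic (p ^ 4 / 3) 0 (2 * p ^ 2 * (2 * π)⁻¹) 0
            ((2 * π)⁻¹ ^ 2)).trans (by ring))
          congr 2
          ext θ
          ring
        rw [h]
        linarith
    · exact lintegral_mul_thermostatOp_le_of_invariant hA hf _ fun θ w x => by
        simp only [momentWeight, collideBath_neg_other hk]
  | mixed k l hkl =>
    by_cases hk : k = a
    · subst hk
      exact lintegral_mixed_mul_thermostatOp_le hA hf hkl
    · by_cases hl : l = a
      · subst hl
        simp only [momentWeight_mixed_comm A hkl]
        exact lintegral_mixed_mul_thermostatOp_le hA hf hkl.symm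
      · exact lintegral_mul_thermostatOp_le_of_invariant hA hf _ fun θ w x => by
          simp only [momentWeight, collideBath_neg_other hk, collideBath_neg_other hl]

end Bath

lemma momentGauge_thermostatEvolution_le (hM : 0 < M) {lamS mu t A C : ℝ} (hlamS : 0 ≤ lamS)
    (hmu : 0 ≤ mu) (ht : 0 ≤ t) (hA : 0 ≤ A) (hA' : (2 * π)⁻¹ ^ 2 ≤ A) (hC : 0 ≤ C)
    {f : State M N} (hf : (momentGauge M N A).Le f C) :
    (momentGauge M N A).Le (thermostatEvolution lamS mu t f) C := by
  have hB : (momentGauge M N A).OpLe (∑ i : Fin M, thermostatOp (Sum.inl i))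
      (Finset.univ : Finset (Fin M)).card :=
    Gauge.OpLe.sum _ fun i _ => opLe_momentGauge_thermostatOp hA hA'
  have h := (momentGauge M N A).thermostatEvolution_le hM hlamS hmu ht (Nat.cast_nonneg _) hC
    (fun i j hij => opLe_momentGauge_collisionOp hij hA) hB hf
  simpa using h

end

/-! ### Moments of the initial state -/

section

variable {M N : ℕ}

lemma lintegral_weight_mul_initialState {l : Vel (Fin M) → ℝ} (hl : Integrable l)
    (hl0 : 0 ≤ᵐ[volume] l) {w : Vel (Fin M) → ℝ} (hw : Continuous w) (hw0 : ∀ v, 0 ≤ w v)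
    (hwl : Integrable fun v => w v * l v) :
    ∫⁻ x : Vel (Fin M ⊕ Fin N), ENNReal.ofReal (w (sysPart x)) * ‖initialState N hl x‖ₑ
      = ENNReal.ofReal (∫ v, w v * l v) := by
  have hmp := measurePreserving_split M N
  have hm1 : AEMeasurable (fun v => ENNReal.ofReal (w v) * ‖l v‖ₑ) volume :=
    hw.measurable.ennreal_ofReal.aemeasurable.mul hl.1.enorm
  have hm2 : AEMeasurable (fun v : Vel (Fin N) => ENNReal.ofReal (maxwellian v)) volume :=
    continuous_maxwellian.measurable.ennreal_ofReal.aemeasurable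
  have hm : AEMeasurable (fun p : Vel (Fin M) × Vel (Fin N) =>
      (ENNReal.ofReal (w p.1) * ‖l p.1‖ₑ) * ENNReal.ofReal (maxwellian p.2)) volume :=
    (hm1.comp_quasiMeasurePreserving Measure.quasiMeasurePreserving_fst).mul
      (hm2.comp_quasiMeasurePreserving Measure.quasiMeasurePreserving_snd)
  have h1 : ∫⁻ x : Vel (Fin M ⊕ Fin N), ENNReal.ofReal (w (sysPart x)) * ‖initialState N hl x‖ₑ
      = ∫⁻ p : Vel (Fin M) × Vel (Fin N),
        (ENNReal.ofReal (w p.1) * ‖l p.1‖ₑ) * ENNReal.ofReal (maxwellian p.2) := by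
    rw [← hmp.map_eq, lintegral_map' (by rw [hmp.map_eq]; exact hm) hmp.aemeasurable]
    refine lintegral_congr_ae ?_
    filter_upwards [(integrable_initial (N := N) hl).coeFn_toL1] with x hx
    rw [initialState, hx, enorm_mul, Real.enorm_of_nonneg (maxwellian_nonneg _), mul_assoc]
  have h2 : ∫⁻ v : Vel (Fin N), ENNReal.ofReal (maxwellian v) = 1 := by
    rw [← ofReal_integral_eq_lintegral_ofReal integrable_maxwellian
      (Filter.Eventually.of_forall maxwellian_nonneg), integral_maxwellian, ENNReal.ofReal_one]
  rw [h1]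
  refine (lintegral_prod_mul hm1 hm2).trans ?_
  rw [h2, mul_one, ofReal_integral_eq_lintegral_ofReal hwl]
  · refine lintegral_congr_ae ?_
    filter_upwards [hl0] with v hv
    rw [Real.enorm_of_nonneg hv, ENNReal.ofReal_mul (hw0 v)]
  · filter_upwards [hl0] with v hv
    exact mul_nonneg (hw0 v) hv

/-- `E₄ + 1 / 2` is both mass weight and bound. Quadratic moments are at most `(E₄ + 1) / 2` by `2
v² ≤ v⁴ + 1`, and mixed ones at most `E₄` by the arithmetic-geometric mean inequality. -/
lemma momentGauge_initialState {l : Vel (Fin M) → ℝ} (hl : Integrable l)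
    (hl0 : 0 ≤ᵐ[volume] l) (hl1 : ∫ v, l v = 1) {E₄ : ℝ} (hE : 0 ≤ E₄)
    (h2 : ∀ i, Integrable fun v => v i ^ 2 * l v) (h4 : ∀ i, Integrable fun v => v i ^ 4 * l v)
    (hE4 : ∀ i, ∫ v, v i ^ 4 * l v = E₄) :
    (momentGauge M N (E₄ + 1 / 2)).Le (initialState N hl) (E₄ + 1 / 2) := by
  rw [momentGauge_le_iff]
  have hπ := Real.pi_gt_three
  intro k
  cases k with
  | mass =>
    refine (lintegral_weight_mul_initialState hl hl0 (w := fun _ => E₄ + 1 / 2) continuous_const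
      (fun _ => by positivity) (hl.const_mul _)).le.trans (le_of_eq ?_)
    rw [integral_const_mul, hl1, mul_one]
  | sq i =>
    have hi : Integrable fun v : Vel (Fin M) => (2 * π)⁻¹ * v i ^ 2 * l v := by
      simpa only [mul_assoc] using (h2 i).const_mul (2 * π)⁻¹
    refine (lintegral_weight_mul_initialState hl hl0 (w := fun v => (2 * π)⁻¹ * v i ^ 2)
      (by fun_prop) (fun _ => by positivity) hi).le.trans (ENNReal.ofReal_le_ofReal ?_)
    have hle : ∫ v : Vel (Fin M), (2 * π)⁻¹ * v i ^ 2 * l v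
        ≤ ∫ v : Vel (Fin M), (1 / 2 * (v i ^ 4 * l v) + 1 / 2 * l v) := by
      refine integral_mono_ae hi (((h4 i).const_mul _).add (hl.const_mul _)) ?_
      filter_upwards [hl0] with v hv
      have hv : 0 ≤ l v := hv
      have hp : (2 * π)⁻¹ ≤ 1 := inv_le_one_of_one_le₀ (by linarith)
      have e1 : (2 * π)⁻¹ * v i ^ 2 ≤ 1 / 2 * v i ^ 4 + 1 / 2 := by
        nlinarith [sq_nonneg (v i ^ 2 - 1), sq_nonneg (v i)]
      have := mul_le_mul_of_nonneg_right e1 hv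
      linarith
    rw [integral_add ((h4 i).const_mul _) (hl.const_mul _), integral_const_mul,
      integral_const_mul, hE4, hl1] at hle
    linarith
  | quart i =>
    have hi : Integrable fun v : Vel (Fin M) => v i ^ 4 / 3 * l v := by
      have := (h4 i).const_mul (1 / 3)
      refine this.congr (Filter.Eventually.of_forall fun v => ?_)
      simp only
      ring
    refine (lintegral_weight_mul_initialState hl hl0 (w := fun v => v i ^ 4 / 3)
      (by fun_prop) (fun _ => by positivity) hi).le.trans (ENNReal.ofReal_le_ofReal ?_)
    have he : ∫ v : Vel (Fin M), v i ^ 4 / 3 * l v = 1 / 3 * E₄ := by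
      rw [← hE4 i, ← integral_const_mul]
      congr 1
      ext v
      ring
    rw [he]
    linarith
  | mixed i j hij =>
    have hle' : ∀ᵐ v : Vel (Fin M), v i ^ 2 * v j ^ 2 * l v
        ≤ 1 / 2 * (v i ^ 4 * l v) + 1 / 2 * (v j ^ 4 * l v) := by
      filter_upwards [hl0] with v hv
      have hv : 0 ≤ l v := hv
      have e1 : v i ^ 2 * v j ^ 2 ≤ 1 / 2 * v i ^ 4 + 1 / 2 * v j ^ 4 := by
        nlinarith [sq_nonneg (v i ^ 2 - v j ^ 2)]
      have := mul_le_mul_of_nonneg_right e1 hv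
      linarith
    have hs : Integrable fun v : Vel (Fin M) =>
        1 / 2 * (v i ^ 4 * l v) + 1 / 2 * (v j ^ 4 * l v) :=
      ((h4 i).const_mul _).add ((h4 j).const_mul _)
    have hi : Integrable fun v : Vel (Fin M) => v i ^ 2 * v j ^ 2 * l v := by
      refine hs.mono' ((by fun_prop : Continuous fun v : Vel (Fin M) =>
        v i ^ 2 * v j ^ 2).aestronglyMeasurable.mul hl.1) ?_
      filter_upwards [hl0, hle'] with v hv hv'
      rwa [Real.norm_of_nonneg (mul_nonneg (by positivity) hv)]
    refine (lintegral_weight_mul_initialState hl hl0 (w := fun v => v i ^ 2 * v j ^ 2)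
      (by fun_prop) (fun _ => by positivity) hi).le.trans (ENNReal.ofReal_le_ofReal ?_)
    have hle := integral_mono_ae hi hs hle'
    rw [integral_add ((h4 i).const_mul _) ((h4 j).const_mul _), integral_const_mul,
      integral_const_mul, hE4, hE4] at hle
    linarith

lemma integrable_and_integral_le_of_lintegral_le {X : Type*} [MeasurableSpace X] {μ : Measure X}
    {W : X → ℝ} (hW : Measurable W) (hW0 : ∀ x, 0 ≤ W x) {f : X →₁[μ] ℝ} {C : ℝ} (hC : 0 ≤ C)
    (h : ∫⁻ x, ENNReal.ofReal (W x) * ‖f x‖ₑ ∂μ ≤ ENNReal.ofReal C) :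
    Integrable (fun x => W x * ‖f x‖) μ ∧ ∫ x, W x * ‖f x‖ ∂μ ≤ C := by
  have hm : AEStronglyMeasurable (fun x => W x * ‖f x‖) μ :=
    hW.aestronglyMeasurable.mul (Lp.aestronglyMeasurable f).norm
  have he : ∀ x, ENNReal.ofReal (W x * ‖f x‖) = ENNReal.ofReal (W x) * ‖f x‖ₑ := fun x => by
    rw [ENNReal.ofReal_mul (hW0 x), ofReal_norm]
  have h0 : ∀ x, 0 ≤ W x * ‖f x‖ := fun x => mul_nonneg (hW0 x) (norm_nonneg _)
  refine ⟨⟨hm, ?_⟩, ?_⟩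
  · rw [hasFiniteIntegral_iff_ofReal (Filter.Eventually.of_forall h0)]
    simp only [he]
    exact h.trans_lt ENNReal.ofReal_lt_top
  · rw [integral_eq_lintegral_of_nonneg_ae (Filter.Eventually.of_forall h0) hm]
    simp only [he]
    exact ENNReal.toReal_le_of_le_ofReal hC h

lemma norm_fourierAt_le {ι : Type*} [Fintype ι] (ζ : Vel ι) (f : Vel ι →₁[volume] ℝ) :
    ‖fourierAt ζ f‖ ≤ ∫ x, ‖f x‖ := by
  rw [fourierAt_apply]
  refine (norm_integral_le_integral_norm _).trans (le_of_eq ?_)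
  congr 1
  ext x
  simp [norm_planeWave]

/-! ### The deviation as a function of a single frequency -/

/-- The vector with the entry `a` replaced by `z`. -/
def withEntry {ι : Type*} [DecidableEq ι] (a : ι) (z : ℝ) (ζ : Vel ι) : Vel ι :=
  WithLp.toLp 2 (Function.update (fun i => ζ i) a z)

section Entry

variable {ι : Type*} [Fintype ι] [DecidableEq ι]

lemma inner_withEntry (a : ι) (z : ℝ) (x ζ : Vel ι) :
    inner ℝ x (withEntry a z ζ) = z * x a + inner ℝ x (withEntry a 0 ζ) := by
  have hs : ∀ v : Vel ι, inner ℝ x v = x a * v a +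
      ∑ i ∈ Finset.univ.erase a, x i * v i := fun v => by
    rw [PiLp.inner_apply, ← Finset.add_sum_erase _ _ (Finset.mem_univ a)]
    simp [mul_comm]
  rw [hs, hs]
  have h : ∑ i ∈ Finset.univ.erase a, x i * withEntry a z ζ i
      = ∑ i ∈ Finset.univ.erase a, x i * withEntry a 0 ζ i :=
    Finset.sum_congr rfl fun i hi => by
      simp [withEntry, Finset.ne_of_mem_erase hi]
  rw [h]
  simp [withEntry]
  ring

lemma norm_sq_withEntry (a : ι) (z : ℝ) (ζ : Vel ι) :
    ‖withEntry a z ζ‖ ^ 2 = ‖ζ‖ ^ 2 - ζ a ^ 2 + z ^ 2 := by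
  simp only [EuclideanSpace.norm_sq_eq, Real.norm_eq_abs, sq_abs]
  exact sum_sq_update

lemma maxwellian_withEntry (a : ι) (z : ℝ) (ζ : Vel ι) :
    maxwellian (withEntry a z ζ) = maxwellian (withEntry a 0 ζ) * gauss z := by
  rw [maxwellian_eq, maxwellian_eq, gauss, ← Real.exp_add, norm_sq_withEntry, norm_sq_withEntry]
  ring_nf

lemma fourierAt_withEntry (a : ι) (z : ℝ) (ζ : Vel ι) (f : Vel ι →₁[volume] ℝ) :
    fourierAt (withEntry a z ζ) f
      = oscIntegral volume (fun x : Vel ι => x a)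
        (fun x => planeWave (withEntry a 0 ζ) x * (f x : ℂ)) 0 z := by
  rw [fourierAt_apply, oscIntegral]
  congr 1
  ext x
  rw [pow_zero, one_mul, ← mul_assoc, planeWave, planeWave, ← Complex.exp_add, inner_withEntry]
  congr 2
  push_cast
  ring

lemma gauss_eq_oscIntegral (z : ℝ) :
    (gauss z : ℂ) = oscIntegral volume (fun w : ℝ => w) (fun w => (gauss w : ℂ)) 0 z := by
  rw [← gauss_neg, ← fourier_gauss, oscIntegral]
  congr 1
  ext w
  rw [pow_zero, one_mul]
  congr 2
  push_cast
  ring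

/-- Dependence of the deviation on one frequency: it is twice differentiable, and its second
difference is controlled by the fourth moments. -/
lemma exists_derivatives_deviationAt (a : ι) (ζ : Vel ι) (f : Vel ι →₁[volume] ℝ) {m₄ : ℝ}
    (hf1 : ∫ x, ‖f x‖ ≤ 1) (h2 : Integrable fun x : Vel ι => x a ^ 2 * ‖f x‖)
    (h4 : Integrable fun x : Vel ι => x a ^ 4 * ‖f x‖) (hm4 : ∫ x : Vel ι, x a ^ 4 * ‖f x‖ ≤ m₄) :
    ∃ κ₁ κ₂ : ℝ → ℂ, (∀ z, HasDerivAt (fun z => deviationAt (withEntry a z ζ) f) (κ₁ z) z) ∧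
      (∀ z, HasDerivAt κ₁ (κ₂ z) z) ∧
      ∀ z h : ℝ, ‖deviationAt (withEntry a (z + h) ζ) f + deviationAt (withEntry a (z - h) ζ) f
        - 2 * deviationAt (withEntry a z ζ) f - h ^ 2 * κ₂ z‖
        ≤ (2 * π) ^ 4 * (m₄ + 3 * (2 * π)⁻¹ ^ 2) * h ^ 4 := by
  have hf := L1.integrable_coeFn f
  set F : Vel ι → ℂ := fun x => planeWave (withEntry a 0 ζ) x * (f x : ℂ) with hFdef
  have hF : Integrable F := integrable_planeWave_mul _ hf
  have hFn : ∀ x, ‖F x‖ = ‖f x‖ := fun x => by simp [hFdef, norm_planeWave]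
  have ha : Measurable fun x : Vel ι => x a := by fun_prop
  have ab4 : ∀ y : ℝ, |y| ^ 4 = y ^ 4 := fun y => by
    rw [← abs_pow, abs_of_nonneg (by positivity)]
  have F2 : Integrable fun x : Vel ι => |x a| ^ 2 * ‖F x‖ := by simpa only [hFn, sq_abs] using h2
  have F4 : Integrable fun x : Vel ι => |x a| ^ 4 * ‖F x‖ := by simpa only [hFn, ab4] using h4
  have F0 : Integrable fun x : Vel ι => |x a| ^ 0 * ‖F x‖ := by simpa using hF.norm
  -- The first moment is dominated by mass plus second moment.
  have F1 : Integrable fun x : Vel ι => |x a| ^ 1 * ‖F x‖ := by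
    refine (F0.add F2).mono' ((Continuous.aestronglyMeasurable (by fun_prop)).mul hF.1.norm)
      (Filter.Eventually.of_forall fun x => ?_)
    rw [Real.norm_of_nonneg (by positivity), Pi.add_apply, ← add_mul]
    refine mul_le_mul_of_nonneg_right ?_ (norm_nonneg _)
    nlinarith [sq_nonneg (|x a| - 1), abs_nonneg (x a)]
  have gn : ∀ w, ‖(gauss w : ℂ)‖ = gauss w := fun w => by
    rw [Complex.norm_real, Real.norm_of_nonneg (gauss_nonneg _)]
  have hg : Integrable fun w => (gauss w : ℂ) := integrable_gauss.ofReal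
  have hgm : AEStronglyMeasurable (fun w => (gauss w : ℂ)) volume := hg.1
  have gk : ∀ k : ℕ, Integrable fun w : ℝ => |w| ^ k * ‖(gauss w : ℂ)‖ := fun k => by
    have := (integrable_pow_mul_gauss k).norm
    refine this.congr (Filter.Eventually.of_forall fun w => ?_)
    simp only [gn, norm_mul, norm_pow, Real.norm_eq_abs, abs_of_nonneg (gauss_nonneg w)]
  -- The Maxwellian factors over the entries, so its share of the deviation is `m` times the
  -- one-dimensional `gauss z`, itself an oscillatory integral, with `‖m‖ ≤ 1`.
  set m : ℂ := maxwellian (withEntry a 0 ζ) * fourierAt 0 f with hm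
  have hm1 : ‖m‖ ≤ 1 := by
    rw [hm, norm_mul, Complex.norm_real, Real.norm_of_nonneg (maxwellian_nonneg _)]
    exact mul_le_one₀ (maxwellian_le_one _) (norm_nonneg _) ((norm_fourierAt_le _ _).trans hf1)
  set u := oscIntegral volume (fun x : Vel ι => x a) F
  set v := oscIntegral volume (fun w : ℝ => w) (fun w => (gauss w : ℂ))
  have hκ : ∀ z, deviationAt (withEntry a z ζ) f = u 0 z - m * v 0 z := fun z => by
    rw [deviationAt_apply, fourierAt_withEntry, maxwellian_withEntry]
    push_cast
    rw [gauss_eq_oscIntegral z]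
    ring
  refine ⟨fun z => u 1 z - m * v 1 z, fun z => u 2 z - m * v 2 z, fun z => ?_, fun z => ?_,
    fun z h => ?_⟩
  · simp only [hκ]
    exact (hasDerivAt_oscIntegral ha hF.1 F0 F1 z).sub
      ((hasDerivAt_oscIntegral measurable_id hgm (gk 0) (gk 1) z).const_mul m)
  · exact (hasDerivAt_oscIntegral ha hF.1 F1 F2 z).sub
      ((hasDerivAt_oscIntegral measurable_id hgm (gk 1) (gk 2) z).const_mul m)
  · simp only [hκ]
    have e : u 0 (z + h) - m * v 0 (z + h) + (u 0 (z - h) - m * v 0 (z - h))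
        - 2 * (u 0 z - m * v 0 z) - h ^ 2 * (u 2 z - m * v 2 z)
        = (u 0 (z + h) + u 0 (z - h) - 2 * u 0 z - h ^ 2 * u 2 z)
          - m * (v 0 (z + h) + v 0 (z - h) - 2 * v 0 z - h ^ 2 * v 2 z) := by ring
    rw [e]
    have n1 := norm_second_difference_oscIntegral_le ha hF.1 hF F2 F4 z h
    have n2 := norm_second_difference_oscIntegral_le (a := fun w : ℝ => w) measurable_id hgm hg
      (gk 2) (gk 4) z h
    simp only [hFn, ab4] at n1
    simp only [gn, ab4, integral_fourth_mul_gauss] at n2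
    have n3 : ‖m * (v 0 (z + h) + v 0 (z - h) - 2 * v 0 z - h ^ 2 * v 2 z)‖
        ≤ (2 * π) ^ 4 * (3 * (2 * π)⁻¹ ^ 2) * h ^ 4 := by
      rw [norm_mul]
      exact (mul_le_of_le_one_left (norm_nonneg _) hm1).trans n2
    refine (norm_sub_le _ _).trans ((add_le_add n1 n3).trans ?_)
    have : (2 * π) ^ 4 * (∫ x : Vel ι, x a ^ 4 * ‖f x‖) * h ^ 4 ≤ (2 * π) ^ 4 * m₄ * h ^ 4 := by
      gcongr
    nlinarith

end Entry

end

section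

variable {M N : ℕ}

/-! ### Comparison of the two generators -/

lemma sysOnly_collideBath_eq_withEntry (i : Fin M) (θ : ℝ) (ζ : Vel (Fin M ⊕ Fin N)) :
    sysOnly (collideBath (Sum.inl i) θ 0 ζ)
      = withEntry (Sum.inl i) (ζ (Sum.inl i) * Real.cos θ) (sysOnly ζ) := by
  ext k
  rcases k with k | k
  · simp [collideBath, withEntry, Function.update_apply]
  · simp [withEntry]

lemma sysOnly_collide_eq_withEntry (i : Fin M) (j : Fin N) (θ : ℝ) (ζ : Vel (Fin M ⊕ Fin N)) :
    sysOnly (collide (Sum.inl i) (Sum.inr j) θ ζ)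
      = withEntry (Sum.inl i) (ζ (Sum.inl i) * Real.cos θ + ζ (Sum.inr j) * Real.sin θ)
        (sysOnly ζ) := by
  ext k
  rcases k with k | k
  · simp [collide, withEntry, Function.update_apply]
  · simp [withEntry]

lemma maxwellian_resPart_collide (i : Fin M) (j : Fin N) (θ : ℝ) (ζ : Vel (Fin M ⊕ Fin N)) :
    maxwellian (resPart (collide (Sum.inl i) (Sum.inr j) θ ζ))
      = (∏ k ∈ Finset.univ.erase j, gauss (ζ (Sum.inr k))) *
        gauss (-ζ (Sum.inl i) * Real.sin θ + ζ (Sum.inr j) * Real.cos θ) := by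
  rw [maxwellian, ← Finset.mul_prod_erase _ _ (Finset.mem_univ j), mul_comm]
  congr 1
  · refine Finset.prod_congr rfl fun k hk => ?_
    simp [collide, Finset.ne_of_mem_erase hk]
  · simp [collide]

lemma maxwellian_resPart_eq (j : Fin N) (ζ : Vel (Fin M ⊕ Fin N)) :
    maxwellian (resPart ζ)
      = (∏ k ∈ Finset.univ.erase j, gauss (ζ (Sum.inr k))) * gauss (ζ (Sum.inr j)) := by
  rw [maxwellian, ← Finset.mul_prod_erase _ _ (Finset.mem_univ j), mul_comm]
  rfl

/-- The reservoir is independent of the system and Maxwellian. -/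
def ReservoirAtEquilibrium (f : State M N) : Prop :=
  ∀ ζ, fourierAt ζ f = maxwellian (resPart ζ) * fourierAt (sysOnly ζ) f

lemma ReservoirAtEquilibrium.deviationAt_eq {f : State M N} (hf : ReservoirAtEquilibrium f)
    (ζ : Vel (Fin M ⊕ Fin N)) :
    deviationAt ζ f = maxwellian (resPart ζ) * deviationAt (sysOnly ζ) f := by
  have h : resPart (sysOnly ζ) = 0 := rfl
  rw [deviationAt_apply, deviationAt_apply, hf ζ, maxwellian_split ζ, maxwellian_split (sysOnly ζ),
    sysPart_sysOnly, h, maxwellian_zero]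
  push_cast
  ring

/-- A Maxwellian reservoir is rotation invariant, so collisions inside it contribute nothing to the
generator difference. -/
lemma ReservoirAtEquilibrium.fourierAt_collisionOp_reservoir {f : State M N}
    (hf : ReservoirAtEquilibrium f) {i j : Fin N} (hij : i ≠ j) (ζ : Vel (Fin M ⊕ Fin N)) :
    fourierAt ζ (collisionOp (Sum.inr i) (Sum.inr j) (Sum.inr_injective.ne hij) f)
      = fourierAt ζ f := by
  rw [collisionCovariant_fourierAt]
  have h : ∀ θ, fourierAt (collide (Sum.inr i) (Sum.inr j) θ ζ) f = fourierAt ζ f := fun θ => by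
    have h1 : resPart (collide (Sum.inr i) (Sum.inr j) θ ζ) = collide i j θ (resPart ζ) := by
      ext k
      simp only [resPart_apply, collide, Function.update_apply, Sum.inr.injEq]
    have h2 : sysOnly (collide (Sum.inr i) (Sum.inr j) θ ζ) = sysOnly ζ := by
      ext k
      rcases k with k | k <;> simp [collide]
    rw [hf, h1, h2, maxwellian_collide hij, ← hf]
  simp only [h, angleMean_const]

/-- The bounds on a state that control the difference of the generators. -/
structure CloseToEquilibrium (f : State M N) (A D : ℝ) : Prop where
  reservoir : ReservoirAtEquilibrium f
  deviation : ∀ ζ, ‖deviationAt ζ f‖ ≤ D * ‖sysPart ζ‖ ^ 2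
  moments : (momentGauge M N A).Le f A

/-- The difference between a thermostat collision and a reservoir collision in terms of the
dependence of the deviation on a single frequency. -/
lemma ReservoirAtEquilibrium.fourierAt_sub_eq {f : State M N} (hf : ReservoirAtEquilibrium f)
    (i : Fin M) (j : Fin N) (ζ : Vel (Fin M ⊕ Fin N)) :
    fourierAt ζ (thermostatOp (Sum.inl i) f)
      - fourierAt ζ (collisionOp (Sum.inl i) (Sum.inr j) Sum.inl_ne_inr f)
      = ((∏ k ∈ Finset.univ.erase j, gauss (ζ (Sum.inr k)) : ℝ) : ℂ) *
        (angleMean (fun θ => deviationAt (withEntry (Sum.inl i) (ζ (Sum.inl i) * Real.cos θ)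
          (sysOnly ζ)) f * gauss (ζ (Sum.inl i) * Real.sin θ)) * gauss (ζ (Sum.inr j))
        - angleMean (fun θ => deviationAt (withEntry (Sum.inl i)
          (ζ (Sum.inl i) * Real.cos θ + ζ (Sum.inr j) * Real.sin θ) (sysOnly ζ)) f
          * gauss (-ζ (Sum.inl i) * Real.sin θ + ζ (Sum.inr j) * Real.cos θ))) := by
  -- Both operators conserve mass, so the Maxwellian parts cancel and the transform can be replaced
  -- by the deviation, which is small.
  have hd : fourierAt ζ (thermostatOp (Sum.inl i) f)
      - fourierAt ζ (collisionOp (Sum.inl i) (Sum.inr j) Sum.inl_ne_inr f)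
      = deviationAt ζ (thermostatOp (Sum.inl i) f)
        - deviationAt ζ (collisionOp (Sum.inl i) (Sum.inr j) Sum.inl_ne_inr f) := by
    rw [deviationAt_apply, deviationAt_apply, fourierAt_zero_collisionOp,
      fourierAt_zero_thermostatOp]
    ring
  rw [hd, thermostatCovariant_deviationAt, collisionCovariant_deviationAt, mul_sub,
    ← angleMean_const_mul, mul_comm (angleMean _) (gauss _ : ℂ), ← mul_assoc,
    ← angleMean_const_mul]
  congr 2
  · ext θ
    rw [hf.deviationAt_eq, resPart_collideBath, sysOnly_collideBath_eq_withEntry,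
      maxwellian_resPart_eq j, Complex.ofReal_mul]
    ring
  · ext θ
    rw [hf.deviationAt_eq, maxwellian_resPart_collide, sysOnly_collide_eq_withEntry,
      Complex.ofReal_mul]
    ring

/-- The moment bounds feed the interpolation for the dependence on the `i`-th frequency, and the
radial comparison is then applied with `G = √(D * L)`. -/
lemma CloseToEquilibrium.norm_sub_le {f : State M N} {A D L : ℝ} (hf : CloseToEquilibrium f A D)
    (hA : 0 < A) (hD : 0 ≤ D) (hL : (2 * π) ^ 4 * (3 * A + 3 * (2 * π)⁻¹ ^ 2) + D ≤ L)
    (i : Fin M) (j : Fin N) (ζ : Vel (Fin M ⊕ Fin N)) :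
    ‖fourierAt ζ (thermostatOp (Sum.inl i) f)
      - fourierAt ζ (collisionOp (Sum.inl i) (Sum.inr j) Sum.inl_ne_inr f)‖
      ≤ 5 * √(D * L) * (((1 - gauss (ζ (Sum.inr j))) *
        ∏ k ∈ Finset.univ.erase j, gauss (ζ (Sum.inr k))) * ‖sysPart ζ‖ ^ 2
        + ζ (Sum.inr j) ^ 2) := by
  have hπ := Real.pi_pos
  have hmom := momentGauge_le_iff.1 hf.moments
  -- The mass weight and the gauge bound are the same number `A`, so the norm is at most one.
  have hf1 : ∫ x, ‖f x‖ ≤ 1 := by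
    have h := (integrable_and_integral_le_of_lintegral_le (continuous_momentWeight A .mass).measurable
      (momentWeight_nonneg hA.le .mass) hA.le (hmom .mass)).2
    simp only [momentWeight, integral_const_mul] at h
    exact le_of_mul_le_mul_left (h.trans_eq (mul_one A).symm) hA
  have h2 : Integrable fun x : Vel (Fin M ⊕ Fin N) => x (Sum.inl i) ^ 2 * ‖f x‖ := by
    have h := (integrable_and_integral_le_of_lintegral_le
      (continuous_momentWeight A (.sq i)).measurable
      (momentWeight_nonneg hA.le (.sq i)) hA.le (hmom (.sq i))).1.const_mul (2 * π)
    refine h.congr (Filter.Eventually.of_forall fun x => ?_)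
    simp only [momentWeight]
    field_simp
  obtain ⟨h4, h4'⟩ := integrable_and_integral_le_of_lintegral_le
    (continuous_momentWeight A (.quart i)).measurable
    (momentWeight_nonneg hA.le (.quart i)) hA.le (hmom (.quart i))
  have e4 : ∀ x : Vel (Fin M ⊕ Fin N), x (Sum.inl i) ^ 4 * ‖f x‖
      = 3 * (momentWeight A (.quart i) x * ‖f x‖) := fun x => by
    simp only [momentWeight]
    ring
  have h4i : Integrable fun x : Vel (Fin M ⊕ Fin N) => x (Sum.inl i) ^ 4 * ‖f x‖ := by
    simp only [e4]
    exact h4.const_mul 3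
  have h4b : ∫ x : Vel (Fin M ⊕ Fin N), x (Sum.inl i) ^ 4 * ‖f x‖ ≤ 3 * A := by
    simp only [e4, integral_const_mul]
    linarith
  obtain ⟨κ₁, κ₂, hκ₁, hκ₂, hT⟩ := exists_derivatives_deviationAt (Sum.inl i) (sysOnly ζ) f hf1
    h2 h4i h4b
  set κ : ℝ → ℂ := fun z => deviationAt (withEntry (Sum.inl i) z (sysOnly ζ)) f with hκdef
  set x := ζ (Sum.inl i) with hx
  set y := ζ (Sum.inr j) with hy
  set P := ∏ k ∈ Finset.univ.erase j, gauss (ζ (Sum.inr k)) with hP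
  -- The contribution of the other system frequencies, constant while the `i`-th one varies.
  set ρ := ‖sysPart ζ‖ ^ 2 - x ^ 2 with hρdef
  have hP0 : 0 ≤ P := Finset.prod_nonneg fun k _ => gauss_nonneg _
  have hP1 : P ≤ 1 := Finset.prod_le_one (fun k _ => gauss_nonneg _) fun k _ => gauss_le_one _
  have hρ : 0 ≤ ρ := by
    have h := norm_sq_withEntry i 0 (sysPart ζ)
    rw [sysPart_apply] at h
    have := sq_nonneg ‖withEntry i 0 (sysPart ζ)‖
    rw [hρdef, hx]
    linarith
  have hκ : ∀ z, ‖κ z‖ ≤ D * (ρ + z ^ 2) := fun z => by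
    refine (hf.deviation _).trans (le_of_eq ?_)
    have h : sysPart (withEntry (Sum.inl i) z (sysOnly ζ)) = withEntry i z (sysPart ζ) := by
      ext k
      simp [withEntry, Function.update_apply]
    rw [h, norm_sq_withEntry, sysPart_apply]
  have hF0 : 0 ≤ (2 * π) ^ 4 * (3 * A + 3 * (2 * π)⁻¹ ^ 2) := by positivity
  have hκ₂b := norm_second_deriv_le hD hF0 hL hκ hT
  have hDG : D ≤ √(D * L) := Real.le_sqrt_of_sq_le (by nlinarith)
  have hmain := norm_angleMean_difference_le hD hDG hρ hκ₁ hκ₂ hκ hκ₂b x y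
  rw [hf.reservoir.fourierAt_sub_eq i j ζ, norm_mul, Complex.norm_real, Real.norm_of_nonneg hP0]
  refine (mul_le_mul_of_nonneg_left hmain hP0).trans ?_
  have hρx : ρ + x ^ 2 = ‖sysPart ζ‖ ^ 2 := by rw [hρdef]; ring
  rw [hρx]
  -- The product `P` is dropped from the `y ^ 2` term but kept next to `1 - gauss y`, where the
  -- summation over `j` depends on it.
  have hs := mul_nonneg (Real.sqrt_nonneg (D * L)) (mul_nonneg (sub_nonneg.2 hP1) (sq_nonneg y))
  nlinarith

/-- Summing over all `N` reservoir particles costs no factor `N`: the weights on `‖sysPart ζ‖ ^ 2`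
add up to at most one, and the remaining squares to `‖resPart ζ‖ ^ 2`. -/
lemma CloseToEquilibrium.norm_sum_sub_le {f : State M N} {A D L : ℝ}
    (hf : CloseToEquilibrium f A D)
    (hA : 0 < A) (hD : 0 ≤ D) (hL : (2 * π) ^ 4 * (3 * A + 3 * (2 * π)⁻¹ ^ 2) + D ≤ L)
    (i : Fin M) (ζ : Vel (Fin M ⊕ Fin N)) :
    ‖∑ j : Fin N, (fourierAt ζ (thermostatOp (Sum.inl i) f)
      - fourierAt ζ (collisionOp (Sum.inl i) (Sum.inr j) Sum.inl_ne_inr f))‖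
      ≤ 5 * √(D * L) * ‖ζ‖ ^ 2 := by
  refine (norm_sum_le _ _).trans ((Finset.sum_le_sum fun j _ =>
    hf.norm_sub_le hA hD hL i j ζ).trans ?_)
  rw [← Finset.mul_sum, Finset.sum_add_distrib, ← Finset.sum_mul]
  refine mul_le_mul_of_nonneg_left ?_ (by positivity)
  have h1 := sum_one_sub_mul_prod_erase_le Finset.univ
    (p := fun j : Fin N => gauss (ζ (Sum.inr j))) (fun _ => gauss_nonneg _) fun _ => gauss_le_one _
  have h2 : ‖resPart ζ‖ ^ 2 = ∑ j, ζ (Sum.inr j) ^ 2 := by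
    simp [EuclideanSpace.norm_sq_eq]
  rw [norm_sq_split, h2]
  have := mul_le_of_le_one_left (sq_nonneg ‖sysPart ζ‖) h1
  linarith

/-- Values of a functional on the difference of two generators. -/
lemma map_generator_sub {E : Type*} [NormedAddCommGroup E] [NormedSpace ℝ E] {α β γ : Type*}
    [Fintype α] [Fintype β] [Fintype γ] (χ : E →L[ℝ] ℂ) (S : E →L[ℝ] E) (R : α → E →L[ℝ] E)
    (T : β → E →L[ℝ] E) (I : β → γ → E →L[ℝ] E) {r m : ℝ} (hγ : (Fintype.card γ : ℝ) ≠ 0) {x : E}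
    (hR : ∀ p, χ (R p x) = χ x) :
    χ ((S + m • ∑ i, (T i - 1)) x
      - (S + r • ∑ p, (R p - 1) + (m / Fintype.card γ) • ∑ i, ∑ j, (I i j - 1)) x)
      = ((m / Fintype.card γ : ℝ) : ℂ) * ∑ i, ∑ j, (χ (T i x) - χ (I i j x)) := by
  have hγ' : (Fintype.card γ : ℂ) ≠ 0 := by exact_mod_cast hγ
  have h1 : ∀ P : E →L[ℝ] E, χ ((P - 1) x) = χ (P x) - χ x := fun P => by
    rw [sub_apply, one_apply_eq_self, map_sub]
  simp only [add_apply, smul_apply, sum_apply, map_sub, map_add, map_smul, map_sum, h1, hR,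
    sub_self, Finset.sum_const_zero, smul_zero, Complex.real_smul]
  simp only [Finset.sum_sub_distrib, Finset.sum_const, Finset.card_univ, nsmul_eq_mul,
    ← Finset.mul_sum]
  push_cast
  field_simp
  ring

lemma CloseToEquilibrium.norm_generator_sub_le (hN : 0 < N) {f : State M N} {A D L : ℝ}
    (hf : CloseToEquilibrium f A D)
    (hA : 0 < A) (hD : 0 ≤ D) (hL : (2 * π) ^ 4 * (3 * A + 3 * (2 * π)⁻¹ ^ 2) + D ≤ L)
    (lamS lamR : ℝ) {mu : ℝ} (hmu : 0 ≤ mu) (ζ : Vel (Fin M ⊕ Fin N)) :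
    ‖fourierAt ζ (genThermostat M N lamS mu f - genFinite M N lamS lamR mu f)‖
      ≤ mu / N * (M * (5 * √(D * L))) * ‖ζ‖ ^ 2 := by
  have hN' : (0 : ℝ) < N := by exact_mod_cast hN
  have h := map_generator_sub (fourierAt ζ) (genS M N lamS)
    (fun p : {p : Fin N × Fin N // p.1 < p.2} =>
      collisionOp (Sum.inr p.1.1) (Sum.inr p.1.2) (Sum.inr_injective.ne p.2.ne))
    (fun i : Fin M => thermostatOp (Sum.inl i))
    (fun (i : Fin M) (j : Fin N) => collisionOp (Sum.inl i) (Sum.inr j) Sum.inl_ne_inr)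
    (r := lamR / ((N : ℝ) - 1)) (m := mu) (by rw [Fintype.card_fin]; exact hN'.ne') (x := f)
    (fun p => hf.reservoir.fourierAt_collisionOp_reservoir p.2.ne ζ)
  rw [Fintype.card_fin] at h
  have h' : fourierAt ζ (genThermostat M N lamS mu f - genFinite M N lamS lamR mu f)
      = ((mu / N : ℝ) : ℂ) * ∑ i : Fin M, ∑ j : Fin N, (fourierAt ζ (thermostatOp (Sum.inl i) f)
        - fourierAt ζ (collisionOp (Sum.inl i) (Sum.inr j) Sum.inl_ne_inr f)) := h
  rw [h', norm_mul, Complex.norm_real, Real.norm_of_nonneg (by positivity), mul_assoc]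
  refine mul_le_mul_of_nonneg_left ?_ (by positivity)
  refine (norm_sum_le _ _).trans ((Finset.sum_le_sum fun i _ =>
    hf.norm_sum_sub_le hA hD hL i ζ).trans (le_of_eq ?_))
  rw [Finset.sum_const, Finset.card_univ, Fintype.card_fin, nsmul_eq_mul, ← mul_assoc]

end

/-! ### Finiteness of the initial distance -/

/-- Taylor's formula for `|u| ≤ 1`; otherwise the triangle inequality and `2 + |u| ≤ 3 u²`. -/
lemma norm_exp_mul_I_sub_one_sub_le (u : ℝ) :
    ‖Complex.exp ((u : ℂ) * Complex.I) - 1 - (u : ℂ) * Complex.I‖ ≤ 3 * u ^ 2 := by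
  have hn : ‖(u : ℂ) * Complex.I‖ = |u| := by simp
  rcases le_total |u| 1 with h | h
  · have h1 := Complex.norm_exp_sub_one_sub_id_le (hn.le.trans h)
    rw [hn, sq_abs] at h1
    linarith [sq_nonneg u]
  · have h1 : ‖Complex.exp ((u : ℂ) * Complex.I) - 1 - (u : ℂ) * Complex.I‖ ≤ 1 + 1 + |u| := by
      refine (norm_sub_le _ _).trans (add_le_add ((norm_sub_le _ _).trans ?_) hn.le)
      rw [Complex.norm_exp_ofReal_mul_I, norm_one]
    have h2 : |u| ^ 2 = u ^ 2 := sq_abs u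
    nlinarith

section Finite

variable {ι : Type*} [Fintype ι]

lemma integrable_entry_mul {l : Vel ι → ℝ} (hl : Integrable l) {i : ι}
    (h2 : Integrable fun v : Vel ι => v i ^ 2 * l v) : Integrable fun v : Vel ι => v i * l v := by
  have hm : AEStronglyMeasurable (fun v : Vel ι => v i) volume :=
    (by fun_prop : Continuous fun v : Vel ι => v i).aestronglyMeasurable
  refine (hl.norm.add h2.norm).mono' (hm.mul hl.1) (Filter.Eventually.of_forall fun v => ?_)
  simp only [Pi.add_apply, Real.norm_eq_abs, abs_mul, abs_pow, sq_abs]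
  have h3 : |v i| ≤ 1 + v i ^ 2 := by
    rw [← sq_abs]
    nlinarith [sq_nonneg (|v i| - 1), abs_nonneg (v i)]
  nlinarith [abs_nonneg (l v)]

lemma inner_sq_le (v ξ : Vel ι) : (inner ℝ v ξ) ^ 2 ≤ ‖ξ‖ ^ 2 * ∑ i, v i ^ 2 := by
  have h := abs_real_inner_le_norm v ξ
  have h2 : ‖v‖ ^ 2 = ∑ i, v i ^ 2 := by simp [EuclideanSpace.norm_sq_eq]
  rw [← h2, ← sq_abs, ← mul_pow, mul_comm]
  exact pow_le_pow_left₀ (abs_nonneg _) h 2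

/-- A centred density with finite second moments agrees with the constant `1` to second order in
Fourier space. -/
lemma norm_fourier_sub_one_le {l : Vel ι → ℝ} (hl : Integrable l) (h1 : ∫ v, l v = 1)
    (hmean : ∀ i, ∫ v, v i * l v = 0) (h2 : ∀ i, Integrable fun v => v i ^ 2 * l v) (ξ : Vel ι) :
    ‖𝓕 (fun v => (l v : ℂ)) ξ - 1‖
      ≤ 3 * (2 * π) ^ 2 * (∑ i, ∫ v, ‖v i ^ 2 * l v‖) * ‖ξ‖ ^ 2 := by
  have hin : ∀ v : Vel ι, inner ℝ v ξ * l v = ∑ i, ξ i * (v i * l v) := fun v => by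
    rw [PiLp.inner_apply, Finset.sum_mul]
    refine Finset.sum_congr rfl fun i _ => ?_
    simp
    ring
  have hi1 : Integrable fun v : Vel ι => inner ℝ v ξ * l v := by
    simp only [hin]
    exact integrable_finsetSum _ fun i _ => (integrable_entry_mul hl (h2 i)).const_mul _
  have hz : ∫ v : Vel ι, inner ℝ v ξ * l v = 0 := by
    simp only [hin]
    rw [integral_finsetSum _ fun i _ => (integrable_entry_mul hl (h2 i)).const_mul _]
    simp [integral_const_mul, hmean]
  have hlin : Integrable fun v : Vel ι => (-2 * π * Complex.I) * ((inner ℝ v ξ * l v : ℝ) : ℂ) :=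
    hi1.ofReal.const_mul _
  have key : 𝓕 (fun v => (l v : ℂ)) ξ - 1
      = ∫ v : Vel ι, (planeWave ξ v * (l v : ℂ) - (l v : ℂ)
        - (-2 * π * Complex.I) * ((inner ℝ v ξ * l v : ℝ) : ℂ)) := by
    have hlc : Integrable fun v : Vel ι => (l v : ℂ) := hl.ofReal
    have hd : Integrable fun v : Vel ι => planeWave ξ v * (l v : ℂ) - (l v : ℂ) :=
      (integrable_planeWave_mul ξ hl).sub hlc
    rw [integral_sub hd hlin,
      integral_sub (integrable_planeWave_mul ξ hl) hlc, fourier_eq_integral_planeWave,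
      integral_const_mul, integral_complex_ofReal, integral_complex_ofReal, hz, h1]
    simp
  have hbi : Integrable fun v : Vel ι => ∑ i, 3 * (2 * π) ^ 2 * ‖ξ‖ ^ 2 * ‖v i ^ 2 * l v‖ :=
    integrable_finsetSum _ fun i _ => (h2 i).norm.const_mul _
  rw [key]
  refine (norm_integral_le_of_norm_le hbi (Filter.Eventually.of_forall fun v => ?_)).trans
    (le_of_eq ?_)
  · have he : planeWave ξ v * (l v : ℂ) - (l v : ℂ)
        - (-2 * π * Complex.I) * ((inner ℝ v ξ * l v : ℝ) : ℂ)
        = (Complex.exp (((-2 * π * inner ℝ v ξ : ℝ) : ℂ) * Complex.I) - 1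
          - ((-2 * π * inner ℝ v ξ : ℝ) : ℂ) * Complex.I) * (l v : ℂ) := by
      rw [planeWave]
      push_cast
      ring
    rw [he, norm_mul, Complex.norm_real]
    refine (mul_le_mul_of_nonneg_right (norm_exp_mul_I_sub_one_sub_le _) (norm_nonneg _)).trans ?_
    have h3 : ∑ i, 3 * (2 * π) ^ 2 * ‖ξ‖ ^ 2 * ‖v i ^ 2 * l v‖
        = 3 * (2 * π) ^ 2 * (‖ξ‖ ^ 2 * ∑ i, v i ^ 2) * ‖l v‖ := by
      rw [Finset.mul_sum, Finset.mul_sum, Finset.sum_mul]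
      refine Finset.sum_congr rfl fun i _ => ?_
      rw [norm_mul, Real.norm_of_nonneg (sq_nonneg (v i))]
      ring
    rw [h3]
    refine mul_le_mul_of_nonneg_right ?_ (norm_nonneg _)
    have h4 := mul_le_mul_of_nonneg_left (inner_sq_le v ξ) (by positivity : 0 ≤ 3 * (2 * π) ^ 2)
    calc 3 * (-2 * π * inner ℝ v ξ) ^ 2 = 3 * (2 * π) ^ 2 * (inner ℝ v ξ) ^ 2 := by ring
      _ ≤ _ := h4
  · rw [integral_finsetSum _ fun i _ => (h2 i).norm.const_mul _]
    simp only [integral_const_mul]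
    rw [← Finset.mul_sum]
    ring

lemma norm_one_sub_maxwellian_le (ξ : Vel ι) : ‖(1 : ℂ) - (maxwellian ξ : ℂ)‖ ≤ π * ‖ξ‖ ^ 2 := by
  have h1 : maxwellian ξ ≤ 1 := by
    rw [maxwellian_eq, Real.exp_le_one_iff]
    nlinarith [Real.pi_pos, sq_nonneg ‖ξ‖]
  have h2 : 1 - π * ‖ξ‖ ^ 2 ≤ maxwellian ξ := by
    rw [maxwellian_eq]
    linarith [Real.add_one_le_exp (-π * ‖ξ‖ ^ 2)]
  rw [← Complex.ofReal_one, ← Complex.ofReal_sub, Complex.norm_real, Real.norm_of_nonneg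
    (by linarith)]
  linarith

lemma gtwDist_le {f g : Vel ι → ℝ} {C : ℝ}
    (h : ∀ ξ, ‖𝓕 (fun v => (f v : ℂ)) ξ - 𝓕 (fun v => (g v : ℂ)) ξ‖ ≤ C * ‖ξ‖ ^ 2) :
    gtwDist f g ≤ ENNReal.ofReal C := by
  refine iSup₂_le fun ξ hξ => ENNReal.ofReal_le_ofReal ?_
  have hξ' : 0 < ‖ξ‖ := norm_pos_iff.2 hξ
  rw [div_le_iff₀ (by positivity)]
  exact h ξ

/-- The frequency `0` is excluded from the supremum; equality of the masses covers it. -/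
lemma norm_fourier_sub_le_gtwDist {f g : Vel ι → ℝ} (hfg : gtwDist f g ≠ ⊤)
    (h0 : ∫ v, f v = ∫ v, g v) (ξ : Vel ι) :
    ‖𝓕 (fun v => (f v : ℂ)) ξ - 𝓕 (fun v => (g v : ℂ)) ξ‖ ≤ (gtwDist f g).toReal * ‖ξ‖ ^ 2 := by
  by_cases hξ : ξ = 0
  · subst hξ
    rw [fourier_eq_integral_planeWave, fourier_eq_integral_planeWave]
    simp only [planeWave, inner_zero_right, mul_zero, Complex.ofReal_zero, zero_mul,
      Complex.exp_zero, one_mul]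
    rw [integral_complex_ofReal, integral_complex_ofReal, h0]
    simp
  · have hξ' : 0 < ‖ξ‖ := norm_pos_iff.2 hξ
    rw [← div_le_iff₀ (by positivity)]
    refine (ENNReal.ofReal_le_iff_le_toReal hfg).1 ?_
    exact le_iSup₂ (f := fun (ξ : Vel ι) (_ : ξ ≠ 0) => ENNReal.ofReal
      (‖𝓕 (fun v => (f v : ℂ)) ξ - 𝓕 (fun v => (g v : ℂ)) ξ‖ / ‖ξ‖ ^ 2)) ξ hξ

lemma gtwDist_maxwellian_ne_top {l : Vel ι → ℝ} (hl : Integrable l) (h1 : ∫ v, l v = 1)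
    (hmean : ∀ i, ∫ v, v i * l v = 0) (h2 : ∀ i, Integrable fun v => v i ^ 2 * l v) :
    gtwDist l maxwellian ≠ ⊤ := by
  refine ne_top_of_le_ne_top ENNReal.ofReal_ne_top (gtwDist_le
    (C := 3 * (2 * π) ^ 2 * (∑ i, ∫ v, ‖v i ^ 2 * l v‖) + π) fun ξ => ?_)
  have h := (norm_add_le (𝓕 (fun v => (l v : ℂ)) ξ - 1) (1 - (maxwellian ξ : ℂ))).trans
    (add_le_add (norm_fourier_sub_one_le hl h1 hmean h2 ξ) (norm_one_sub_maxwellian_le ξ))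
  rw [fourier_maxwellian, add_mul]
  rwa [sub_add_sub_cancel] at h

end Finite

/-! ### Duhamel's formula -/

/-- Two one-parameter groups are close, when tested against `χ`, if their generators are close
along the orbit of the first one. -/
lemma norm_exp_smul_sub_exp_smul_le {E : Type*} [NormedAddCommGroup E] [NormedSpace ℝ E]
    [CompleteSpace E] (A B : E →L[ℝ] E) (χ : E →L[ℝ] ℂ) (x : E) {c k t : ℝ} (ht : 0 ≤ t)
    (hk : k ≠ 0)
    (h : ∀ s ∈ Ico 0 t, ‖χ (NormedSpace.exp ((t - s) • B)
      (A (NormedSpace.exp (s • A) x) - B (NormedSpace.exp (s • A) x)))‖ ≤ c * Real.exp (-k * s)) :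
    ‖χ (NormedSpace.exp (t • A) x) - χ (NormedSpace.exp (t • B) x)‖
      ≤ c / k * (1 - Real.exp (-k * t)) := by
  -- `U` interpolates between the group of `B` at `s = 0` and that of `A` at `s = t`.
  let U : ℝ → E →L[ℝ] E := fun s => NormedSpace.exp ((t - s) • B) * NormedSpace.exp (s • A)
  have hU : ∀ s, HasDerivAt U
      (NormedSpace.exp ((t - s) • B) * (A - B) * NormedSpace.exp (s • A)) s := fun s => by
    have h1 : HasDerivAt (fun s : ℝ => NormedSpace.exp (s • A)) (A * NormedSpace.exp (s • A)) s :=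
      hasDerivAt_exp_smul_const' A s
    have h2 : HasDerivAt (fun s : ℝ => NormedSpace.exp ((t - s) • B))
        ((-1 : ℝ) • (NormedSpace.exp ((t - s) • B) * B)) s :=
      (hasDerivAt_exp_smul_const B (t - s)).scomp s ((hasDerivAt_id s).const_sub t)
    refine (h2.mul h1).congr_deriv ?_
    rw [neg_one_smul]
    noncomm_ring
  let V : ℝ → ℂ := fun s => χ (U s x) - χ (U 0 x)
  have hV : ∀ s, HasDerivAt V (χ (NormedSpace.exp ((t - s) • B)
      (A (NormedSpace.exp (s • A) x) - B (NormedSpace.exp (s • A) x)))) s := fun s => by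
    have h1 : HasDerivAt (fun s => U s x)
        ((NormedSpace.exp ((t - s) • B) * (A - B) * NormedSpace.exp (s • A)) x) s :=
      (ContinuousLinearMap.apply ℝ E x).hasFDerivAt.comp_hasDerivAt s (hU s)
    exact (χ.hasFDerivAt.comp_hasDerivAt s h1).sub_const _
  have hbd : ∀ s, HasDerivAt (fun s => c / k * (1 - Real.exp (-k * s)))
      (c * Real.exp (-k * s)) s := fun s => by
    have h1 : HasDerivAt (fun s => Real.exp (-k * s)) (Real.exp (-k * s) * (-k * 1)) s :=
      ((hasDerivAt_id s).const_mul (-k)).exp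
    refine ((h1.const_sub 1).const_mul (c / k)).congr_deriv ?_
    field_simp
  -- A comparison of derivatives replaces the time integral.
  have hfin := image_norm_le_of_norm_deriv_right_le_deriv_boundary (f := V) (a := 0) (b := t)
    (fun s _ => (hV s).continuousAt.continuousWithinAt) (fun s _ => (hV s).hasDerivWithinAt)
    (by simp [V]) hbd h (right_mem_Icc.2 ht)
  simpa [V, U] using hfin

section

variable {M N : ℕ}

/-! ### Comparison of the two evolutions -/

lemma closeToEquilibrium_thermostatEvolution (hM : 0 < M) {lamS mu : ℝ} (hlamS : 0 ≤ lamS)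
    (hmu : 0 ≤ mu) {A D : ℝ} (hA : (2 * π)⁻¹ ^ 2 ≤ A) (hD : 0 ≤ D)
    {l : Vel (Fin M) → ℝ} (hl : Integrable l) (h1 : ∫ v, l v = 1)
    (hdev : ∀ ξ, ‖𝓕 (fun v => (l v : ℂ)) ξ
      - 𝓕 (fun v : Vel (Fin M) => (maxwellian v : ℂ)) ξ‖ ≤ D * ‖ξ‖ ^ 2)
    (hmom : (momentGauge M N A).Le (initialState N hl) A) {s : ℝ} (hs : 0 ≤ s) :
    CloseToEquilibrium (thermostatEvolution lamS mu s (initialState N hl)) A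
      (Real.exp (-(mu / 2) * s) * D) where
  reservoir := fourierAt_thermostatEvolution_initialState hM hlamS hmu hs hl
  deviation := norm_deviationAt_thermostatEvolution_le hM hlamS hmu hs hD
    (norm_deviationAt_initialState_le hl h1 hdev)
  moments :=
    have hA0 : 0 ≤ A := le_trans (by positivity) hA
    momentGauge_thermostatEvolution_le hM hlamS hmu hs hA0 hA hA0 hmom

/-- The finite reservoir evolution does not increase bounds by `‖ζ‖ ^ 2` in Fourier space. -/
lemma norm_fourierAt_finiteEvolution_le (hM : 0 < M) (hN : 0 < N) {lamS lamR mu t C : ℝ}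
    (hlamS : 0 ≤ lamS) (hlamR : 0 ≤ lamR) (hmu : 0 ≤ mu) (ht : 0 ≤ t) (hC : 0 ≤ C)
    {f : State M N} (hf : ∀ ζ, ‖fourierAt ζ f‖ ≤ C * ‖ζ‖ ^ 2) (ζ : Vel (Fin M ⊕ Fin N)) :
    ‖fourierAt ζ (finiteEvolution lamS lamR mu t f)‖ ≤ C * ‖ζ‖ ^ 2 :=
  (functionalGauge fourierAt (fun ζ => ‖ζ‖ ^ 2) fun _ => sq_nonneg _).finiteEvolution_le hM hN
    hlamS hlamR hmu ht hC (fun _ _ hab => (collisionCovariant_fourierAt hab).opLe _ fun ζ θ => by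
      rw [norm_collide hab]) hf ζ

lemma norm_fourierAt_evolution_sub_le (hM : 0 < M) (hN : 0 < N) {lamS lamR mu : ℝ}
    (hlamS : 0 ≤ lamS) (hlamR : 0 ≤ lamR) (hmu : 0 < mu) {A D L : ℝ} (hA : (2 * π)⁻¹ ^ 2 ≤ A)
    (hD : 0 ≤ D) (hL : (2 * π) ^ 4 * (3 * A + 3 * (2 * π)⁻¹ ^ 2) + D ≤ L)
    {l : Vel (Fin M) → ℝ} (hl : Integrable l) (h1 : ∫ v, l v = 1)
    (hdev : ∀ ξ, ‖𝓕 (fun v => (l v : ℂ)) ξ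
      - 𝓕 (fun v : Vel (Fin M) => (maxwellian v : ℂ)) ξ‖ ≤ D * ‖ξ‖ ^ 2)
    (hmom : (momentGauge M N A).Le (initialState N hl) A) {t : ℝ} (ht : 0 ≤ t)
    (ζ : Vel (Fin M ⊕ Fin N)) :
    ‖fourierAt ζ (thermostatEvolution lamS mu t (initialState N hl))
        - fourierAt ζ (finiteEvolution lamS lamR mu t (initialState N hl))‖
      ≤ 20 * M / N * (1 - Real.exp (-(mu / 4) * t)) * √(D * L) * ‖ζ‖ ^ 2 := by
  have hA0 : 0 < A := lt_of_lt_of_le (by positivity) hA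
  have hN' : (0 : ℝ) < N := by exact_mod_cast hN
  -- The square root halves the decay rate of the deviation, from `mu / 2` to `mu / 4`.
  have hsqrt : ∀ s, √(Real.exp (-(mu / 2) * s) * D * L)
      = Real.exp (-(mu / 4) * s) * √(D * L) := fun s => by
    have he : Real.exp (-(mu / 2) * s) = Real.exp (-(mu / 4) * s) ^ 2 := by
      rw [← Real.exp_nat_mul]
      congr 1
      push_cast
      ring
    rw [mul_assoc, Real.sqrt_mul (Real.exp_pos _).le, he, Real.sqrt_sq (Real.exp_pos _).le]
  have hgen : ∀ s ∈ Ico 0 t, ‖fourierAt ζ (finiteEvolution lamS lamR mu (t - s)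
      (genThermostat M N lamS mu (thermostatEvolution lamS mu s (initialState N hl))
        - genFinite M N lamS lamR mu (thermostatEvolution lamS mu s (initialState N hl))))‖
      ≤ mu / N * (M * (5 * √(D * L))) * ‖ζ‖ ^ 2 * Real.exp (-(mu / 4) * s) := fun s hs => by
    have hc := closeToEquilibrium_thermostatEvolution hM hlamS hmu.le hA hD hl h1 hdev hmom hs.1
    -- Only the factor `D` under the root needs to decay; `L` is fixed for all times because the
    -- deviation never exceeds its initial bound.
    have hle : Real.exp (-(mu / 2) * s) * D ≤ D :=
      mul_le_of_le_one_left hD (Real.exp_le_one_iff.2 (by nlinarith [hs.1]))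
    have hb := norm_fourierAt_finiteEvolution_le hM hN hlamS hlamR hmu.le
      (sub_nonneg.2 hs.2.le) (by positivity) (fun ζ => hc.norm_generator_sub_le hN hA0
        (by positivity) ((add_le_add_right hle _).trans hL) lamS lamR hmu.le ζ) ζ
    refine hb.trans (le_of_eq ?_)
    rw [hsqrt]
    ring
  refine (norm_exp_smul_sub_exp_smul_le (genThermostat M N lamS mu) (genFinite M N lamS lamR mu)
    (fourierAt ζ) (initialState N hl) ht (by positivity : mu / 4 ≠ 0) hgen).trans (le_of_eq ?_)
  field_simp
  ring

lemma gtwDist_evolution_le (hM : 0 < M) (hN : 0 < N) {lamS lamR mu : ℝ}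
    (hlamS : 0 ≤ lamS) (hlamR : 0 ≤ lamR) (hmu : 0 < mu)
    {l : Vel (Fin M) → ℝ} (hl : Integrable l) (hl0 : 0 ≤ᵐ[volume] l) (h1 : ∫ v, l v = 1)
    (h2 : ∀ i, Integrable fun v => v i ^ 2 * l v) {E₄ : ℝ}
    (h4 : ∀ i, Integrable fun v => v i ^ 4 * l v) (hE₄ : ∀ i, ∫ v, v i ^ 4 * l v = E₄)
    (hfin : gtwDist l maxwellian ≠ ⊤) {t : ℝ} (ht : 0 ≤ t) :
    gtwDist (thermostatEvolution lamS mu t (initialState N hl))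
        (finiteEvolution lamS lamR mu t (initialState N hl)) ≤
      ENNReal.ofReal (16 * √2 * M / N * (1 - Real.exp (-(mu / 4) * t)) *
        √((gtwDist l maxwellian).toReal *
          (48 * π ^ 4 * (E₄ + 1) + (gtwDist l maxwellian).toReal))) := by
  set D := (gtwDist l maxwellian).toReal
  have hπ := Real.pi_gt_three
  have hE : 0 ≤ E₄ := by
    rw [← hE₄ ⟨0, hM⟩]
    refine integral_nonneg_of_ae ?_
    filter_upwards [hl0] with v hv
    exact mul_nonneg (by positivity) hv
  have hinv : (2 * π)⁻¹ ^ 2 ≤ E₄ + 1 / 2 := by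
    have h3 : (2 * π)⁻¹ ≤ 1 / 2 := by
      rw [inv_le_comm₀ (by positivity) (by norm_num)]
      linarith
    nlinarith [inv_pos.2 Real.two_pi_pos]
  -- The left side without `D` is `48 π⁴ E₄ + 24 π⁴ + 12 π²`, and `12 π² ≤ 24 π⁴`; this is where
  -- `F₄` comes from.
  have hL : (2 * π) ^ 4 * (3 * (E₄ + 1 / 2) + 3 * (2 * π)⁻¹ ^ 2) + D
      ≤ 48 * π ^ 4 * (E₄ + 1) + D := by
    have h3 : (2 * π) ^ 4 * (3 * (E₄ + 1 / 2) + 3 * (2 * π)⁻¹ ^ 2)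
        = 48 * π ^ 4 * E₄ + 24 * π ^ 4 + 12 * π ^ 2 := by
      field_simp
      ring
    rw [h3]
    nlinarith [sq_nonneg π, sq_nonneg (π ^ 2 - 1)]
  have hdev := norm_fourier_sub_le_gtwDist hfin (h1.trans integral_maxwellian.symm)
  refine gtwDist_le fun ζ => ?_
  rw [fourier_coe, fourier_coe]
  refine (norm_fourierAt_evolution_sub_le hM hN hlamS hlamR hmu hinv ENNReal.toReal_nonneg hL hl h1
    hdev (momentGauge_initialState hl hl0 h1 hE h2 h4 hE₄) ht ζ).trans ?_
  have h20 : (20 : ℝ) ≤ 16 * √2 := by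
    have : (5 / 4 : ℝ) ≤ √2 := Real.le_sqrt_of_sq_le (by norm_num)
    linarith
  have hexp : 0 ≤ 1 - Real.exp (-(mu / 4) * t) :=
    sub_nonneg.2 (Real.exp_le_one_iff.2 (by nlinarith))
  gcongr

end

end KacReservoir

end

/-! ### Main theorem -/

theorem mainTheorem2 (M N : ℕ) (hM : 0 < M) (hN : 0 < N)
    (lamS lamR mu : ℝ) (hlamS : 0 ≤ lamS) (hlamR : 0 ≤ lamR) (hmu : 0 < mu)
    (l₀ : Vel (Fin M) → ℝ) (hl₀ : Integrable l₀) (hl₀_nonneg : 0 ≤ᵐ[volume] l₀)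
    (hl₀_one : ∫ v, l₀ v = 1)
    (hl₀_symm : ∀ σ : Equiv.Perm (Fin M),
      (fun v : Vel (Fin M) => l₀ (WithLp.toLp 2 fun i => v (σ i))) =ᵐ[volume] l₀)
    (hl₀_mean : ∀ i, ∫ v, v i * l₀ v = 0)
    (hl₀_second : ∀ i, Integrable fun v => v i ^ 2 * l₀ v)
    (E₄ : ℝ) (hl₀_fourth : ∀ i, Integrable fun v => v i ^ 4 * l₀ v)
    (hE₄ : ∀ i, ∫ v, v i ^ 4 * l₀ v = E₄) :
    gtwDist l₀ maxwellian ≠ ⊤ ∧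
    ∀ t : ℝ, 0 < t →
      gtwDist (thermostatEvolution lamS mu t (initialState N hl₀))
          (finiteEvolution lamS lamR mu t (initialState N hl₀)) ≤
        ENNReal.ofReal (16 * √2 * M / N * (1 - Real.exp (-(mu / 4) * t)) *
          √((gtwDist l₀ maxwellian).toReal *
            (48 * π ^ 4 * (E₄ + 1) + (gtwDist l₀ maxwellian).toReal))) := by
  have hfin := gtwDist_maxwellian_ne_top hl₀ hl₀_one hl₀_mean hl₀_second
  exact ⟨hfin, fun t ht => gtwDist_evolution_le hM hN hlamS hlamR hmu hl₀ hl₀_nonneg hl₀_one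
    hl₀_second hl₀_fourth hE₄ hfin ht.le⟩
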